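/- Let $k$ be a fixed natural number and let $\Sigma=(\Sigma_1,\dots,\Sigma_k)$ denote a tuple of finite alphabets, with product monoid $S=\Sigma_1^*\times\cdots\times\Sigma_k^*$; the length of a tuple is the total length of its words. A (nondeterministic) $k$-tape automaton $A$ over $\Sigma$ consists of a finite set $Q$ of states, a set $E\subseteq Q\times S^{(1)}\times Q$ of edges, where $S^{(1)}$ is the set of elements of $S$ of length one, and sets of initial and of final states. The multiplicity $A(s)$ of $s\in S$ is the number of runs (finite, possibly empty, paths of edges) of $A$ from an initial to a final state such that the product of the labels of the edges is $s$. Automata $A$ and $B$ over the same alphabets are multiplicity equivalent if $A(s)=B(s)$ for all $s\in S$, and language equivalent if $\{s : A(s)>0\}=\{s : B(s)>0\}$. An automaton is deterministic if it has exactly one initial state and each state reads letters from a single tape only and has exactly one transition for every letter of that tape. Algorithms are probabilistic, get a pair of automata over the same alphabets as input (the states and the letters being listed explicitly, so that the size of the input is at least their number), and have a running time that is bounded, for all outcomes of the coin tosses, by a polynomial (which may depend on $k$) in the size of the input. For each fixed $k$: (a) Multiplicity equivalence of $k$-tape automata can be decided in randomised polynomial time: there is such an algorithm that always answers correctly if the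 two automata are multiplicity equivalent, and answers correctly with probability at least $1/2$ if they are not. (b) Consequently, language equivalence of deterministic $k$-tape automata can be decided in randomised polynomial time, in the same sense. (c) There is such an algorithm that, given two $k$-tape automata $A$ and $B$ that are not multiplicity equivalent, outputs with probability at least $1/2$ a tuple $s\in S$ with $A(s)\neq B(s)$. -/

import Mathlib

/-! # Multitape automata -/

namespace Multitape

/-- The product monoid `S = Σ₁* × ⋯ × Σₖ*` of tuples of words. -/
abbrev Tuple {k : ℕ} (α : Fin k → Type) : Type := (i : Fin k) → FreeMonoid (α i)

/-- A letter together with the tape it stands on. These are exactly the elements of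
length one of `Tuple α`, see `Letter.toTuple`. -/
abbrev Letter {k : ℕ} (α : Fin k → Type) : Type := (i : Fin k) × α i

/-- The tuple of total length one with the given letter on the given tape and the
empty word on all other tapes. -/
def Letter.toTuple {k : ℕ} {α : Fin k → Type} (x : Letter α) : Tuple α :=
  Pi.mulSingle x.1 (FreeMonoid.of x.2)

/-- A (nondeterministic) `k`-tape automaton with alphabets `α i` and set of states `Q`. -/
structure Automaton {k : ℕ} (α : Fin k → Type) (Q : Type) where
  edges : Set (Q × Letter α × Q)
  start : Set Q
  final : Set Q

namespace Automaton

variable {k : ℕ} {α : Fin k → Type} {Q : Type}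

/-- `A.IsRun p ρ q`: the sequence of edges `ρ` is a run of `A` from `p` to `q`. -/
inductive IsRun (A : Automaton α Q) : Q → List (Q × Letter α × Q) → Q → Prop
  | nil (q : Q) : IsRun A q [] q
  | cons {p : Q} {x : Letter α} {q r : Q} {ρ : List (Q × Letter α × Q)} :
      (p, x, q) ∈ A.edges → IsRun A q ρ r → IsRun A p ((p, x, q) :: ρ) r

/-- The label of a sequence of edges: the product in `Tuple α` of the labels of its edges. -/
def label (ρ : List (Q × Letter α × Q)) : Tuple α :=
  (ρ.map fun e => e.2.1.toTuple).prod

/-- The accepting runs of `A` with label `s`, each with its first and its last state. -/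
def acceptingRuns (A : Automaton α Q) (s : Tuple α) : Set (Q × List (Q × Letter α × Q) × Q) :=
  {x | x.1 ∈ A.start ∧ x.2.2 ∈ A.final ∧ A.IsRun x.1 x.2.1 x.2.2 ∧ label x.2.1 = s}

/-- The multiplicity `A(s)`: the number of accepting runs with label `s`. -/
noncomputable def mult (A : Automaton α Q) (s : Tuple α) : ℕ := (A.acceptingRuns s).ncard

/-- The relation accepted by `A`. -/
def language (A : Automaton α Q) : Set (Tuple α) := {s | (A.acceptingRuns s).Nonempty}

/-- There is exactly one initial state, every state reads letters from a single tape only, and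
it has exactly one transition for every letter of that tape. -/
def IsDeterministic (A : Automaton α Q) : Prop :=
  (∃ q, A.start = {q}) ∧
  ∀ p, ∃ i : Fin k,
    (∀ x q, (p, x, q) ∈ A.edges → x.1 = i) ∧ ∀ a : α i, ∃! q, (p, (⟨i, a⟩ : Letter α), q) ∈ A.edges

end Automaton

/-- Two automata over the same alphabets are multiplicity equivalent. -/
def MultEquiv {k : ℕ} {α : Fin k → Type} {Q Q' : Type}
    (A : Automaton α Q) (B : Automaton α Q') : Prop :=
  ∀ s, A.mult s = B.mult s

/-! ## Encodings as finite sequences of natural numbers -/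

/-- A pair of finite `k`-tape automata over the same finite alphabets; the letters of tape `i`
are numbered `0, …, m i - 1`, the states of the automata `0, …, nA - 1` and `0, …, nB - 1`. -/
structure AutomatonPair (k : ℕ) where
  m : Fin k → ℕ
  nA : ℕ
  nB : ℕ
  A : Automaton (fun i => Fin (m i)) (Fin nA)
  B : Automaton (fun i => Fin (m i)) (Fin nB)

open Classical in
/-- The truth value of a proposition as a number. -/
noncomputable def bit (p : Prop) : ℕ := if p then 1 else 0

/-- An automaton is encoded by the characteristic sequences of its initial states, of its final
states and of its set of edges (a table over all source states, letters and target states). -/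
noncomputable def Automaton.encode {k n : ℕ} {m : Fin k → ℕ}
    (A : Automaton (fun i => Fin (m i)) (Fin n)) : List ℕ :=
  ((List.finRange n).map fun q => bit (q ∈ A.start)) ++
  ((List.finRange n).map fun q => bit (q ∈ A.final)) ++
  (List.finRange n).flatMap fun p => (List.finRange k).flatMap fun i =>
    (List.finRange (m i)).flatMap fun a => (List.finRange n).map fun q =>
      bit ((p, (⟨i, a⟩ : Letter fun i => Fin (m i)), q) ∈ A.edges)

/-- A pair of automata is encoded by the numbers of states, the sizes of the alphabets and
the tables of the two automata. -/
noncomputable def AutomatonPair.encode {k : ℕ} (x : AutomatonPair k) : List ℕ :=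
  x.nA :: x.nB :: (List.ofFn x.m ++ (x.A.encode ++ x.B.encode))

/-- A tuple of words is encoded tape by tape, the length of each word followed by its letters. -/
def encodeTuple {k : ℕ} {m : Fin k → ℕ} (s : Tuple fun i => Fin (m i)) : List ℕ :=
  (List.finRange k).flatMap fun i =>
    (FreeMonoid.toList (s i)).length :: (FreeMonoid.toList (s i)).map Fin.val

end Multitape

/-! # Randomised random access machines with logarithmic cost -/

namespace RAM

/-- Memory cells `0, 1, 2, …` holding natural numbers, and the coin tosses still to come. -/
structure State where
  mem : ℕ → ℕ
  coins : List Bool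

/-- The arithmetic operations of the machine; subtraction is truncated. -/
inductive Op
  | add | sub | mul | div | mod

/-- The value of an arithmetic operation. -/
def Op.eval : Op → ℕ → ℕ → ℕ
  | add, a, b => a + b
  | sub, a, b => a - b
  | mul, a, b => a * b
  | div, a, b => a / b
  | mod, a, b => a % b

/-- Basic instructions. -/
inductive Instr
  /-- write the constant `c` into cell `d` -/
  | const (d c : ℕ)
  /-- write the content of cell `a` into cell `d` -/
  | copy (d a : ℕ)
  /-- apply an operation to the contents of cells `a` and `b`, write the result into cell `d` -/
  | arith (o : Op) (d a b : ℕ)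
  /-- write the content of the cell whose address is in cell `a` into cell `d` -/
  | load (d a : ℕ)
  /-- write the content of cell `b` into the cell whose address is in cell `a` -/
  | store (a b : ℕ)
  /-- toss a fair coin and write the result, `0` or `1`, into cell `d` -/
  | toss (d : ℕ)

/-- The state with the content of cell `d` replaced by `v`. -/
def State.write (s : State) (d v : ℕ) : State := { s with mem := Function.update s.mem d v }

/-- The effect of a basic instruction. -/
def Instr.exec : Instr → State → State
  | const d c, s => s.write d c
  | copy d a, s => s.write d (s.mem a)
  | arith o d a b, s => s.write d (o.eval (s.mem a) (s.mem b))
  | load d a, s => s.write d (s.mem (s.mem a))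
  | store a b, s => s.write (s.mem a) (s.mem b)
  | toss d, s => { s.write d (if s.coins.headD false then 1 else 0) with coins := s.coins.tail }

/-- The logarithmic cost of a basic instruction: one plus the binary lengths of the operands and
of the addresses held in memory cells that it handles. -/
def Instr.cost : Instr → State → ℕ
  | const _ c, _ => 1 + Nat.size c
  | copy _ a, s => 1 + Nat.size (s.mem a)
  | arith _ _ a b, s => 1 + Nat.size (s.mem a) + Nat.size (s.mem b)
  | load _ a, s => 1 + Nat.size (s.mem a) + Nat.size (s.mem (s.mem a))
  | store a b, s => 1 + Nat.size (s.mem a) + Nat.size (s.mem b)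
  | toss _, _ => 1

/-- Programs: sequencing, branching on whether a cell is nonzero, repetition while a cell is
nonzero. -/
inductive Program
  | instr (i : Instr)
  | seq (P R : Program)
  | branch (a : ℕ) (P R : Program)
  | loop (a : ℕ) (P : Program)

/-- `Exec P s s' t`: started in state `s`, the program `P` halts in state `s'`, and the total
cost of the computation is `t`. -/
inductive Exec : Program → State → State → ℕ → Prop
  | instr (i : Instr) (s : State) : Exec (.instr i) s (i.exec s) (i.cost s)
  | seq {P R : Program} {s s' s'' : State} {t t' : ℕ} :
      Exec P s s' t → Exec R s' s'' t' → Exec (.seq P R) s s'' (t + t')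
  | branch_true {a : ℕ} {P R : Program} {s s' : State} {t : ℕ} :
      s.mem a ≠ 0 → Exec P s s' t → Exec (.branch a P R) s s' (1 + Nat.size (s.mem a) + t)
  | branch_false {a : ℕ} {P R : Program} {s s' : State} {t : ℕ} :
      s.mem a = 0 → Exec R s s' t → Exec (.branch a P R) s s' (1 + t)
  | loop_true {a : ℕ} {P : Program} {s s' s'' : State} {t t' : ℕ} :
      s.mem a ≠ 0 → Exec P s s' t → Exec (.loop a P) s' s'' t' →
      Exec (.loop a P) s s'' (1 + Nat.size (s.mem a) + t + t')
  | loop_false {a : ℕ} {P : Program} {s : State} :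
      s.mem a = 0 → Exec (.loop a P) s s 1

/-- The final state and the cost are determined by the program and the initial state. -/
theorem Exec.unique {P : Program} {s s₁ s₂ : State} {t₁ t₂ : ℕ}
    (h₁ : Exec P s s₁ t₁) (h₂ : Exec P s s₂ t₂) : s₁ = s₂ ∧ t₁ = t₂ := by
  induction h₁ generalizing s₂ t₂ with
  | instr i s => cases h₂; exact ⟨rfl, rfl⟩
  | seq _ _ ih ih' =>
    cases h₂ with
    | seq g g' =>
      obtain ⟨rfl, rfl⟩ := ih g
      obtain ⟨rfl, rfl⟩ := ih' g'
      exact ⟨rfl, rfl⟩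
  | branch_true h _ ih =>
    cases h₂ with
    | branch_true _ g => obtain ⟨rfl, rfl⟩ := ih g; exact ⟨rfl, rfl⟩
    | branch_false h' _ => exact absurd h' h
  | branch_false h _ ih =>
    cases h₂ with
    | branch_true h' _ => exact absurd h h'
    | branch_false _ g => obtain ⟨rfl, rfl⟩ := ih g; exact ⟨rfl, rfl⟩
  | loop_true h _ _ ih ih' =>
    cases h₂ with
    | loop_true _ g g' =>
      obtain ⟨rfl, rfl⟩ := ih g
      obtain ⟨rfl, rfl⟩ := ih' g'
      exact ⟨rfl, rfl⟩
    | loop_false h' => exact absurd h' h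
  | loop_false h =>
    cases h₂ with
    | loop_true h' _ _ => exact absurd h h'
    | loop_false _ => exact ⟨rfl, rfl⟩

/-- The initial state on input `x`: cell `0` holds the length of `x`, the following cells hold
the entries of `x`, and all other cells hold `0`. -/
def State.initial (x : List ℕ) (r : List Bool) : State where
  mem := fun j => (x.length :: x).getD j 0
  coins := r

/-- The output of a state: cell `0` holds its length, the following cells its entries. -/
def State.output (s : State) : List ℕ := (List.range (s.mem 0)).map fun j => s.mem (j + 1)

/-- On input `x` and with the coin tosses `r`, the program halts at cost at most `T` with
output `y`. -/
def Outputs (P : Program) (x : List ℕ) (r : List Bool) (T : ℕ) (y : List ℕ) : Prop :=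
  ∃ s t, Exec P (State.initial x r) s t ∧ t ≤ T ∧ s.output = y

/-- The size of an input in binary notation, with one extra symbol per entry. -/
def inputSize (x : List ℕ) : ℕ := (x.map fun a => Nat.size a + 1).sum

/-- The probability of an event in `T` independent tosses of a fair coin. -/
noncomputable def coinProb (T : ℕ) (E : List Bool → Prop) : ℚ :=
  (Nat.card {r : Fin T → Bool // E (List.ofFn r)} : ℚ) / 2 ^ T

/-- The program halts within `p (size of the input)` steps on every instance and for all
outcomes of the coin tosses. (A toss costs `1`, so at most that many coins are tossed.) -/
def RunsInTime {ι : Type} (enc : ι → List ℕ) (P : Program) (p : Polynomial ℕ) : Prop :=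
  ∀ (x : ι) (r : List Bool), r.length = p.eval (inputSize (enc x)) →
    ∃ y, Outputs P (enc x) r (p.eval (inputSize (enc x))) y

/-- The probability that the output of the program on input `x`, with time and coins bounded
by `T`, has the property `R`. -/
noncomputable def outputProb (P : Program) (x : List ℕ) (T : ℕ) (R : List ℕ → Prop) : ℚ :=
  coinProb T fun r => ∃ y, Outputs P x r T y ∧ R y

/-- The problem "does the instance `x` have the property `Y`?" is decided in randomised
polynomial time with one-sided error: yes-instances are always answered correctly by `1`,
no-instances are answered correctly by `0` with probability at least one half. -/
def DecidableInRandPolyTime {ι : Type} (enc : ι → List ℕ) (Y : ι → Prop) : Prop :=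
  ∃ (P : Program) (p : Polynomial ℕ), RunsInTime enc P p ∧
    ∀ x : ι,
      (Y x → outputProb P (enc x) (p.eval (inputSize (enc x))) (fun y => y = [1]) = 1) ∧
      (¬ Y x → 1 / 2 ≤ outputProb P (enc x) (p.eval (inputSize (enc x))) (fun y => y = [0]))

/-- The function problem "given an instance `x` that has a solution, compute a solution" is
solved in randomised polynomial time: on every such instance the output is a solution with
probability at least one half. -/
def SearchInRandPolyTime {ι : Type} (enc : ι → List ℕ) (Sol : ι → List ℕ → Prop) : Prop :=
  ∃ (P : Program) (p : Polynomial ℕ), RunsInTime enc P p ∧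
    ∀ x : ι, (∃ y, Sol x y) →
      1 / 2 ≤ outputProb P (enc x) (p.eval (inputSize (enc x))) (Sol x)

end RAM

/-! Give every letter of tape `i` that stands at position `j` of its word, counted from the end, an
indeterminate weight. For a tuple `p` of lengths, the sum of the weights of all accepting runs
reading words of lengths `p` is a polynomial of degree at most `∑ i, p i`, in which the monomial of
a tuple `s` has the coefficient `A(s)` (`Automaton.value_eq`). Two automata are thus multiplicity
equivalent if and only if these polynomials agree for all `p`.

It suffices to look at tuples shorter than the total number `n` of states (`multEquiv_of_agree`).
For a position `r` in `ℕ^k` and a length `l`, collect into one vector, indexed by a position `P` and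
a state, the sums over runs of length `l` that lead from `P` down to `r`. For `r` in a box of side
`D` and `l ≤ n` there are `(n + 1) * D ^ k` such vectors with `n * (D + n) ^ k` relevant entries.
For large `D` this forces a nontrivial linear relation over the polynomial ring (`exists_relation`).
Because weights depend on absolute positions, a step in front of a run acts on all vectors in the
same way, so the relation survives when all lengths are increased by the same amount
(`relation_add`). Suppose a shortest tuple distinguishing the automata has length `m ≥ n`. Shift the
relation so that its longest runs have length `m`: by minimality only these contribute to the
difference of the automata. What remains is a vanishing convolution of nonzero coefficients with
nonzero differences; since `ℕ^k` has the unique sums property, some position isolates a single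
product, and polynomial rings have no zero divisors.

The algorithm replaces the indeterminates by random numbers below a power of two `2 ^ b` with `2 * N
≤ 2 ^ b < 4 * N`, where `N` is the length of the input sequence. By the Schwartz–Zippel lemma a
difference at a fixed `p` of total length below `n ≤ N` stays visible with probability at least one
half (`card_value_eq_le`). For fixed `k` there are only `N ^ k` tuples of lengths to be inspected,
and dynamic programming evaluates all of them exactly (`Good.run_dpCmd`). Equivalent automata are
never told apart. Multiplicities of deterministic automata are `0` or `1`, so the same program
decides language equivalence.

For the search, a value is the sum, over the letters `c`, of the values in which one given position
is restricted to `c`; so some `c` preserves a difference. Fixing all positions one by one leaves a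
single tuple (`Stage.run_fixCmd`, `Stage.exists_mult_ne`).

The running time is handled by a small language of bounded loops that is compiled to the machine.
All loop bounds and second factors are reduced modulo a power `M` of the input length plus a
constant; hence a fixed command takes polynomially many steps, each adding at most `M` bits to the
numbers in memory (`exists_program`). -/

/-! # Step-bounded execution -/

namespace RAM

/-- `Run G P s s' w`: started in `s`, the program `P` halts in `s'` after at most `w` steps, where each
step lengthens the contents of the memory by at most `G` bits. -/
def Run (G : ℕ) (P : Program) (s s' : State) (w : ℕ) : Prop :=
  ∀ B, (∀ j, s.mem j < 2 ^ B) → (∀ j, s'.mem j < 2 ^ (B + G * w)) ∧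
    ∃ t, t ≤ w * (1 + G + 2 * (B + G * w)) ∧ Exec P s s' t

/-- Constants and factors are less than `2 ^ G`. -/
def Instr.Ok (G : ℕ) : Instr → State → Prop
  | const _ c, _ => c < 2 ^ G
  | arith .mul _ _ b, s => s.mem b < 2 ^ G
  | _, _ => True

theorem State.write_lt {s : State} {d v N N' : ℕ} (h : ∀ j, s.mem j < N) (hN : N ≤ N')
    (hv : v < N') (j : ℕ) : (s.write d v).mem j < N' := by
  by_cases hj : j = d
  · subst hj; simpa [State.write] using hv
  · simpa [State.write, Function.update_of_ne hj] using (h j).trans_le hN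

/-- An operation on numbers of `B` bits adds at most one bit, except that a product with a factor
below `2 ^ G` may add `G` bits; constants have at most `G` bits. At most two numbers from memory or
one constant are charged, so `1 + G + 2 * B` covers the cost. -/
theorem Run.instr {G : ℕ} (hG : 1 ≤ G) (i : Instr) (s : State) (h : i.Ok G s) :
    Run G (.instr i) s (i.exec s) 1 := by
  intro B hB
  have hs : ∀ j, Nat.size (s.mem j) ≤ B := fun j => Nat.size_le.2 (hB j)
  have hpow : 2 ^ B ≤ 2 ^ (B + G * 1) := Nat.pow_le_pow_right (by norm_num) (by omega)
  have hpow2 : 2 ^ B + 2 ^ B ≤ 2 ^ (B + G * 1) :=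
    le_trans (by rw [pow_succ]; omega) (Nat.pow_le_pow_right (n := 2) (by norm_num)
      (show B + 1 ≤ B + G * 1 by omega))
  have hpow3 : 2 ^ (B + G * 1) = 2 ^ B * 2 ^ G := by rw [mul_one, pow_add]
  have hB1 : 0 < 2 ^ B := by positivity
  refine ⟨?_, _, ?_, Exec.instr i s⟩
  · cases i with
    | const d c =>
      refine State.write_lt hB hpow (lt_of_lt_of_le (h : c < 2 ^ G) ?_)
      exact Nat.pow_le_pow_right (by norm_num) (by omega)
    | copy d a => exact State.write_lt hB hpow ((hB a).trans_le hpow)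
    | arith o d a b =>
      refine State.write_lt hB hpow ?_
      have ha := hB a
      have hb := hB b
      cases o with
      | add => simp only [Op.eval]; omega
      | sub => simp only [Op.eval]; omega
      | mul =>
        simp only [Op.eval]
        rw [hpow3]
        exact Nat.mul_lt_mul_of_lt_of_le ha (le_of_lt h) (by positivity)
      | div => exact ((Nat.div_le_self _ _).trans_lt ha).trans_le hpow
      | mod => exact ((Nat.mod_le _ _).trans_lt ha).trans_le hpow
    | load d a => exact State.write_lt hB hpow ((hB _).trans_le hpow)
    | store a b => exact State.write_lt hB hpow ((hB _).trans_le hpow)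
    | toss d =>
      refine State.write_lt hB hpow ?_
      split <;> omega
  · cases i with
    | const d c =>
      have : Nat.size c ≤ G := Nat.size_le.2 h
      simp only [Instr.cost]; omega
    | copy d a => have := hs a; simp only [Instr.cost]; omega
    | arith o d a b => have := hs a; have := hs b; simp only [Instr.cost]; omega
    | load d a => have := hs a; have := hs (s.mem a); simp only [Instr.cost]; omega
    | store a b => have := hs a; have := hs b; simp only [Instr.cost]; omega
    | toss d => simp only [Instr.cost]; omega

theorem Run.mono {G : ℕ} {P : Program} {s s' : State} {w w' : ℕ} (h : Run G P s s' w)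
    (hw : w ≤ w') : Run G P s s' w' := by
  intro B hB
  obtain ⟨h1, t, ht, h2⟩ := h B hB
  have hGw : G * w ≤ G * w' := Nat.mul_le_mul_left _ hw
  exact ⟨fun j => (h1 j).trans_le (Nat.pow_le_pow_right (by norm_num) (by omega)), t,
    ht.trans (Nat.mul_le_mul hw (by omega)), h2⟩

/-- The charge per step is taken at the bit length reached at the end of the whole computation. This
dominates the charges in both parts, and the second part starts with `B + G * w` bits, so the bounds
add up. -/
theorem Run.add_time {G B w w' t t' : ℕ} (ht : t ≤ w * (1 + G + 2 * (B + G * w)))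
    (ht' : t' ≤ w' * (1 + G + 2 * (B + G * w + G * w'))) :
    t + t' ≤ (w + w') * (1 + G + 2 * (B + G * (w + w'))) := by
  have : w * (1 + G + 2 * (B + G * w)) ≤ w * (1 + G + 2 * (B + G * (w + w'))) := by
    gcongr; omega
  have : B + G * w + G * w' = B + G * (w + w') := by ring
  rw [this] at ht'
  rw [add_mul]; omega

/-- The bit bound `B` is quantified inside `Run`, so the second program can be estimated at the bit
length that the first one leaves behind. -/
theorem Run.seq {G : ℕ} {P R : Program} {s s' s'' : State} {w w' : ℕ} (h : Run G P s s' w)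
    (h' : Run G R s' s'' w') : Run G (.seq P R) s s'' (w + w') := by
  intro B hB
  obtain ⟨h1, t, ht, h2⟩ := h B hB
  obtain ⟨h1', t', ht', h2'⟩ := h' _ h1
  refine ⟨fun j => ?_, _, Run.add_time ht ht', Exec.seq h2 h2'⟩
  have := h1' j
  rwa [add_assoc, ← mul_add] at this

theorem Run.branch_true {G : ℕ} {a : ℕ} {P R : Program} {s s' : State} {w : ℕ}
    (ha : s.mem a ≠ 0) (h : Run G P s s' w) : Run G (.branch a P R) s s' (1 + w) := by
  intro B hB
  obtain ⟨h1, t, ht, h2⟩ := h B hB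
  have hGw : G * w ≤ G * (1 + w) := Nat.mul_le_mul_left _ (by omega)
  refine ⟨fun j => (h1 j).trans_le (Nat.pow_le_pow_right (by norm_num) (by omega)), _, ?_,
    Exec.branch_true ha h2⟩
  have : Nat.size (s.mem a) ≤ B := Nat.size_le.2 (hB a)
  refine Run.add_time (w := 1) (by omega) (ht.trans ?_)
  gcongr; omega

theorem Run.branch_false {G : ℕ} {a : ℕ} {P R : Program} {s s' : State} {w : ℕ}
    (ha : s.mem a = 0) (h : Run G R s s' w) : Run G (.branch a P R) s s' (1 + w) := by
  intro B hB
  obtain ⟨h1, t, ht, h2⟩ := h B hB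
  have hGw : G * w ≤ G * (1 + w) := Nat.mul_le_mul_left _ (by omega)
  refine ⟨fun j => (h1 j).trans_le (Nat.pow_le_pow_right (by norm_num) (by omega)), _, ?_,
    Exec.branch_false ha h2⟩
  refine Run.add_time (w := 1) (by omega) (ht.trans ?_)
  gcongr; omega

theorem Run.loop_false {G : ℕ} {a : ℕ} {P : Program} {s : State} (ha : s.mem a = 0) :
    Run G (.loop a P) s s 1 := by
  intro B hB
  refine ⟨fun j => (hB j).trans_le (Nat.pow_le_pow_right (by norm_num) (by omega)), _, ?_,
    Exec.loop_false ha⟩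
  omega

theorem Run.loop_true {G : ℕ} {a : ℕ} {P : Program} {s s' s'' : State} {w w' : ℕ}
    (ha : s.mem a ≠ 0) (h : Run G P s s' w) (h' : Run G (.loop a P) s' s'' w') :
    Run G (.loop a P) s s'' (1 + w + w') := by
  intro B hB
  obtain ⟨h1, t, ht, h2⟩ := h B hB
  obtain ⟨h1', t', ht', h2'⟩ := h' _ h1
  have hsz : Nat.size (s.mem a) ≤ B := Nat.size_le.2 (hB a)
  have hG : G * (1 + w + w') = G + G * w + G * w' := by ring
  refine ⟨fun j => (h1' j).trans_le (Nat.pow_le_pow_right (by norm_num) ?_), _, ?_,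
    Exec.loop_true ha h2 h2'⟩
  · omega
  · refine Run.add_time (w := 1 + w) (Run.add_time (w := 1) (by omega) (ht.trans ?_))
      (ht'.trans ?_)
    · gcongr; omega
    · gcongr; omega

/-- A loop that counts a cell down to zero. -/
theorem Run.countdown {G h w n : ℕ} {P : Program} (I : ℕ → State → Prop)
    (step : ∀ i < n, ∀ s, I i s → s.mem h = n - i →
      ∃ s', Run G P s s' w ∧ I (i + 1) s' ∧ s'.mem h = n - (i + 1))
    {s : State} (h0 : I 0 s) (hn : s.mem h = n) :
    ∃ s', Run G (.loop h P) s s' (n * (w + 1) + 1) ∧ I n s' ∧ s'.mem h = 0 := by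
  suffices H : ∀ m i, i + m = n → ∀ s, I i s → s.mem h = n - i →
      ∃ s', Run G (.loop h P) s s' (m * (w + 1) + 1) ∧ I n s' ∧ s'.mem h = 0 from
    H n 0 (by omega) s h0 (by omega)
  intro m
  induction m with
  | zero =>
    intro i hi s hs hm
    obtain rfl : i = n := by omega
    have : s.mem h = 0 := by omega
    exact ⟨s, by simpa using Run.loop_false this, hs, this⟩
  | succ m ih =>
    intro i hi s hs hm
    obtain ⟨s1, r1, i1, m1⟩ := step i (by omega) s hs hm
    obtain ⟨s2, r2, i2, m2⟩ := ih (i + 1) (by omega) s1 i1 m1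
    exact ⟨s2, (Run.loop_true (by omega) r1 r2).mono (by linarith), i2, m2⟩

@[simp] theorem State.write_coins (s : State) (d v : ℕ) : (s.write d v).coins = s.coins := rfl

@[simp] theorem State.write_mem_self (s : State) (d v : ℕ) : (s.write d v).mem d = v := by
  simp [State.write]

theorem State.write_mem_of_ne (s : State) {d j : ℕ} (v : ℕ) (h : j ≠ d) :
    (s.write d v).mem j = s.mem j := by
  simp [State.write, h]

theorem State.write_mem (s : State) (d v j : ℕ) :
    (s.write d v).mem j = if j = d then v else s.mem j := by
  simp [State.write, Function.update_apply]

theorem Run.const {G : ℕ} (hG : 1 ≤ G) {d c : ℕ} (s : State) (hc : c < 2 ^ G) :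
    Run G (.instr (.const d c)) s (s.write d c) 1 := Run.instr hG _ s hc

theorem Run.copy {G : ℕ} (hG : 1 ≤ G) (d a : ℕ) (s : State) :
    Run G (.instr (.copy d a)) s (s.write d (s.mem a)) 1 := Run.instr hG _ s trivial

theorem Run.load {G : ℕ} (hG : 1 ≤ G) (d a : ℕ) (s : State) :
    Run G (.instr (.load d a)) s (s.write d (s.mem (s.mem a))) 1 := Run.instr hG _ s trivial

theorem Run.store {G : ℕ} (hG : 1 ≤ G) (a b : ℕ) (s : State) :
    Run G (.instr (.store a b)) s (s.write (s.mem a) (s.mem b)) 1 := Run.instr hG _ s trivial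

theorem Run.arith {G : ℕ} (hG : 1 ≤ G) {o : Op} {d a b : ℕ} (s : State)
    (h : o = .mul → s.mem b < 2 ^ G) :
    Run G (.instr (.arith o d a b)) s (s.write d (o.eval (s.mem a) (s.mem b))) 1 :=
  Run.instr hG _ s (by cases o <;> first | trivial | exact h rfl)

end RAM

/-! # A language of bounded loops

The values are natural numbers, the store consists of arrays `0, 1, 2, …` indexed by the natural
numbers. All bounds of loops and all second factors are reduced modulo a number `M`, so that
the running time of a program is polynomial in `M`. Bound variables are de Bruijn indices. -/

namespace LoopLang

open RAM

/-- Expressions. -/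
inductive Expr
  | num (n : ℕ)
  | loc (i : ℕ)
  | bnd
  | get (x : ℕ) (e : Expr)
  | op (o : Op) (e e' : Expr)
  | cond (c e e' : Expr)
  | sum (n e : Expr)

/-- The operations, with the second factor of a product reduced modulo `M`. -/
def opVal (M : ℕ) : Op → ℕ → ℕ → ℕ
  | .mul, a, b => a * (b % M)
  | o, a, b => o.eval a b

/-- The value of an expression. -/
def Expr.eval (M : ℕ) (a : ℕ → ℕ → ℕ) : Expr → List ℕ → ℕ
  | num n, _ => n
  | loc i, env => env.getD i M
  | bnd, _ => M
  | get x e, env => a x (e.eval M a env)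
  | op o e e', env => opVal M o (e.eval M a env) (e'.eval M a env)
  | cond c e e', env => if c.eval M a env = 0 then e'.eval M a env else e.eval M a env
  | sum n e, env => ∑ i ∈ Finset.range (n.eval M a env % M), e.eval M a (i :: env)

/-- Commands. -/
inductive Cmd
  | skip
  | put (x : ℕ) (e e' : Expr)
  | toss (x : ℕ) (e : Expr)
  | seq (c c' : Cmd)
  | ite (e : Expr) (c c' : Cmd)
  | loop (n : Expr) (c : Cmd)

/-- The arrays and the coin tosses still to come. -/
structure Store where
  arr : ℕ → ℕ → ℕ
  coins : List Bool

/-- Write `v` to the place `i` of the array `x`. -/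
def Store.put (σ : Store) (x i v : ℕ) : Store :=
  { σ with arr := Function.update σ.arr x (Function.update (σ.arr x) i v) }

/-- Iterate `f i` for `i = 0, …, n - 1`. -/
def iter {S : Type*} (f : ℕ → S → S) (σ : S) : ℕ → S
  | 0 => σ
  | n + 1 => f n (iter f σ n)

/-- The effect of a command. -/
def Cmd.run (M : ℕ) : Cmd → List ℕ → Store → Store
  | skip, _, σ => σ
  | put x e e', env, σ => σ.put x (e.eval M σ.arr env) (e'.eval M σ.arr env)
  | toss x e, env, σ =>
    { σ.put x (e.eval M σ.arr env) (if σ.coins.headD false then 1 else 0) with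
      coins := σ.coins.tail }
  | seq c c', env, σ => c'.run M env (c.run M env σ)
  | ite e c c', env, σ => if e.eval M σ.arr env = 0 then c'.run M env σ else c.run M env σ
  | .loop n c, env, σ => iter (fun i τ => c.run M (i :: env) τ) σ (n.eval M σ.arr env % M)

/-- The number of cells used for the evaluation of an expression. -/
def Expr.height : Expr → ℕ
  | num _ => 1
  | loc _ => 1
  | bnd => 1
  | get _ e => e.height + 2
  | op _ e e' => e.height + e'.height + 1
  | cond c e e' => c.height + e.height + e'.height
  | sum n e => n.height + e.height + 5

/-- The number of cells used by a command. -/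
def Cmd.height : Cmd → ℕ
  | skip => 1
  | put _ e e' => e.height + e'.height + 3
  | toss _ e => e.height + 3
  | seq c c' => c.height + c'.height
  | ite e c c' => e.height + c.height + c'.height
  | .loop n c => n.height + c.height + 4

/-- A bound for the constants and the names of arrays in an expression. -/
def Expr.size : Expr → ℕ
  | num n => n + 1
  | loc _ => 1
  | bnd => 1
  | get x e => e.size + x + 1
  | op _ e e' => e.size + e'.size
  | cond c e e' => c.size + e.size + e'.size
  | sum n e => n.size + e.size

/-- A bound for the constants and the names of arrays in a command. -/
def Cmd.size : Cmd → ℕ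
  | skip => 1
  | put x e e' => e.size + e'.size + x + 1
  | toss x e => e.size + x + 1
  | seq c c' => c.size + c'.size
  | ite e c c' => e.size + c.size + c'.size
  | .loop n c => n.size + c.size

/-- The number of steps for the evaluation of an expression. -/
def Expr.steps (M : ℕ) : Expr → ℕ
  | num _ => 1
  | loc _ => 1
  | bnd => 1
  | get _ e => e.steps M + 5
  | op _ e e' => e.steps M + e'.steps M + 2
  | cond c e e' => c.steps M + e.steps M + e'.steps M + 1
  | sum n e => n.steps M + M * (e.steps M + 5) + 4

/-- The number of steps of a command. -/
def Cmd.steps (M : ℕ) : Cmd → ℕ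
  | skip => 1
  | put _ e e' => e.steps M + e'.steps M + 5
  | toss _ e => e.steps M + 6
  | seq c c' => c.steps M + c'.steps M
  | ite e c c' => e.steps M + c.steps M + c'.steps M + 1
  | .loop n c => n.steps M + M * (c.steps M + 4) + 3

/-- The nesting depth is fixed by the expression and each sum contributes a factor `M`, whence a
polynomial in `M`. -/
theorem Expr.exists_steps_eq (e : Expr) : ∃ p : Polynomial ℕ, ∀ M, e.steps M = p.eval M := by
  induction e with
  | num | loc | bnd => exact ⟨1, fun M => by simp [steps]⟩
  | get x e ih => obtain ⟨p, hp⟩ := ih; exact ⟨p + 5, fun M => by simp [steps, hp]⟩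
  | op o e e' ih ih' =>
    obtain ⟨p, hp⟩ := ih
    obtain ⟨q, hq⟩ := ih'
    exact ⟨p + q + 2, fun M => by simp [steps, hp, hq]⟩
  | cond c e e' ih ih' ih'' =>
    obtain ⟨p, hp⟩ := ih
    obtain ⟨q, hq⟩ := ih'
    obtain ⟨r, hr⟩ := ih''
    exact ⟨p + q + r + 1, fun M => by simp [steps, hp, hq, hr]⟩
  | sum n e ih ih' =>
    obtain ⟨p, hp⟩ := ih
    obtain ⟨q, hq⟩ := ih'
    exact ⟨p + .X * (q + 5) + 4, fun M => by simp [steps, hp, hq]⟩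

theorem Cmd.exists_steps_eq (c : Cmd) : ∃ p : Polynomial ℕ, ∀ M, c.steps M = p.eval M := by
  induction c with
  | skip => exact ⟨1, fun M => by simp [steps]⟩
  | put x e e' =>
    obtain ⟨p, hp⟩ := e.exists_steps_eq
    obtain ⟨q, hq⟩ := e'.exists_steps_eq
    exact ⟨p + q + 5, fun M => by simp [steps, hp, hq]⟩
  | toss x e =>
    obtain ⟨p, hp⟩ := e.exists_steps_eq
    exact ⟨p + 6, fun M => by simp [steps, hp]⟩
  | seq c c' ih ih' =>
    obtain ⟨p, hp⟩ := ih
    obtain ⟨q, hq⟩ := ih'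
    exact ⟨p + q, fun M => by simp [steps, hp, hq]⟩
  | ite e c c' ih ih' =>
    obtain ⟨p, hp⟩ := ih
    obtain ⟨q, hq⟩ := ih'
    obtain ⟨r, hr⟩ := e.exists_steps_eq
    exact ⟨r + p + q + 1, fun M => by simp [steps, hp, hq, hr]⟩
  | loop n c ih =>
    obtain ⟨p, hp⟩ := n.exists_steps_eq
    obtain ⟨q, hq⟩ := ih
    exact ⟨p + .X * (q + 4) + 3, fun M => by simp [steps, hp, hq]⟩

/-! ## Compilation

Cell `0` holds `M`, the cells `1, …, R - 1` serve as a stack, the entry `i` of the array `x`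
is kept in the cell `R + K * i + x`. The list `cs` contains the cells of the bound variables, and
`h` is the first free cell of the stack. -/

/-- Execute `P`, then `Q`. -/
infixr:60 " ;; " => Program.seq

/-- Replace an index in cell `h` by the address of this entry of the array `x`. -/
def address (R K x h : ℕ) : Program :=
  .instr (.const (h + 1) K) ;; .instr (.arith .mul h h (h + 1)) ;;
  .instr (.const (h + 1) (R + x)) ;; .instr (.arith .add h h (h + 1))

/-- Add one to cell `i` and subtract one from cell `n`, using cell `t`. -/
def advance (i n t : ℕ) : Program :=
  .instr (.const t 1) ;; .instr (.arith .add i i t) ;; .instr (.arith .sub n n t)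

/-- The second factor of a product in cell `h` is reduced modulo `M`. -/
def reduce (h : ℕ) : Op → Program
  | .mul => .instr (.arith .mod h h 0)
  | _ => .instr (.copy h h)

/-- A program that writes the value of an expression into cell `h`. -/
def Expr.compile (R K : ℕ) : Expr → List ℕ → ℕ → Program
  | num n, _, h => .instr (.const h n)
  | loc i, cs, h => .instr (.copy h (cs.getD i 0))
  | bnd, _, h => .instr (.copy h 0)
  | get x e, cs, h => e.compile R K cs h ;; address R K x h ;; .instr (.load h h)
  | op o e e', cs, h => e.compile R K cs h ;; e'.compile R K cs (h + 1) ;; reduce (h + 1) o ;;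
      .instr (.arith o h h (h + 1))
  | cond c e e', cs, h => c.compile R K cs h ;;
      .branch h (e.compile R K cs h) (e'.compile R K cs h)
  | sum n e, cs, h => n.compile R K cs (h + 1) ;; .instr (.arith .mod (h + 1) (h + 1) 0) ;;
      .instr (.const (h + 2) 0) ;; .instr (.const h 0) ;;
      .loop (h + 1) (e.compile R K ((h + 2) :: cs) (h + 3) ;; .instr (.arith .add h h (h + 3)) ;;
        advance (h + 2) (h + 1) (h + 3))

/-- A program with the effect of a command. -/
def Cmd.compile (R K : ℕ) : Cmd → List ℕ → ℕ → Program
  | skip, _, h => .instr (.const h 0)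
  | put x e e', cs, h => e.compile R K cs h ;; address R K x h ;; e'.compile R K cs (h + 1) ;;
      .instr (.store h (h + 1))
  | toss x e, cs, h => e.compile R K cs h ;; address R K x h ;; .instr (.toss (h + 1)) ;;
      .instr (.store h (h + 1))
  | seq c c', cs, h => c.compile R K cs h ;; c'.compile R K cs h
  | ite e c c', cs, h => e.compile R K cs h ;;
      .branch h (c.compile R K cs h) (c'.compile R K cs h)
  | .loop n c, cs, h => n.compile R K cs h ;; .instr (.arith .mod h h 0) ;;
      .instr (.const (h + 1) 0) ;;
      .loop h (c.compile R K ((h + 1) :: cs) (h + 2) ;; advance (h + 1) h (h + 2))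

/-- The parameters of a compilation. -/
structure Params (M G R K : ℕ) : Prop where
  one_le : 1 ≤ G
  pos : 1 ≤ M
  bound : M < 2 ^ G
  width : R + K < 2 ^ G

/-- The state `s` represents the arrays `a` and the values `env` of the bound variables. -/
structure Rep (M R K : ℕ) (s : State) (a : ℕ → ℕ → ℕ) (cs env : List ℕ) (h : ℕ) : Prop where
  pos : 1 ≤ h
  bound : s.mem 0 = M
  arr : ∀ x < K, ∀ i, s.mem (R + K * i + x) = a x i
  loc : cs.map s.mem = env
  lt : ∀ c ∈ cs, c < h

/-- The states agree up to cells from `h` to `R - 1`. -/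
structure Same (R h : ℕ) (s s' : State) : Prop where
  coins : s'.coins = s.coins
  low : ∀ j < h, s'.mem j = s.mem j
  high : ∀ j, R ≤ j → s'.mem j = s.mem j

theorem Same.refl (R h : ℕ) (s : State) : Same R h s s := ⟨rfl, fun _ _ => rfl, fun _ _ => rfl⟩

theorem Same.trans {R h h' : ℕ} {s s' s'' : State} (h1 : Same R h s s') (h2 : Same R h' s' s'')
    (hh : h ≤ h') : Same R h s s'' :=
  ⟨h2.coins.trans h1.coins, fun j hj => (h2.low j (by omega)).trans (h1.low j hj),
    fun j hj => (h2.high j hj).trans (h1.high j hj)⟩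

theorem Same.mono {R h h' : ℕ} {s s' : State} (h1 : Same R h s s') (hh : h' ≤ h) :
    Same R h' s s' := ⟨h1.coins, fun j hj => h1.low j (by omega), h1.high⟩

theorem Same.write {R h : ℕ} (s : State) {d : ℕ} (v : ℕ) (hd : h ≤ d) (hR : d < R) :
    Same R h s (s.write d v) :=
  ⟨rfl, fun j hj => State.write_mem_of_ne _ _ (by omega),
    fun j hj => State.write_mem_of_ne _ _ (by omega)⟩

theorem Same.write' {R h : ℕ} {s s' : State} (h1 : Same R h s s') {d : ℕ} (v : ℕ) (hd : h ≤ d)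
    (hR : d < R) : Same R h s (s'.write d v) :=
  h1.trans (Same.write s' v hd hR) le_rfl

/-! ### Correctness of the compilation -/

variable {M G R K : ℕ}

/-- Evaluation writes only to the stack between `h` and `R - 1`: cell `0` (as `1 ≤ h`), the cells of
the bound variables and the arrays are out of reach. -/
theorem Rep.same {s s' : State} {a : ℕ → ℕ → ℕ} {cs env : List ℕ} {h h' : ℕ}
    (r : Rep M R K s a cs env h) (hs : Same R h s s') (hh : h ≤ h') :
    Rep M R K s' a cs env h' where
  pos := r.pos.trans hh
  bound := (hs.low 0 r.pos).trans r.bound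
  arr x hx i := (hs.high _ (by omega)).trans (r.arr x hx i)
  loc := by
    rw [← r.loc]
    exact List.map_congr_left fun c hc => hs.low c (r.lt c hc)
  lt c hc := (r.lt c hc).trans_le hh

theorem Rep.push {s s' : State} {a : ℕ → ℕ → ℕ} {cs env : List ℕ} {h c h' v : ℕ}
    (r : Rep M R K s a cs env h) (hs : Same R h s s') (hc : h ≤ c) (hv : s'.mem c = v)
    (hh : c < h') :
    Rep M R K s' a (c :: cs) (v :: env) h' where
  pos := by omega
  bound := (hs.low 0 r.pos).trans r.bound
  arr x hx i := (hs.high _ (by omega)).trans (r.arr x hx i)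
  loc := by
    rw [List.map_cons, hv, ← r.loc]
    congr 1
    exact List.map_congr_left fun c hc => hs.low c (r.lt c hc)
  lt d hd := by
    rcases List.mem_cons.1 hd with rfl | hd
    · exact hh
    · have := r.lt d hd; omega

theorem Rep.getD {s : State} {a : ℕ → ℕ → ℕ} {cs env : List ℕ} {h : ℕ}
    (r : Rep M R K s a cs env h) (i : ℕ) : s.mem (cs.getD i 0) = env.getD i M := by
  rw [← r.loc, ← r.bound, List.getD_map]

/-- The product with `K` is an admissible step however large the index is, since only the second
factor, a constant below `2 ^ G`, is restricted. -/
theorem run_address (P : Params M G R K) {x h : ℕ} (hx : x < K) (hR : h + 2 ≤ R) (s : State) :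
    ∃ s', Run G (address R K x h) s s' 4 ∧ Same R h s s' ∧
      s'.mem h = R + K * s.mem h + x := by
  have hw := P.width
  have r1 := Run.const P.one_le (d := h + 1) (c := K) s (by omega)
  set s1 := s.write (h + 1) K with hs1
  have r2 := Run.arith P.one_le (o := .mul) (d := h) (a := h) (b := h + 1) s1
    (fun _ => by simp [hs1]; omega)
  set s2 := s1.write h _ with hs2
  have r3 := Run.const P.one_le (d := h + 1) (c := R + x) s2 (by omega)
  set s3 := s2.write (h + 1) (R + x) with hs3
  have r4 := Run.arith P.one_le (o := .add) (d := h) (a := h) (b := h + 1) s3 (by simp)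
  refine ⟨_, r1.seq (r2.seq (r3.seq r4)), ?_, ?_⟩
  · rw [hs3, hs2, hs1]
    refine (((Same.write _ _ ?_ ?_).write' _ ?_ ?_).write' _ ?_ ?_).write' _ ?_ ?_ <;> omega
  · simp [hs3, hs2, hs1, State.write_mem, Op.eval]
    ring

theorem run_advance (P : Params M G R K) {i n t h : ℕ} (hi : h ≤ i) (hn : h ≤ n) (ht : h ≤ t)
    (hi' : i < R) (hn' : n < R) (ht' : t < R) (h1 : i ≠ n) (h2 : i ≠ t) (h3 : n ≠ t) (s : State) :
    ∃ s', Run G (advance i n t) s s' 3 ∧ Same R h s s' ∧ s'.mem i = s.mem i + 1 ∧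
      s'.mem n = s.mem n - 1 ∧ ∀ j, j ≠ i → j ≠ n → j ≠ t → s'.mem j = s.mem j := by
  have r1 := Run.const P.one_le (d := t) (c := 1) s
    (Nat.one_lt_two_pow (by have := P.one_le; omega))
  set s1 := s.write t 1 with hs1
  have r2 := Run.arith P.one_le (o := .add) (d := i) (a := i) (b := t) s1 (by simp)
  set s2 := s1.write i _ with hs2
  have r3 := Run.arith P.one_le (o := .sub) (d := n) (a := n) (b := t) s2 (by simp)
  refine ⟨_, r1.seq (r2.seq r3), ?_, ?_, ?_, ?_⟩
  · rw [hs2, hs1]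
    exact ((Same.write _ _ ht ht').write' _ hi hi').write' _ hn hn'
  · simp [hs2, hs1, State.write_mem, Op.eval, h1, h2]
  · simp [hs2, hs1, State.write_mem, Op.eval, h1.symm, h3, h2.symm]
  · intro j j1 j2 j3
    simp [hs2, hs1, State.write_mem, j1, j2, j3]

theorem Expr.height_pos (e : Expr) : 0 < e.height := by
  induction e <;> simp only [height] <;> omega

/-- Induction on the expression. Subexpressions are evaluated at increasing stack heights, so an
intermediate result in cell `h` survives the evaluation of the next operand at `h + 1`; the
induction hypothesis therefore includes `Same`. -/
theorem Expr.run_compile (P : Params M G R K) (a : ℕ → ℕ → ℕ) (e : Expr) :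
    ∀ (cs env : List ℕ) (h : ℕ) (s : State), e.size ≤ K → h + e.height ≤ R →
      Rep M R K s a cs env h →
      ∃ s', Run G (e.compile R K cs h) s s' (e.steps M) ∧ Same R h s s' ∧
        s'.mem h = e.eval M a env := by
  have hG := P.one_le
  have hw := P.width
  induction e with
  | num n =>
    intro cs env h s hK hR r
    simp only [size, height] at hK hR
    exact ⟨_, Run.const hG s (by omega), Same.write _ _ le_rfl (by omega), by simp [eval]⟩
  | loc i =>
    intro cs env h s hK hR r
    simp only [size, height] at hK hR
    exact ⟨_, Run.copy hG _ _ s, Same.write _ _ le_rfl (by omega), by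
      rw [State.write_mem_self, r.getD, eval]⟩
  | bnd =>
    intro cs env h s hK hR r
    simp only [size, height] at hK hR
    exact ⟨_, Run.copy hG _ _ s, Same.write _ _ le_rfl (by omega), by simp [eval, r.bound]⟩
  | get x e ih =>
    intro cs env h s hK hR r
    simp only [size, height] at hK hR
    obtain ⟨s1, r1, m1, v1⟩ := ih cs env h s (by omega) (by omega) r
    obtain ⟨s2, r2, m2, v2⟩ := run_address P (x := x) (h := h) (by omega) (by omega) s1
    have rep2 := r.same (m1.trans m2 le_rfl) le_rfl
    refine ⟨_, (r1.seq (r2.seq (Run.load hG h h s2))).mono (by simp [steps]), ?_, ?_⟩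
    · exact (m1.trans m2 le_rfl).write' _ le_rfl (by omega)
    · rw [State.write_mem_self, v2, v1, rep2.arr x (by omega), eval]
  | op o e e' ih ih' =>
    intro cs env h s hK hR r
    simp only [size, height] at hK hR
    obtain ⟨s1, r1, m1, v1⟩ := ih cs env h s (by omega) (by omega) r
    have rep1 := r.same m1 (Nat.le_succ h)
    obtain ⟨s2, r2, m2, v2⟩ := ih' cs env (h + 1) s1 (by omega) (by omega) rep1
    have hpos := e'.height_pos
    have m12 := m1.trans m2 (Nat.le_succ h)
    have rep2 := r.same m12 le_rfl
    have h2 : s2.mem h = e.eval M a env := by rw [m2.low h (by omega), v1]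
    -- Only the second factor of a product is changed; reduced modulo `M < 2 ^ G` it meets the
    -- condition of `Instr.Ok`, and `opVal` contains the same reduction.
    obtain ⟨s3, r3, m3, v3, w3⟩ : ∃ s3, Run G (reduce (h + 1) o) s2 s3 1 ∧ Same R (h + 1) s2 s3 ∧
        (∀ y, o.eval y (s3.mem (h + 1)) = opVal M o y (e'.eval M a env)) ∧
        (o = .mul → s3.mem (h + 1) < 2 ^ G) := by
      cases o with
      | mul =>
        refine ⟨_, Run.arith hG s2 (by simp), Same.write _ _ le_rfl (by omega), ?_, fun _ => ?_⟩
        · simp [Op.eval, opVal, rep2.bound, v2]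
        · simpa [Op.eval, rep2.bound] using (Nat.mod_lt _ P.pos).trans P.bound
      | _ =>
        exact ⟨_, Run.copy hG _ _ s2, Same.write _ _ le_rfl (by omega), by simp [opVal, v2],
          by simp⟩
    have r4 := Run.arith hG (o := o) (d := h) (a := h) (b := h + 1) s3 w3
    refine ⟨_, (r1.seq (r2.seq (r3.seq r4))).mono (by simp only [steps]; omega),
      (m12.trans m3 (Nat.le_succ h)).write' _ le_rfl (by omega), ?_⟩
    rw [State.write_mem_self, v3, m3.low h (by omega), h2, eval]
  | cond c e e' ih ih1 ih2 =>
    intro cs env h s hK hR r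
    simp only [size, height] at hK hR
    obtain ⟨s1, r1, m1, v1⟩ := ih cs env h s (by omega) (by omega) r
    have rep1 := r.same m1 le_rfl
    by_cases hc : c.eval M a env = 0
    · obtain ⟨s2, r2, m2, v2⟩ := ih2 cs env h s1 (by omega) (by omega) rep1
      exact ⟨s2, (r1.seq (Run.branch_false (v1.trans hc) r2)).mono (by simp only [steps]; omega),
        m1.trans m2 le_rfl, by rw [v2, eval, if_pos hc]⟩
    · obtain ⟨s2, r2, m2, v2⟩ := ih1 cs env h s1 (by omega) (by omega) rep1
      exact ⟨s2, (r1.seq (Run.branch_true (by rwa [v1]) r2)).mono (by simp only [steps]; omega),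
        m1.trans m2 le_rfl, by rw [v2, eval, if_neg hc]⟩
  | sum n e ih ih' =>
    intro cs env h s hK hR r
    simp only [size, height] at hK hR
    have rep0 := r.same (Same.refl R h s) (Nat.le_succ h)
    obtain ⟨s1, r1, m1, v1⟩ := ih cs env (h + 1) s (by omega) (by omega) rep0
    have rep1 := r.same (m1.mono (Nat.le_succ h)) le_rfl
    have r2 := Run.arith hG (o := .mod) (d := h + 1) (a := h + 1) (b := 0) s1 (by simp)
    set s2 := s1.write (h + 1) _ with hs2
    have r3 := Run.const hG (d := h + 2) (c := 0) s2 (by positivity)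
    set s3 := s2.write (h + 2) 0 with hs3
    have r4 := Run.const hG (d := h) (c := 0) s3 (by positivity)
    set s4 := s3.write h 0 with hs4
    set N := n.eval M a env % M with hN
    have m4 : Same R h s s4 := by
      rw [hs4, hs3, hs2]
      refine (((m1.mono (Nat.le_succ h)).write' _ ?_ ?_).write' _ ?_ ?_).write' _ ?_ ?_ <;> omega
    -- Loop invariant: cell `h` holds the partial sum, `h + 1` the number of rounds left, `h + 2`
    -- the bound variable; the summand is computed from `h + 3` on.
    have step : ∀ i < N, ∀ t : State, (Same R h s t ∧ t.mem (h + 2) = i ∧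
        t.mem h = ∑ i ∈ Finset.range i, e.eval M a (i :: env)) → t.mem (h + 1) = N - i →
        ∃ t', Run G (e.compile R K ((h + 2) :: cs) (h + 3) ;; .instr (.arith .add h h (h + 3)) ;;
          advance (h + 2) (h + 1) (h + 3)) t t' (e.steps M + 4) ∧ (Same R h s t' ∧
          t'.mem (h + 2) = i + 1 ∧
          t'.mem h = ∑ i ∈ Finset.range (i + 1), e.eval M a (i :: env)) ∧
          t'.mem (h + 1) = N - (i + 1) := by
      rintro i hi t ⟨mt, vt, at'⟩ nt
      obtain ⟨t1, q1, n1, w1⟩ := ih' ((h + 2) :: cs) (i :: env) (h + 3) t (by omega) (by omega)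
        (r.push mt (by omega) vt (by omega))
      have q2 := Run.arith hG (o := .add) (d := h) (a := h) (b := h + 3) t1 (by simp)
      set t2 := t1.write h _ with ht2
      have hpos := e.height_pos
      obtain ⟨t3, q3, n3, w3, w3', w3''⟩ := run_advance P (i := h + 2) (n := h + 1) (t := h + 3)
        (h := h) (by omega) (by omega) (by omega) (by omega) (by omega) (by omega) (by omega)
        (by omega) (by omega) t2
      refine ⟨t3, (q1.seq (q2.seq q3)).mono (by omega), ⟨?_, ?_, ?_⟩, ?_⟩
      · refine mt.trans (Same.trans ?_ n3 le_rfl) le_rfl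
        exact (n1.mono (by omega)).write' _ le_rfl (by omega)
      · rw [w3, ht2, State.write_mem_of_ne _ _ (by omega), n1.low _ (by omega), vt]
      · rw [w3'' h (by omega) (by omega) (by omega), ht2, State.write_mem_self, w1,
          n1.low _ (by omega), at', Finset.sum_range_succ, Op.eval]
      · rw [w3', ht2, State.write_mem_of_ne _ _ (by omega), n1.low _ (by omega), nt]
        omega
    obtain ⟨s5, r5, ⟨m5, _, v5⟩, _⟩ := Run.countdown (s := s4) (fun i t => Same R h s t ∧
        t.mem (h + 2) = i ∧ t.mem h = ∑ i ∈ Finset.range i, e.eval M a (i :: env)) step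
      ⟨m4, by simp [hs4, hs3, State.write_mem], by simp [hs4]⟩
      (by simp [hs4, hs3, hs2, State.write_mem, Op.eval, v1, rep1.bound, hN])
    have hNM : N ≤ M := (Nat.mod_lt _ P.pos).le
    have : N * (e.steps M + 4 + 1) ≤ M * (e.steps M + 5) := by gcongr
    exact ⟨s5, (r1.seq (r2.seq (r3.seq (r4.seq r5)))).mono (by simp only [steps]; omega), m5,
      by rw [v5, eval]⟩

/-- As array names are below `K`, the remainder modulo `K` of `K * i + x` recovers the array and
then the index, so a write hits exactly one entry of one array. -/
theorem Rep.put {s s' : State} {σ : Store} {cs env : List ℕ} {h x i v : ℕ}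
    (r : Rep M R K s σ.arr cs env h) (hs : Same R h s s') (hx : x < K) (hR : h ≤ R) :
    Rep M R K (s'.write (R + K * i + x) v) (σ.put x i v).arr cs env h ∧
      ∀ j < h, (s'.write (R + K * i + x) v).mem j = s.mem j := by
  have hlow : ∀ j < h, (s'.write (R + K * i + x) v).mem j = s.mem j := fun j hj => by
    rw [State.write_mem_of_ne _ _ (by omega), hs.low j hj]
  refine ⟨⟨r.pos, (hlow 0 r.pos).trans r.bound, fun y hy j => ?_, ?_, r.lt⟩, hlow⟩
  · by_cases hyx : y = x
    · subst hyx
      by_cases hji : j = i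
      · subst hji; simp [Store.put]
      · have : R + K * j + y ≠ R + K * i + y := by
          have := mt (Nat.eq_of_mul_eq_mul_left (show 0 < K by omega)) hji
          omega
        rw [State.write_mem_of_ne _ _ this, hs.high _ (by omega), r.arr y hy]
        simp [Store.put, hji]
    · have : R + K * j + y ≠ R + K * i + x := by
        intro h
        have h' : (K * j + y) % K = (K * i + x) % K := by congr 1; omega
        rw [Nat.mul_add_mod, Nat.mul_add_mod, Nat.mod_eq_of_lt hy, Nat.mod_eq_of_lt hx] at h'
        exact hyx h'
      rw [State.write_mem_of_ne _ _ this, hs.high _ (by omega), r.arr y hy]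
      simp [Store.put, hyx]
  · rw [← r.loc]
    exact List.map_congr_left fun c hc => hlow c (r.lt c hc)

/-- For leaving the scope of a bound variable: the arrays are taken from the state after the loop
body, the environment from the state before it. -/
theorem Rep.low {s s' : State} {a a' : ℕ → ℕ → ℕ} {cs env cs' env' : List ℕ} {h h' : ℕ}
    (r : Rep M R K s a cs env h) (r' : Rep M R K s' a' cs' env' h')
    (hs : ∀ j < h, s'.mem j = s.mem j) : Rep M R K s' a' cs env h where
  pos := r.pos
  bound := (hs 0 r.pos).trans r.bound
  arr := r'.arr
  loc := by
    rw [← r.loc]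
    exact List.map_congr_left fun c hc => hs c (r.lt c hc)
  lt := r.lt

/-- Commands alter cells beyond `R` and the coins, so `Same` is too strong here; what is preserved
is the part of the stack below `h`, and the arrays are tracked by `Rep`. -/
theorem Cmd.run_compile (P : Params M G R K) (c : Cmd) :
    ∀ (cs env : List ℕ) (h : ℕ) (s : State) (σ : Store), c.size ≤ K → h + c.height ≤ R →
      Rep M R K s σ.arr cs env h → s.coins = σ.coins →
      ∃ s', Run G (c.compile R K cs h) s s' (c.steps M) ∧ (∀ j < h, s'.mem j = s.mem j) ∧
        Rep M R K s' (c.run M env σ).arr cs env h ∧ s'.coins = (c.run M env σ).coins := by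
  have hG := P.one_le
  have hw := P.width
  induction c with
  | skip =>
    intro cs env h s σ hK hR r hc
    simp only [size, height] at hK hR
    have m : Same R h s (s.write h 0) := Same.write _ _ le_rfl (by omega)
    exact ⟨_, Run.const hG s (by positivity), m.low, r.same m le_rfl, hc⟩
  | put x e e' =>
    intro cs env h s σ hK hR r hc
    simp only [size, height] at hK hR
    obtain ⟨s1, r1, m1, v1⟩ := e.run_compile P σ.arr cs env h s (by omega) (by omega) r
    obtain ⟨s2, r2, m2, v2⟩ := run_address P (x := x) (h := h) (by omega) (by omega) s1
    have m12 := m1.trans m2 le_rfl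
    obtain ⟨s3, r3, m3, v3⟩ := e'.run_compile P σ.arr cs env (h + 1) s2 (by omega) (by omega)
      (r.same m12 (Nat.le_succ h))
    have m13 := m12.trans m3 (Nat.le_succ h)
    have r4 := Run.store hG h (h + 1) s3
    rw [m3.low h (by omega), v2, v1, v3] at r4
    obtain ⟨q1, q2⟩ := r.put (i := e.eval M σ.arr env) (v := e'.eval M σ.arr env) m13
      (show x < K by omega) (by omega)
    exact ⟨_, (r1.seq (r2.seq (r3.seq r4))).mono (by simp only [steps]; omega), q2, q1,
      m13.coins.trans hc⟩
  | toss x e =>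
    intro cs env h s σ hK hR r hc
    simp only [size, height] at hK hR
    obtain ⟨s1, r1, m1, v1⟩ := e.run_compile P σ.arr cs env h s (by omega) (by omega) r
    obtain ⟨s2, r2, m2, v2⟩ := run_address P (x := x) (h := h) (by omega) (by omega) s1
    have m12 := m1.trans m2 le_rfl
    have r3 := Run.instr hG (.toss (h + 1)) s2 trivial
    set s3 : State := { s2.write (h + 1) (if s2.coins.headD false then 1 else 0) with
      coins := s2.coins.tail } with hs3
    have r4 := Run.store hG h (h + 1) s3
    have h1 : s3.mem h = R + K * e.eval M σ.arr env + x := by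
      rw [← v1, ← v2]
      exact State.write_mem_of_ne _ _ (by omega)
    have h2 : s3.mem (h + 1) = if σ.coins.headD false then 1 else 0 := by
      rw [← hc, ← m12.coins]
      exact State.write_mem_self _ _ _
    -- A toss changes the coins, which `Same` forbids. `Rep` speaks of the memory alone, so the old
    -- coins are put back for this comparison.
    have m3 : Same R h s ⟨s3.mem, s2.coins⟩ := by
      have : Same R h s (s2.write (h + 1) (if s2.coins.headD false then 1 else 0)) :=
        m12.write' _ (by omega) (by omega)
      exact this
    obtain ⟨q1, q2⟩ := r.put (i := e.eval M σ.arr env)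
      (v := if σ.coins.headD false then 1 else 0) m3 (show x < K by omega) (by omega)
    rw [h1, h2] at r4
    refine ⟨_, (r1.seq (r2.seq (r3.seq r4))).mono (by simp only [steps]; omega), q2,
      ⟨q1.pos, q1.bound, q1.arr, q1.loc, q1.lt⟩, ?_⟩
    simp [hs3, Cmd.run, m12.coins, hc]
  | seq c c' ih ih' =>
    intro cs env h s σ hK hR r hc
    simp only [size, height] at hK hR
    obtain ⟨s1, r1, m1, v1, c1⟩ := ih cs env h s σ (by omega) (by omega) r hc
    obtain ⟨s2, r2, m2, v2, c2⟩ := ih' cs env h s1 _ (by omega) (by omega) v1 c1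
    exact ⟨s2, r1.seq r2, fun j hj => (m2 j hj).trans (m1 j hj), v2, c2⟩
  | ite e c c' ih ih' =>
    intro cs env h s σ hK hR r hc
    simp only [size, height] at hK hR
    obtain ⟨s1, r1, m1, v1⟩ := e.run_compile P σ.arr cs env h s (by omega) (by omega) r
    have rep1 := r.same m1 le_rfl
    have hc1 := m1.coins.trans hc
    by_cases h0 : e.eval M σ.arr env = 0
    · obtain ⟨s2, r2, m2, v2, c2⟩ := ih' cs env h s1 σ (by omega) (by omega) rep1 hc1
      refine ⟨s2, (r1.seq (Run.branch_false (v1.trans h0) r2)).mono (by simp only [steps]; omega),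
        fun j hj => (m2 j hj).trans (m1.low j hj), ?_, ?_⟩
      · rwa [run, if_pos h0]
      · rwa [run, if_pos h0]
    · obtain ⟨s2, r2, m2, v2, c2⟩ := ih cs env h s1 σ (by omega) (by omega) rep1 hc1
      refine ⟨s2, (r1.seq (Run.branch_true (by rwa [v1]) r2)).mono (by simp only [steps]; omega),
        fun j hj => (m2 j hj).trans (m1.low j hj), ?_, ?_⟩
      · rwa [run, if_neg h0]
      · rwa [run, if_neg h0]
  | loop n c ih =>
    intro cs env h s σ hK hR r hc
    simp only [size, height] at hK hR
    obtain ⟨s1, r1, m1, v1⟩ := n.run_compile P σ.arr cs env h s (by omega) (by omega) r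
    have rep1 := r.same m1 le_rfl
    have r2 := Run.arith hG (o := .mod) (d := h) (a := h) (b := 0) s1 (by simp)
    set s2 := s1.write h _ with hs2
    have r3 := Run.const hG (d := h + 1) (c := 0) s2 (by positivity)
    set s3 := s2.write (h + 1) 0 with hs3
    set N := n.eval M σ.arr env % M with hN
    set f : ℕ → Store → Store := fun i τ => c.run M (i :: env) τ with hf
    have m3 : Same R h s s3 := by
      rw [hs3, hs2]
      refine (m1.write' _ ?_ ?_).write' _ ?_ ?_ <;> omega
    have step : ∀ i < N, ∀ t : State, (Rep M R K t (iter f σ i).arr cs env h ∧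
        t.coins = (iter f σ i).coins ∧ t.mem (h + 1) = i ∧ ∀ j < h, t.mem j = s.mem j) →
        t.mem h = N - i →
        ∃ t', Run G (c.compile R K ((h + 1) :: cs) (h + 2) ;; advance (h + 1) h (h + 2)) t t'
          (c.steps M + 3) ∧ (Rep M R K t' (iter f σ (i + 1)).arr cs env h ∧
          t'.coins = (iter f σ (i + 1)).coins ∧ t'.mem (h + 1) = i + 1 ∧
          ∀ j < h, t'.mem j = s.mem j) ∧ t'.mem h = N - (i + 1) := by
      rintro i hi t ⟨rt, ct, vt, mt⟩ nt
      obtain ⟨t1, q1, n1, w1, c1⟩ := ih ((h + 1) :: cs) (i :: env) (h + 2) t (iter f σ i)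
        (by omega) (by omega) (rt.push (Same.refl R h t) (by omega) vt (by omega)) ct
      obtain ⟨t2, q2, n2, w2, w2', w2''⟩ := run_advance P (i := h + 1) (n := h) (t := h + 2)
        (h := h) (by omega) (by omega) (by omega) (by omega) (by omega) (by omega) (by omega)
        (by omega) (by omega) t1
      have low : ∀ j < h, t2.mem j = t.mem j := fun j hj =>
        (n2.low j hj).trans (n1 j (by omega))
      have rep1 := rt.low w1 fun j hj => n1 j (by omega)
      refine ⟨t2, q1.seq q2, ⟨rep1.same n2 le_rfl, n2.coins.trans c1, ?_, fun j hj =>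
        (low j hj).trans (mt j hj)⟩, ?_⟩
      · rw [w2, n1 _ (by omega), vt]
      · rw [w2', n1 _ (by omega), nt]; omega
    obtain ⟨s4, r4, ⟨rep4, c4, _, m4⟩, _⟩ := Run.countdown (s := s3) (fun i t =>
        Rep M R K t (iter f σ i).arr cs env h ∧
        t.coins = (iter f σ i).coins ∧ t.mem (h + 1) = i ∧ ∀ j < h, t.mem j = s.mem j) step
      ⟨r.same m3 le_rfl, m3.coins.trans hc, by simp [hs3], m3.low⟩
      (by simp [hs3, hs2, State.write_mem, Op.eval, v1, rep1.bound, hN])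
    have hNM : N ≤ M := (Nat.mod_lt _ P.pos).le
    have : N * (c.steps M + 3 + 1) ≤ M * (c.steps M + 4) := by gcongr
    exact ⟨s4, (r1.seq (r2.seq (r3.seq r4))).mono (by simp only [steps]; omega), m4,
      rep4, c4⟩

end LoopLang

/-! ## The frame of a compiled program -/

namespace RAM

open LoopLang

/-- A sequence of basic instructions. -/
def block : Instr → List Instr → Program
  | i, [] => .instr i
  | i, j :: l => .instr i ;; block j l

/-- The effect of a sequence of basic instructions. -/
def execs : List Instr → State → State
  | [], s => s
  | i :: l, s => execs l (i.exec s)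

/-- Constants and factors in a sequence of instructions are less than `2 ^ G`. -/
def OkAll (G : ℕ) : List Instr → State → Prop
  | [], _ => True
  | i :: l, s => i.Ok G s ∧ OkAll G l (i.exec s)

theorem Run.block {G : ℕ} (hG : 1 ≤ G) (i : Instr) (l : List Instr) (s : State)
    (h : OkAll G (i :: l) s) :
    Run G (block i l) s (execs (i :: l) s) (l.length + 1) := by
  induction l generalizing i s with
  | nil => exact Run.instr hG i s h.1
  | cons j l ih =>
    exact ((Run.instr hG i s h.1).seq (ih j _ h.2)).mono (by simp only [List.length_cons]; omega)

/-- Copy a sequence of cells: cell `2` holds the number of cells, cells `3` and `4` the addresses of the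
first source and the first target, cells `5` and `6` the distances between consecutive sources and
targets, cell `8` the number one. -/
def transfer : Program :=
  .loop 2 (block (.load 7 3) [.store 4 7, .arith .add 3 3 5, .arith .add 4 4 6, .arith .sub 2 2 8])

/-- Condition `hab` says that no source has been overwritten by the time it is read, so sources and
targets may otherwise overlap. The bound `9` keeps both away from the working cells `2, …, 8`. -/
theorem run_transfer {G n a b p q : ℕ} (hG : 1 ≤ G) {s : State} (h2 : s.mem 2 = n) (h3 : s.mem 3 = a)
    (h4 : s.mem 4 = b) (h5 : s.mem 5 = p) (h6 : s.mem 6 = q) (h8 : s.mem 8 = 1)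
    (ha : ∀ i < n, 9 ≤ a + p * i)
    (hb : 9 ≤ b) (hq : 1 ≤ q) (hab : ∀ i < n, ∀ j < i, b + q * j ≠ a + p * i) :
    ∃ s', Run G transfer s s' (6 * n + 1) ∧ s'.coins = s.coins ∧
      (∀ i < n, s'.mem (b + q * i) = s.mem (a + p * i)) ∧
      (∀ c, (c < 2 ∨ 9 ≤ c) → (∀ i < n, c ≠ b + q * i) → s'.mem c = s.mem c) := by
  have step : ∀ i < n, ∀ t : State, (t.coins = s.coins ∧ t.mem 3 = a + p * i ∧
      t.mem 4 = b + q * i ∧ t.mem 5 = p ∧ t.mem 6 = q ∧ t.mem 8 = 1 ∧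
      (∀ j < i, t.mem (b + q * j) = s.mem (a + p * j)) ∧
      (∀ c, (c < 2 ∨ 9 ≤ c) → (∀ j < i, c ≠ b + q * j) → t.mem c = s.mem c)) → t.mem 2 = n - i →
      ∃ t', Run G (block (.load 7 3) [.store 4 7, .arith .add 3 3 5, .arith .add 4 4 6,
          .arith .sub 2 2 8]) t t' 5 ∧ (t'.coins = s.coins ∧ t'.mem 3 = a + p * (i + 1) ∧
      t'.mem 4 = b + q * (i + 1) ∧ t'.mem 5 = p ∧ t'.mem 6 = q ∧ t'.mem 8 = 1 ∧
      (∀ j < i + 1, t'.mem (b + q * j) = s.mem (a + p * j)) ∧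
      (∀ c, (c < 2 ∨ 9 ≤ c) → (∀ j < i + 1, c ≠ b + q * j) → t'.mem c = s.mem c)) ∧
      t'.mem 2 = n - (i + 1) := by
    rintro i hi t ⟨hc, t3, t4, t5, t6, t8, hj, hk⟩ t2
    have hsrc : t.mem (a + p * i) = s.mem (a + p * i) :=
      hk _ (Or.inr (ha i hi)) fun j hji => (hab i hi j hji).symm
    have hbig : ∀ j, 9 ≤ b + q * j := fun j => by omega
    have hbi := hbig i
    have key : ∀ c, (execs [.load 7 3, .store 4 7, .arith .add 3 3 5, .arith .add 4 4 6,
          .arith .sub 2 2 8] t).mem c = if c = 2 then n - (i + 1) else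
          if c = 4 then b + q * (i + 1) else if c = 3 then a + p * (i + 1) else
          if c = b + q * i then s.mem (a + p * i) else if c = 7 then s.mem (a + p * i) else
          t.mem c := by
      intro c
      have n2 : 2 ≠ b + q * i := by omega
      have n3 : 3 ≠ b + q * i := by omega
      have n4 : 4 ≠ b + q * i := by omega
      have n5 : 5 ≠ b + q * i := by omega
      have n6 : 6 ≠ b + q * i := by omega
      have n8 : 8 ≠ b + q * i := by omega
      have m2 : n - i - 1 = n - (i + 1) := by omega
      simp only [execs, Instr.exec, State.write_mem, t3, t4, t5, t6, t8, t2, hsrc, Op.eval,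
        mul_add, mul_one, ← add_assoc, if_true]
      simp only [show (2:ℕ) ≠ 4 by decide, show (2:ℕ) ≠ 3 by decide, show (2:ℕ) ≠ 7 by decide,
        show (8:ℕ) ≠ 4 by decide, show (8:ℕ) ≠ 3 by decide, show (8:ℕ) ≠ 7 by decide,
        show (4:ℕ) ≠ 3 by decide, show (4:ℕ) ≠ 7 by decide, show (3:ℕ) ≠ 7 by decide,
        show (6:ℕ) ≠ 3 by decide, show (6:ℕ) ≠ 7 by decide, show (5:ℕ) ≠ 7 by decide,
        n2, n3, n4, n5, n6, n8, if_false, m2]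
    refine ⟨_, Run.block hG _ _ _ ?_, ⟨hc, ?_, ?_, ?_, ?_, ?_, ?_, ?_⟩, ?_⟩
    · simp [OkAll, Instr.Ok]
    · rw [key]; simp
    · rw [key]; simp
    · rw [key, if_neg, if_neg, if_neg, if_neg, if_neg, t5] <;> omega
    · rw [key, if_neg, if_neg, if_neg, if_neg, if_neg, t6] <;> omega
    · rw [key, if_neg, if_neg, if_neg, if_neg, if_neg, t8] <;> omega
    · intro j hji
      have := hbig j
      rw [key, if_neg (by omega), if_neg (by omega), if_neg (by omega)]
      by_cases hjeq : j = i
      · subst hjeq; simp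
      · have : q * j ≠ q * i := fun h => hjeq (Nat.eq_of_mul_eq_mul_left hq h)
        rw [if_neg (by omega), if_neg (by omega), hj j (by omega)]
    · intro c hc9 hcj
      have := hcj i (by omega)
      rw [key, if_neg (by omega), if_neg (by omega), if_neg (by omega), if_neg (by omega),
        if_neg (by omega), hk c hc9 fun j hj => hcj j (by omega)]
    · rw [key]; simp
  obtain ⟨s', r, ⟨hc, _, _, _, _, _, h1, h2⟩, _⟩ := Run.countdown (s := s) _ step
    ⟨rfl, by simpa using h3, by simpa using h4, h5, h6, h8, by simp, by simp⟩ h2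
  exact ⟨s', r.mono (by omega), hc, h1, h2⟩

/-- Double cell `0` repeatedly. -/
def double : ℕ → Program
  | 0 => .instr (.copy 0 0)
  | n + 1 => double n ;; .instr (.arith .add 0 0 0)

theorem run_double {G : ℕ} (hG : 1 ≤ G) (n : ℕ) (s : State) :
    ∃ s', Run G (double n) s s' (n + 1) ∧ s'.coins = s.coins ∧ s'.mem 0 = 2 ^ n * s.mem 0 ∧
      ∀ j, 1 ≤ j → s'.mem j = s.mem j := by
  induction n with
  | zero => exact ⟨_, Run.copy hG _ _ s, rfl, by simp, fun j hj =>
      State.write_mem_of_ne _ _ (by omega)⟩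
  | succ n ih =>
    obtain ⟨s1, r1, c1, v1, h1⟩ := ih
    refine ⟨_, r1.seq (Run.arith hG s1 (by simp)), c1, ?_, fun j hj => ?_⟩
    · rw [State.write_mem_self, Op.eval, v1]; ring
    · rw [State.write_mem_of_ne _ _ (by omega), h1 j hj]

/-- Save the cells `1, …, n + 1` at the address in cell `0`. -/
def save : ℕ → Program
  | 0 => block (.store 0 1) [.const 1 1]
  | n + 1 => save n ;; block (.arith .add 0 0 1) [.store 0 (n + 2)]

/-- Cell `1` is saved first and then provides the number one that advances the address in cell `0`.
No further working cell is needed, so the remaining cells are still intact when they are saved. -/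
theorem run_save {G H : ℕ} (hG : 1 ≤ G) (n : ℕ) {s : State} (h0 : s.mem 0 = H) (hn : n + 2 ≤ H) :
    ∃ s', Run G (save n) s s' (2 * (n + 1)) ∧ s'.coins = s.coins ∧ s'.mem 0 = H + n ∧
      s'.mem 1 = 1 ∧ (∀ j ≤ n, s'.mem (H + j) = s.mem (j + 1)) ∧
      ∀ j, n + 1 < j → j < H → s'.mem j = s.mem j := by
  induction n with
  | zero =>
    refine ⟨_, Run.block hG _ _ s ?_, rfl, ?_, ?_, ?_, ?_⟩
    · simpa [OkAll, Instr.Ok] using Nat.one_lt_two_pow (by omega : G ≠ 0)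
    · rw [execs, execs, execs, Instr.exec, Instr.exec, State.write_mem_of_ne _ _ (by omega),
        State.write_mem_of_ne _ _ (by omega), h0, add_zero]
    · rw [execs, execs, execs, Instr.exec, State.write_mem_self]
    · intro j hj
      obtain rfl : j = 0 := by omega
      rw [execs, execs, execs, Instr.exec, Instr.exec, State.write_mem_of_ne _ _ (by omega), h0,
        add_zero, State.write_mem_self]
    · intro j hj hj'
      rw [execs, execs, execs, Instr.exec, Instr.exec, State.write_mem_of_ne _ _ (by omega),
        State.write_mem_of_ne _ _ (by omega)]
  | succ n ih =>
    obtain ⟨s1, r1, c1, v1, w1, h1, g1⟩ := ih (by omega)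
    have hr := Run.block hG (.arith .add 0 0 1) [.store 0 (n + 2)] s1 (by simp [OkAll, Instr.Ok])
    have key : ∀ j, (execs [.arith .add 0 0 1, .store 0 (n + 2)] s1).mem j =
        if j = H + n + 1 then s1.mem (n + 2) else if j = 0 then H + n + 1 else s1.mem j := by
      intro j
      rw [execs, execs, execs, Instr.exec, Instr.exec, State.write_mem_self, State.write_mem,
        State.write_mem_of_ne _ _ (show n + 2 ≠ 0 by omega), State.write_mem, Op.eval, v1, w1]
    refine ⟨_, (r1.seq hr).mono (by simp; omega), c1, ?_, ?_, ?_, ?_⟩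
    · rw [key, if_neg (by omega), if_pos rfl]; ring
    · rw [key, if_neg (by omega), if_neg (by omega), w1]
    · intro j hj
      rw [key]
      by_cases hjn : j = n + 1
      · subst hjn
        rw [if_pos (by ring), g1 _ (by omega) (by omega)]
      · rw [if_neg (by omega), if_neg (by omega), h1 j (by omega)]
    · intro j hj hj'
      rw [key, if_neg (by omega), if_neg (by omega), g1 j (by omega) hj']

/-- Multiply cell `0` repeatedly by cell `1`. -/
def power : ℕ → Program
  | 0 => .instr (.const 0 1)
  | n + 1 => power n ;; .instr (.arith .mul 0 0 1)

theorem run_power {G : ℕ} (hG : 1 ≤ G) (n : ℕ) (s : State) (h1 : s.mem 1 < 2 ^ G) :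
    ∃ s', Run G (power n) s s' (n + 1) ∧ s'.coins = s.coins ∧ s'.mem 0 = s.mem 1 ^ n ∧
      ∀ j, 1 ≤ j → s'.mem j = s.mem j := by
  induction n with
  | zero => exact ⟨_, Run.const hG s (Nat.one_lt_two_pow (by omega)), rfl, by simp, fun j hj =>
      State.write_mem_of_ne _ _ (by omega)⟩
  | succ n ih =>
    obtain ⟨s1, r1, c1, v1, g1⟩ := ih
    refine ⟨_, r1.seq (Run.arith hG s1 fun _ => by rwa [g1 1 le_rfl]), c1, ?_, fun j hj => ?_⟩
    · rw [State.write_mem_self, Op.eval, v1, g1 1 le_rfl, pow_succ]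
    · rw [State.write_mem_of_ne _ _ (by omega), g1 j hj]

end RAM

/-! ### Moving the input into the arrays and the output back -/

namespace RAM

open LoopLang

/-- Move the initial contents of the memory to the array `0`, and write the number `(L + C) ^ e` into
cell `0`, where `L` is the length of the input. -/
def prologue (R K D C e : ℕ) : Program :=
  double D ;; save (R - 2) ;;
  block (.const 1 (R - 2)) [.arith .sub 0 0 1, .const 1 (2 ^ D), .arith .div 1 0 1,
    .const 3 (R - 1), .arith .sub 2 1 3, .const 3 R, .const 4 (R - 1), .arith .add 4 0 4,
    .const 5 1, .const 6 1, .const 8 1] ;; transfer ;;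
  block (.copy 2 1) [.copy 3 0, .const 4 (R + K), .const 5 1, .const 6 K, .const 8 1] ;; transfer ;;
  block (.const 2 R) [.store 2 1, .const 2 C, .arith .add 1 1 2] ;; power e

/-- At the start the input may fill all the working cells. Doubling cell `0`, which holds the length
`L`, yields an address `H = 2 ^ D * L` beyond the future array without any other cell. The input is
first moved to `H`, in straight-line code for the cells below `R` and by a loop for the others, and
then spread from there with stride `K`; `L` is recovered as `H / 2 ^ D`. -/
theorem run_prologue {G R K D C e L : ℕ} (hG : 1 ≤ G) (hR : 10 ≤ R) (hK : 1 ≤ K) (hDG : D < G)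
    (hD : R + 2 * K + 10 ≤ 2 ^ D) (hRK : R + K < 2 ^ G) (hL : L + C < 2 ^ G) (hL1 : 1 ≤ L)
    {s : State} (h0 : s.mem 0 = L) :
    ∃ s', Run G (prologue R K D C e) s s' (D + 2 * R + e + 12 * L + 40) ∧ s'.coins = s.coins ∧
      s'.mem 0 = (L + C) ^ e ∧ ∀ j ≤ L, s'.mem (R + K * j) = s.mem j := by
  obtain ⟨H, hH⟩ : ∃ H, H = 2 ^ D * L := ⟨_, rfl⟩
  -- All entries of the new array lie below `H`, so the second transfer never overwrites a source.
  have hHL : R + K * L + K + L < H := by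
    obtain ⟨l, rfl⟩ : ∃ l, L = l + 1 := ⟨L - 1, by omega⟩
    calc R + K * (l + 1) + K + (l + 1) < (R + 2 * K + 10) * (l + 1) := by nlinarith
      _ ≤ H := by rw [hH]; gcongr
  have h1G : 1 < 2 ^ G := Nat.one_lt_two_pow (by omega)
  have hDpow : 2 ^ D < 2 ^ G := Nat.pow_lt_pow_right (by norm_num) hDG
  obtain ⟨s1, r1, c1, v1, g1⟩ := run_double hG D s
  rw [h0, ← hH] at v1
  obtain ⟨s2, r2, c2, v2, w2, g2, g2'⟩ := run_save hG (R - 2) v1 (by omega)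
  have r3 := Run.block hG (.const 1 (R - 2)) [.arith .sub 0 0 1, .const 1 (2 ^ D),
    .arith .div 1 0 1, .const 3 (R - 1), .arith .sub 2 1 3, .const 3 R, .const 4 (R - 1),
    .arith .add 4 0 4, .const 5 1, .const 6 1, .const 8 1] s2 (by
      simp [OkAll, Instr.Ok, h1G, hDpow]; omega)
  set s3 := execs _ s2 with hs3
  have hdiv : H / 2 ^ D = L := by rw [hH]; exact Nat.mul_div_cancel_left _ (by positivity)
  have v3 : s3.mem 0 = H ∧ s3.mem 1 = L ∧ s3.mem 2 = L - (R - 1) ∧ s3.mem 3 = R ∧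
      s3.mem 4 = H + (R - 1) ∧ s3.mem 5 = 1 ∧ s3.mem 6 = 1 ∧ s3.mem 8 = 1 := by
    simp [hs3, execs, Instr.exec, State.write_mem, Op.eval, v2, hdiv]
  have g3 : ∀ j, 9 ≤ j → s3.mem j = s2.mem j := by
    intro j hj
    rw [hs3]
    simp only [execs, Instr.exec, State.write_mem]
    rw [if_neg, if_neg, if_neg, if_neg, if_neg, if_neg, if_neg, if_neg, if_neg, if_neg, if_neg,
      if_neg] <;> omega
  obtain ⟨e0, e1, e2, e3, e4, e5, e6, e8⟩ := v3
  have c3 : s3.coins = s.coins := c2.trans c1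
  obtain ⟨s4, r4, c4, t4, f4⟩ := run_transfer hG e2 e3 e4 e5 e6 e8 (by intros; omega) (by omega)
    le_rfl (by intros; omega)
  have cells : ∀ j < L, s4.mem (H + j) = s.mem (j + 1) := by
    intro j hj
    by_cases hjR : j < R - 1
    · rw [f4 _ (by omega) (by intros; omega), g3 _ (by omega), g2 j (by omega), g1 _ (by omega)]
    · have := t4 (j - (R - 1)) (by omega)
      rw [show H + (R - 1) + 1 * (j - (R - 1)) = H + j by omega,
        show R + 1 * (j - (R - 1)) = j + 1 by omega] at this
      rw [this, g3 _ (by omega), g2' _ (by omega) (by omega), g1 _ (by omega)]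
  have r5 := Run.block hG (.copy 2 1) [.copy 3 0, .const 4 (R + K), .const 5 1, .const 6 K,
    .const 8 1] s4 (by simp [OkAll, Instr.Ok, h1G]; omega)
  set s5 := execs _ s4 with hs5
  have q0 : s4.mem 0 = H := by rw [f4 0 (by omega) (by intros; omega), e0]
  have q1 : s4.mem 1 = L := by rw [f4 1 (by omega) (by intros; omega), e1]
  have v5 : s5.mem 0 = H ∧ s5.mem 1 = L ∧ s5.mem 2 = L ∧ s5.mem 3 = H ∧
      s5.mem 4 = R + K ∧ s5.mem 5 = 1 ∧ s5.mem 6 = K ∧ s5.mem 8 = 1 := by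
    simp [hs5, execs, Instr.exec, State.write_mem, q0, q1]
  have g5 : ∀ j, 9 ≤ j → s5.mem j = s4.mem j := by
    intro j hj
    rw [hs5]
    simp only [execs, Instr.exec, State.write_mem]
    rw [if_neg, if_neg, if_neg, if_neg, if_neg, if_neg] <;> omega
  obtain ⟨d0, d1, d2, d3, d4, d5, d6, d8⟩ := v5
  have bound : ∀ j < L, R + K + K * j < H := by
    intro j hj
    have : K * j ≤ K * L := Nat.mul_le_mul_left _ hj.le
    omega
  obtain ⟨s6, r6, c6, t6, f6⟩ := run_transfer hG d2 d3 d4 d5 d6 d8 (by intros; omega) (by omega)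
    hK (fun i hi j hj => by have := bound j (by omega); omega)
  have r7 := Run.block hG (.const 2 R) [.store 2 1, .const 2 C, .arith .add 1 1 2] s6 (by
    simp [OkAll, Instr.Ok]; omega)
  set s7 := execs _ s6 with hs7
  have p1 : s6.mem 1 = L := by rw [f6 1 (by omega) (by intros; omega), d1]
  have v7 : s7.mem 1 = L + C := by
    simp [hs7, execs, Instr.exec, State.write_mem, Op.eval, p1, show 1 ≠ R by omega]
  obtain ⟨s8, r8, c8, v8, g8⟩ := run_power hG e s7 (by omega)
  refine ⟨s8, (r1.seq (r2.seq (r3.seq (r4.seq (r5.seq (r6.seq (r7.seq r8))))))).mono ?_, ?_, ?_, ?_⟩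
  · simp only [List.length_cons, List.length_nil]; omega
  · rw [c8, show s7.coins = s6.coins from rfl, c6, show s5.coins = s4.coins from rfl, c4, c3]
  · rw [v8, v7]
  · intro j hj
    rw [g8 _ (by omega)]
    have : s7.mem (R + K * j) = if j = 0 then L else s6.mem (R + K * j) := by
      have h1 : 1 ≠ R := by omega
      have h2 : R + K * j ≠ 2 := by omega
      have h3 : R + K * j ≠ 1 := by omega
      have h4 : K ≠ 0 := by omega
      simp [hs7, execs, Instr.exec, State.write_mem, Op.eval, p1, h2, h3, h4]
    rw [this]
    split
    · subst j; exact h0.symm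
    · have := t6 (j - 1) (by omega)
      rw [g5 _ (by omega), one_mul, cells _ (by omega), show j - 1 + 1 = j by omega] at this
      rw [← this, add_assoc, show K + K * (j - 1) = K * j by
        obtain ⟨i, rfl⟩ : ∃ i, j = i + 1 := ⟨j - 1, by omega⟩
        rw [Nat.add_sub_cancel]; ring]

/-- Move the first entries of the array `1` to the initial cells of the memory; the entry `0`, reduced
modulo cell `0`, is the number of the further entries that are moved. -/
def epilogue (R K : ℕ) : Program :=
  block (.const 1 (R + 1)) [.load 1 1, .arith .mod 1 1 0, .const 2 (R + 2 * K + 20),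
    .arith .mul 0 1 2, .arith .add 0 0 2, .const 8 1, .arith .add 2 1 8, .const 3 (R + 1),
    .copy 4 0, .const 5 K, .const 6 1] ;; transfer ;;
  block (.store 0 1) [.const 4 8, .arith .sub 2 1 4, .const 4 9, .arith .add 3 0 4, .const 5 1,
    .const 6 1, .const 8 1] ;; transfer ;;
  block (.const 1 1) [.arith .add 1 1 0, .const 2 2, .arith .add 2 2 0, .const 3 3,
    .arith .add 3 3 0, .const 4 4, .arith .add 4 4 0, .const 5 5, .arith .add 5 5 0, .const 6 6,
    .arith .add 6 6 0, .const 7 7, .arith .add 7 7 0, .const 8 8, .arith .add 8 8 0,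
    .load 1 1, .load 2 2, .load 3 3, .load 4 4, .load 5 5, .load 6 6, .load 7 7, .load 8 8,
    .load 0 0]

/-- The output belongs into the cells that the transfer itself works with. It is therefore gathered
at an address `H` beyond the last source; the cells from `9` on are then filled by a second
transfer, and the first nine by straight-line code. -/
theorem run_epilogue {G R K M : ℕ} (hG : 5 ≤ G) (hR : 10 ≤ R) (hK : 1 ≤ K)
    (hRK : R + 2 * K + 20 < 2 ^ G) (hM : 1 ≤ M) {s : State} (h0 : s.mem 0 = M) :
    ∃ s', Run G (epilogue R K) s s' (12 * M + 60) ∧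
      s'.mem 0 = s.mem (R + 1) % M ∧
      ∀ j < s.mem (R + 1) % M, s'.mem (j + 1) = s.mem (R + 1 + K * (j + 1)) := by
  have hG1 : 1 ≤ G := by omega
  have h32 : 2 ^ 5 ≤ 2 ^ G := Nat.pow_le_pow_right (by norm_num) hG
  obtain ⟨L, hL⟩ : ∃ L, L = s.mem (R + 1) % M := ⟨_, rfl⟩
  have hLM : L < M := hL ▸ Nat.mod_lt _ hM
  obtain ⟨H, hH⟩ : ∃ H, H = L * (R + 2 * K + 20) + (R + 2 * K + 20) := ⟨_, rfl⟩
  have hKL : R + 1 + K * L + L + 18 < H := by nlinarith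
  rw [← hL]
  have r1 := Run.block hG1 (.const 1 (R + 1)) [.load 1 1, .arith .mod 1 1 0,
    .const 2 (R + 2 * K + 20), .arith .mul 0 1 2, .arith .add 0 0 2, .const 8 1,
    .arith .add 2 1 8, .const 3 (R + 1), .copy 4 0, .const 5 K, .const 6 1] s (by
      simp [OkAll, Instr.Ok, Instr.exec, State.write_mem]; omega)
  set s1 := execs _ s with hs1
  have v1 : s1.mem 0 = H ∧ s1.mem 1 = L ∧ s1.mem 2 = L + 1 ∧ s1.mem 3 = R + 1 ∧ s1.mem 4 = H ∧
      s1.mem 5 = K ∧ s1.mem 6 = 1 ∧ s1.mem 8 = 1 := by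
    simp [hs1, execs, Instr.exec, State.write_mem, Op.eval, h0, show R ≠ 0 by omega, ← hL, hH]
  have g1 : ∀ j, 9 ≤ j → s1.mem j = s.mem j := by
    intro j hj
    rw [hs1]
    simp only [execs, Instr.exec, State.write_mem]
    rw [if_neg, if_neg, if_neg, if_neg, if_neg, if_neg, if_neg, if_neg, if_neg, if_neg, if_neg,
      if_neg] <;> omega
  obtain ⟨e0, e1, e2, e3, e4, e5, e6, e8⟩ := v1
  obtain ⟨s2, r2, c2, t2, f2⟩ := run_transfer hG1 e2 e3 e4 e5 e6 e8 (by intros; omega) (by omega)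
    le_rfl (fun i hi j hj => by
      have : K * i ≤ K * L := Nat.mul_le_mul_left _ (by omega)
      omega)
  have r3 := Run.block hG1 (.store 0 1) [.const 4 8, .arith .sub 2 1 4, .const 4 9,
    .arith .add 3 0 4, .const 5 1, .const 6 1, .const 8 1] s2 (by
      simp [OkAll, Instr.Ok]; omega)
  set s3 := execs _ s2 with hs3
  have q0 : s2.mem 0 = H := by rw [f2 0 (by omega) (by intros; omega), e0]
  have q1 : s2.mem 1 = L := by rw [f2 1 (by omega) (by intros; omega), e1]
  have v3 : s3.mem 0 = H ∧ s3.mem 1 = L ∧ s3.mem 2 = L - 8 ∧ s3.mem 3 = H + 9 ∧ s3.mem 4 = 9 ∧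
      s3.mem 5 = 1 ∧ s3.mem 6 = 1 ∧ s3.mem 8 = 1 := by
    simp [hs3, execs, Instr.exec, State.write_mem, Op.eval, q0, q1, show 0 ≠ H by omega,
      show 1 ≠ H by omega]
  have g3 : ∀ j, 9 ≤ j → s3.mem j = if j = H then L else s2.mem j := by
    intro j hj
    rw [hs3]
    simp only [execs, Instr.exec, State.write_mem, q0, q1]
    rw [if_neg, if_neg, if_neg, if_neg, if_neg, if_neg, if_neg] <;> omega
  obtain ⟨d0, d1, d2, d3, d4, d5, d6, d8⟩ := v3
  obtain ⟨s4, r4, c4, t4, f4⟩ := run_transfer hG1 d2 d3 d4 d5 d6 d8 (by intros; omega) (by omega)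
    le_rfl (by intros; omega)
  have p0 : s4.mem 0 = H := by rw [f4 0 (by omega) (by intros; omega), d0]
  have cells : ∀ j ≤ L, 1 ≤ j → s3.mem (H + j) = s.mem (R + 1 + K * j) := by
    intro j hj hj1
    have := t2 j (by omega)
    rw [one_mul] at this
    rw [g3 _ (by omega), if_neg (by omega), this, g1 _ (by omega)]
  have high : ∀ j, s4.mem (H + j) = s3.mem (H + j) := fun j => f4 _ (by omega) (by intros; omega)
  -- Each of the cells `1, …, 8` first receives its own source address `H + j` and then loads
  -- through itself; cell `0`, which holds `H`, comes last.
  have r5 := Run.block hG1 (.const 1 1) [.arith .add 1 1 0, .const 2 2, .arith .add 2 2 0,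
    .const 3 3, .arith .add 3 3 0, .const 4 4, .arith .add 4 4 0, .const 5 5, .arith .add 5 5 0,
    .const 6 6, .arith .add 6 6 0, .const 7 7, .arith .add 7 7 0, .const 8 8, .arith .add 8 8 0,
    .load 1 1, .load 2 2, .load 3 3, .load 4 4, .load 5 5, .load 6 6, .load 7 7, .load 8 8,
    .load 0 0] s4 (by simp [OkAll, Instr.Ok]; omega)
  set s5 := execs _ s4 with hs5
  have key : (s5.mem 0 = s4.mem H) ∧ (∀ j, 1 ≤ j → j ≤ 8 → s5.mem j = s4.mem (H + j)) ∧
      ∀ j, 9 ≤ j → s5.mem j = s4.mem j := by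
    have ne : ∀ i ≤ 8, H ≠ i := fun i hi => by omega
    have ne' : ∀ i ≤ 8, ∀ j, j + H ≠ i := fun i hi => by omega
    refine ⟨?_, ?_, ?_⟩
    · simp [hs5, execs, Instr.exec, State.write_mem, Op.eval, p0, ne]
    · intro j hj hj8
      interval_cases j <;>
        simp [hs5, execs, Instr.exec, State.write_mem, Op.eval, p0, ne', add_comm H, show H ≠ 0 by omega]
    · intro j hj
      have : ∀ i ≤ 8, j ≠ i := fun i hi => by omega
      simp [hs5, execs, Instr.exec, State.write_mem, Op.eval, this]
  obtain ⟨k0, k1, k2⟩ := key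
  refine ⟨s5, (r1.seq (r2.seq (r3.seq (r4.seq r5)))).mono ?_, ?_, ?_⟩
  · simp only [List.length_cons, List.length_nil]; omega
  · have h := high 0
    rw [add_zero] at h
    rw [k0, h, g3 _ (by omega), if_pos rfl]
  · intro j hj
    by_cases hj8 : j + 1 ≤ 8
    · rw [k1 _ (by omega) hj8, high, cells _ (by omega) (by omega)]
    · have := t4 (j + 1 - 9) (by omega)
      rw [one_mul, show 9 + (j + 1 - 9) = j + 1 by omega,
        show H + 9 + (j + 1 - 9) = H + (j + 1) by omega, cells _ (by omega) (by omega)] at this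
      rw [k2 _ (by omega), this]

end RAM

/-! ### From commands to programs of polynomial cost -/

namespace RAM

open LoopLang

theorem eval_mono (p : Polynomial ℕ) {m n : ℕ} (h : m ≤ n) : p.eval m ≤ p.eval n := by
  induction p using Polynomial.induction_on' with
  | add p q hp hq => simpa using add_le_add hp hq
  | monomial i a =>
    simp only [Polynomial.eval_monomial]
    gcongr

theorem size_le_inputSize {x : List ℕ} {a : ℕ} (h : a ∈ x) : Nat.size a ≤ inputSize x := by
  have : Nat.size a + 1 ≤ inputSize x :=
    List.single_le_sum (by simp) _ (List.mem_map.2 ⟨a, h, rfl⟩)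
  omega

theorem length_le_inputSize (x : List ℕ) : x.length ≤ inputSize x := by
  induction x with
  | nil => simp
  | cons a x ih =>
    have : inputSize (a :: x) = Nat.size a + 1 + inputSize x := by simp [inputSize]
    rw [List.length_cons, this]; omega

theorem initial_lt (x : List ℕ) (r : List Bool) (j : ℕ) :
    (State.initial x r).mem j < 2 ^ inputSize x := by
  rw [← Nat.size_le]
  show Nat.size ((x.length :: x).getD j 0) ≤ _
  rcases lt_or_ge j (x.length + 1) with h | h
  · rw [List.getD_eq_getElem _ _ (by simpa using h)]
    have := List.getElem_mem (l := x.length :: x) (n := j) (by simpa using h)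
    rcases List.mem_cons.1 this with h | h
    · rw [h, Nat.size_le]
      exact (length_le_inputSize x).trans_lt Nat.lt_two_pow_self
    · exact size_le_inputSize h
  · rw [List.getD_eq_default _ _ (by simpa using h)]; simp

theorem Outputs.mono {P : Program} {x : List ℕ} {r : List Bool} {T T' : ℕ} {y : List ℕ}
    (h : Outputs P x r T y) (hT : T ≤ T') : Outputs P x r T' y := by
  obtain ⟨s, t, h1, h2, h3⟩ := h
  exact ⟨s, t, h1, h2.trans hT, h3⟩

/-- The output of a command: array `1`, where the entry `0` is the number of the further entries. -/
def Store.output (M : ℕ) (σ : Store) : List ℕ :=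
  (List.range (σ.arr 1 0 % M)).map fun j => σ.arr 1 (j + 1)

/-- The store `σ` holds the input `x` in array `0`, preceded by its length. -/
def Store.Holds (σ : Store) (x : List ℕ) : Prop :=
  ∀ j ≤ x.length, σ.arr 0 j = (x.length :: x).getD j 0

/-- Commands can be executed in polynomial time, with any power `M` of the length of the input, up to
additive constants, as a bound for their loops. -/
theorem exists_program (c : Cmd) (c₀ : ℕ) {e : ℕ} (he : 1 ≤ e) :
    ∃ (P : Program) (p : Polynomial ℕ) (C : ℕ), c₀ ≤ C ∧ ∀ (x : List ℕ) (r : List Bool), x ≠ [] →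
      ∃ σ : Store, Store.Holds σ x ∧ σ.coins = r ∧
        Outputs P x r (p.eval (inputSize x))
          (Store.output ((x.length + C) ^ e) (c.run ((x.length + C) ^ e) [] σ)) := by
  obtain ⟨K, hK⟩ : ∃ K, K = c.size + 2 := ⟨_, rfl⟩
  obtain ⟨R, hR⟩ : ∃ R, R = c.height + 12 := ⟨_, rfl⟩
  obtain ⟨D, hD⟩ : ∃ D, D = R + 2 * K + 10 := ⟨_, rfl⟩
  -- `C` exceeds the layout parameters and the constants they require, so `M ≥ L + C` makes every
  -- side condition hold with `G = M`.
  obtain ⟨C, hC⟩ : ∃ C, C = c₀ + D + R + 2 * K + 30 := ⟨_, rfl⟩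
  obtain ⟨q, hq⟩ := c.exists_steps_eq
  -- `W` bounds the number of steps in terms of `M`: the command takes `q`, and the `12 * L` and `12
  -- * M` steps of the frame are covered by `24 * M`.
  let W : Polynomial ℕ := q + 24 * .X + .C (D + 2 * R + e + 100)
  let pM : Polynomial ℕ := (.X + .C C) ^ e
  -- The polynomial is the cost bound in `Run` with `G = M`, `w = W` and initial contents of
  -- `inputSize x` bits.
  refine ⟨prologue R K D C e ;; c.compile R K [] 1 ;; epilogue R K,
    W.comp pM * (1 + pM + 2 * (.X + pM * W.comp pM)), C, by omega, fun x r hx => ?_⟩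
  obtain ⟨L, hL⟩ : ∃ L, L = x.length := ⟨_, rfl⟩
  have hL1 : 1 ≤ L := by rw [hL]; exact List.length_pos_iff.2 hx
  rw [← hL]
  obtain ⟨M, hM⟩ : ∃ M, M = (L + C) ^ e := ⟨_, rfl⟩
  rw [← hM]
  have hLM : L + C ≤ M := by rw [hM]; exact Nat.le_self_pow (by omega) _
  have hM2 : M < 2 ^ M := Nat.lt_two_pow_self
  have P : Params M M R K := ⟨by omega, by omega, hM2, by omega⟩
  have hDpow : D < 2 ^ D := Nat.lt_two_pow_self
  obtain ⟨s1, r1, c1, v1, g1⟩ := run_prologue (G := M) (R := R) (K := K) (D := D) (C := C) (e := e)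
    (L := L) (s := State.initial x r) (by omega) (by omega) (by omega) (by omega) (by omega)
    (by omega) (by omega) hL1 (by simp [State.initial, hL])
  rw [← hM] at v1
  let σ : Store := ⟨fun y i => s1.mem (R + K * i + y), s1.coins⟩
  have rep : Rep M R K s1 σ.arr [] [] 1 := ⟨le_rfl, v1, fun _ _ _ => rfl, rfl, by simp⟩
  obtain ⟨s2, r2, l2, rep2, c2⟩ := c.run_compile P [] [] 1 s1 σ (by omega) (by omega) rep rfl
  obtain ⟨s3, r3, v3, g3⟩ := run_epilogue (G := M) (R := R) (K := K) (M := M) (s := s2) (by omega)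
    (by omega) (by omega) (by omega) (by omega) rep2.bound
  have hout : ∀ i, s2.mem (R + 1 + K * i) = (c.run M [] σ).arr 1 i := fun i => by
    rw [← rep2.arr 1 (by omega) i]; congr 1; ring
  have hout0 := hout 0
  rw [mul_zero, add_zero] at hout0
  refine ⟨σ, fun j hj => ?_, c1, ?_⟩
  · rw [← hL] at hj
    exact g1 j hj
  · obtain ⟨-, t, ht, hexec⟩ := (r1.seq (r2.seq r3)) _ (initial_lt x r)
    refine ⟨s3, t, hexec, ht.trans ?_, ?_⟩
    · have hn := length_le_inputSize x
      have hMp : M ≤ pM.eval (inputSize x) := by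
        simp only [pM, Polynomial.eval_pow, Polynomial.eval_add, Polynomial.eval_X,
          Polynomial.eval_C, hM]
        gcongr
        omega
      have hW : D + 2 * R + e + 12 * L + 40 + (c.steps M + (12 * M + 60)) ≤
          W.eval (pM.eval (inputSize x)) := by
        refine le_trans ?_ (eval_mono W hMp)
        simp only [W, Polynomial.eval_add, Polynomial.eval_mul, Polynomial.eval_X,
          Polynomial.eval_C, Polynomial.eval_ofNat, ← hq]
        omega
      simp only [Polynomial.eval_add, Polynomial.eval_mul, Polynomial.eval_comp, Polynomial.eval_X,
        Polynomial.eval_ofNat, Polynomial.eval_one]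
      gcongr
    · rw [State.output, v3, hout0, Store.output]
      refine List.map_congr_left fun j hj => ?_
      rw [g3 j (by rw [hout0]; exact List.mem_range.1 hj), hout]

end RAM

/-! # Weighted sums over the runs of an automaton -/

namespace Multitape

open Finset

section RunSum

variable {k : ℕ} {α : Fin k → Type} [∀ i, Fintype (α i)] {Q : Type} [Fintype Q]
  {R : Type*} [CommSemiring R]

/-- The sum over the runs of length `n` from `q` that read `p i` letters from tape `i`, where a letter
`x` read as the last but `j` letter of its tape has the weight `w x j`, an edge has the weight `E`,
and the last state has the weight `F`. -/
def runSum (E : Q → Letter α → Q → ℕ) (F : Q → ℕ) (w : Letter α → ℕ → R) :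
    ℕ → (Fin k → ℕ) → Q → R
  | 0, p, q => if p = 0 then (F q : R) else 0
  | n + 1, p, q => ∑ x : Letter α, if 0 < p x.1 then
      ∑ q', (E q x q' : R) * w x (p x.1 - 1) * runSum E F w n (p - Pi.single x.1 1) q' else 0

theorem sum_sub_single {p : Fin k → ℕ} {i : Fin k} (h : 0 < p i) :
    ∑ j, (p - Pi.single i 1 : Fin k → ℕ) j + 1 = ∑ j, p j := by
  have : p = (p - Pi.single i 1 : Fin k → ℕ) + Pi.single i 1 := by
    ext j
    by_cases hj : j = i
    · subst hj; simp; omega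
    · simp [hj]
  conv_rhs => rw [this]
  simp [Finset.sum_add_distrib]

/-- Every edge reads exactly one letter, so the length of a run is the total length of its label. -/
theorem runSum_eq_zero (E : Q → Letter α → Q → ℕ) (F : Q → ℕ) (w : Letter α → ℕ → R) {n : ℕ}
    {p : Fin k → ℕ} (h : ∑ i, p i ≠ n) (q : Q) : runSum E F w n p q = 0 := by
  induction n generalizing p q with
  | zero =>
    rw [runSum, if_neg]
    rintro rfl
    simp at h
  | succ n ih =>
    rw [runSum]
    refine Finset.sum_eq_zero fun x _ => ?_
    split
    · rename_i hx
      refine Finset.sum_eq_zero fun q' _ => ?_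
      rw [ih, mul_zero]
      have := sum_sub_single hx
      omega
    · rfl

/-- The same recursion is used over polynomials in the analysis and over natural numbers in the
algorithm; ring homomorphisms connect the two. -/
theorem map_runSum {R' : Type*} [CommSemiring R'] (f : R →+* R') (E : Q → Letter α → Q → ℕ)
    (F : Q → ℕ) (w : Letter α → ℕ → R) (n : ℕ) (p : Fin k → ℕ) (q : Q) :
    f (runSum E F w n p q) = runSum E F (fun x j => f (w x j)) n p q := by
  induction n generalizing p q with
  | zero => simp only [runSum]; split <;> simp
  | succ n ih =>
    simp only [runSum, map_sum]
    refine Finset.sum_congr rfl fun x _ => ?_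
    split
    · simp [ih]
    · simp

/-- The weight of a word. -/
def wordWeight {β : Type*} (w : β → ℕ → R) : List β → R
  | [] => 1
  | a :: l => w a l.length * wordWeight w l

/-- The weight of a tuple of words. -/
def weight (w : Letter α → ℕ → R) (s : Tuple α) : R :=
  ∏ i, wordWeight (fun a => w ⟨i, a⟩) (FreeMonoid.toList (s i))

/-- The lengths of the words of a tuple. -/
def lengths {α : Fin k → Type} (s : Tuple α) (i : Fin k) : ℕ := (FreeMonoid.toList (s i)).length

theorem toTuple_mul_same {α : Fin k → Type} (x : Letter α) (s : Tuple α) :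
    FreeMonoid.toList ((x.toTuple * s) x.1) = x.2 :: FreeMonoid.toList (s x.1) := by
  simp [Letter.toTuple]

theorem toTuple_mul_of_ne {α : Fin k → Type} (x : Letter α) (s : Tuple α) {i : Fin k}
    (h : i ≠ x.1) : (x.toTuple * s) i = s i := by
  simp [Letter.toTuple, Pi.mulSingle_eq_of_ne h]

theorem lengths_toTuple_mul {α : Fin k → Type} (x : Letter α) (s : Tuple α) :
    lengths (x.toTuple * s) = lengths s + Pi.single x.1 1 := by
  ext i
  by_cases h : i = x.1
  · subst h
    rw [lengths, toTuple_mul_same, Pi.add_apply, Pi.single_eq_same, List.length_cons, lengths]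
  · simp [lengths, toTuple_mul_of_ne x s h, h]

/-- Positions are counted from the end of a word, so a letter put in front does not move the others;
its own position is the length of the old word. This makes the weights compatible with the recursion
of `runSum` on the first edge. -/
theorem weight_toTuple_mul {α : Fin k → Type} (w : Letter α → ℕ → R) (x : Letter α) (s : Tuple α) :
    weight w (x.toTuple * s) = w x (lengths s x.1) * weight w s := by
  rw [weight, weight, ← Finset.mul_prod_erase _ _ (mem_univ x.1),
    ← Finset.mul_prod_erase univ (fun i => wordWeight _ (FreeMonoid.toList (s i))) (mem_univ x.1),
    ← mul_assoc]
  congr 1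
  · rw [toTuple_mul_same]; rfl
  · refine Finset.prod_congr rfl fun i hi => ?_
    rw [toTuple_mul_of_ne x s (Finset.ne_of_mem_erase hi)]

theorem lengths_eq_iff {α : Fin k → Type} (x : Letter α) (s : Tuple α) (p : Fin k → ℕ) :
    lengths (x.toTuple * s) = p ↔ 0 < p x.1 ∧ lengths s = p - Pi.single x.1 1 := by
  rw [lengths_toTuple_mul]
  constructor
  · rintro rfl; simp
  · rintro ⟨h, h'⟩
    rw [h']
    ext j
    by_cases hj : j = x.1
    · subst hj; simp; omega
    · simp [hj]

end RunSum

/-! ### Multiplicities as coefficients of weighted sums of runs -/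

namespace Automaton

variable {k : ℕ} {α : Fin k → Type} {Q : Type}

theorem label_cons (e : Q × Letter α × Q) (ρ : List (Q × Letter α × Q)) :
    label (e :: ρ) = e.2.1.toTuple * label ρ := by simp [label]

theorem sum_lengths_label (ρ : List (Q × Letter α × Q)) : ∑ i, lengths (label ρ) i = ρ.length := by
  induction ρ with
  | nil => simp [label, lengths]
  | cons e ρ ih =>
    rw [label_cons, lengths_toTuple_mul]
    simp [Finset.sum_add_distrib, ih]

/-- The weight of an edge. -/
noncomputable def edgeBit (A : Automaton α Q) (q : Q) (x : Letter α) (q' : Q) : ℕ :=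
  bit ((q, x, q') ∈ A.edges)

/-- The weight of a final state. -/
noncomputable def finalBit (A : Automaton α Q) (q : Q) : ℕ := bit (q ∈ A.final)

/-- The weight of an initial state. -/
noncomputable def startBit (A : Automaton α Q) (q : Q) : ℕ := bit (q ∈ A.start)

variable [∀ i, Fintype (α i)] [Fintype Q]

open Classical in
/-- The runs of length `n` from `q` to a final state. -/
noncomputable def runsFrom (A : Automaton α Q) : ℕ → Q → Finset (List (Q × Letter α × Q) × Q)
  | 0, q => if q ∈ A.final then {([], q)} else ∅
  | n + 1, q => (univ.filter fun e : Letter α × Q => (q, e.1, e.2) ∈ A.edges).biUnion fun e =>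
      (A.runsFrom n e.2).image fun r => ((q, e.1, e.2) :: r.1, r.2)

theorem mem_runsFrom (A : Automaton α Q) (n : ℕ) (q : Q) (r : List (Q × Letter α × Q) × Q) :
    r ∈ A.runsFrom n q ↔ r.1.length = n ∧ A.IsRun q r.1 r.2 ∧ r.2 ∈ A.final := by
  classical
  obtain ⟨ρ, q'⟩ := r
  induction n generalizing q ρ with
  | zero =>
    rw [runsFrom]
    split
    · rename_i h
      simp only [mem_singleton, Prod.mk.injEq, List.length_eq_zero_iff]
      constructor
      · rintro ⟨rfl, rfl⟩; exact ⟨rfl, .nil _, h⟩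
      · rintro ⟨rfl, h1, h2⟩; cases h1; exact ⟨rfl, rfl⟩
    · rename_i h
      simp only [notMem_empty, List.length_eq_zero_iff, false_iff]
      rintro ⟨rfl, h1, h2⟩; cases h1; exact h h2
  | succ n ih =>
    simp only [runsFrom, mem_biUnion, mem_filter, mem_univ, true_and, mem_image, Prod.mk.injEq,
      Prod.exists]
    constructor
    · rintro ⟨x, q1, he, ρ', q'', hr, rfl, rfl⟩
      obtain ⟨h1, h2, h3⟩ := (ih q1 ρ').1 hr
      exact ⟨by simpa using h1, .cons he h2, h3⟩
    · rintro ⟨h1, h2, h3⟩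
      cases h2 with
      | nil => simp at h1
      | cons he h2 => exact ⟨_, _, he, _, _, (ih _ _).2 ⟨by simpa using h1, h2, h3⟩, rfl, rfl⟩

theorem sum_runsFrom_succ {R : Type*} [AddCommMonoid R] (A : Automaton α Q) (n : ℕ) (q : Q)
    (g : List (Q × Letter α × Q) → R) :
    ∑ r ∈ A.runsFrom (n + 1) q, g r.1 =
      ∑ x : Letter α, ∑ q', A.edgeBit q x q' • ∑ r ∈ A.runsFrom n q', g ((q, x, q') :: r.1) := by
  classical
  rw [runsFrom, Finset.sum_biUnion]
  · rw [Finset.sum_filter, Fintype.sum_prod_type]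
    refine Finset.sum_congr rfl fun x _ => Finset.sum_congr rfl fun q' _ => ?_
    simp only [edgeBit, bit]
    split
    · rw [one_smul, Finset.sum_image]
      rintro ⟨ρ, q1⟩ _ ⟨ρ', q1'⟩ _ h
      simpa using h
    · simp
  · rintro ⟨x, q1⟩ _ ⟨x', q1'⟩ _ hne
    rw [Function.onFun, Finset.disjoint_left]
    rintro r h1 h2
    obtain ⟨r1, _, rfl⟩ := mem_image.1 h1
    obtain ⟨r2, _, h⟩ := mem_image.1 h2
    simp only [Prod.mk.injEq, List.cons.injEq, true_and] at h
    exact hne (by rw [h.1.1.1, h.1.1.2])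

open Classical in
theorem runSum_eq_sum_runsFrom {R : Type*} [CommSemiring R] (A : Automaton α Q)
    (w : Letter α → ℕ → R) (n : ℕ) (p : Fin k → ℕ) (q : Q) :
    runSum A.edgeBit A.finalBit w n p q =
      ∑ r ∈ A.runsFrom n q, if lengths (label r.1) = p then weight w (label r.1) else 0 := by
  induction n generalizing p q with
  | zero =>
    rw [runSum, runsFrom]
    have h0 : lengths (label ([] : List (Q × Letter α × Q))) = 0 := by ext i; simp [label, lengths]
    have h1 : weight w (label ([] : List (Q × Letter α × Q))) = 1 := by
      simp [label, weight, wordWeight]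
    by_cases hq : q ∈ A.final
    · simp [hq, finalBit, bit, h0, h1, eq_comm]
    · simp [hq, finalBit, bit]
  | succ n ih =>
    rw [runSum, A.sum_runsFrom_succ n q fun ρ =>
      if lengths (label ρ) = p then weight w (label ρ) else 0]
    refine Finset.sum_congr rfl fun x _ => ?_
    simp only [label_cons, lengths_eq_iff, weight_toTuple_mul]
    split
    · rename_i hx
      refine Finset.sum_congr rfl fun q' _ => ?_
      rw [ih, nsmul_eq_mul, mul_assoc, Finset.mul_sum]
      congr 1
      refine Finset.sum_congr rfl fun r _ => ?_
      by_cases h : lengths (label r.1) = p - Pi.single x.1 1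
      · rw [if_pos h, if_pos ⟨hx, h⟩, h]; simp
      · rw [if_neg h, if_neg fun h' => h h'.2, mul_zero]
    · rename_i hx
      simp [hx]

open Classical in
/-- The accepting runs of length `n`. -/
noncomputable def runsOfLength (A : Automaton α Q) (n : ℕ) :
    Finset (Q × List (Q × Letter α × Q) × Q) :=
  (univ.filter (· ∈ A.start)).biUnion fun q => (A.runsFrom n q).image fun r => (q, r)

theorem mem_runsOfLength (A : Automaton α Q) (n : ℕ) (r : Q × List (Q × Letter α × Q) × Q) :
    r ∈ A.runsOfLength n ↔
      r.1 ∈ A.start ∧ r.2.2 ∈ A.final ∧ A.IsRun r.1 r.2.1 r.2.2 ∧ r.2.1.length = n := by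
  classical
  obtain ⟨q, ρ, q'⟩ := r
  simp [runsOfLength, mem_runsFrom]
  tauto

theorem sum_runsOfLength {R : Type*} [AddCommMonoid R] (A : Automaton α Q) (n : ℕ)
    (g : List (Q × Letter α × Q) → R) :
    ∑ r ∈ A.runsOfLength n, g r.2.1 = ∑ q, A.startBit q • ∑ r ∈ A.runsFrom n q, g r.1 := by
  classical
  rw [runsOfLength, Finset.sum_biUnion]
  · rw [Finset.sum_filter]
    refine Finset.sum_congr rfl fun q _ => ?_
    simp only [startBit, bit]
    split
    · rw [one_smul, Finset.sum_image]
      rintro r _ r' _ h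
      simpa using h
    · simp
  · rintro q _ q' _ hne
    rw [Function.onFun, Finset.disjoint_left]
    rintro r h1 h2
    obtain ⟨r1, _, rfl⟩ := mem_image.1 h1
    obtain ⟨r2, _, h⟩ := mem_image.1 h2
    exact hne (by simp at h; exact h.1.symm)

/-- The label determines the length of a run; hence only finitely many runs accept `s`, and
`Set.ncard` is a genuine count. -/
theorem acceptingRuns_eq (A : Automaton α Q) (s : Tuple α) :
    A.acceptingRuns s = {r | r ∈ A.runsOfLength (∑ i, lengths s i) ∧ label r.2.1 = s} := by
  ext r
  simp only [acceptingRuns, Set.mem_ofPred_eq, mem_runsOfLength]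
  constructor
  · rintro ⟨h1, h2, h3, rfl⟩
    exact ⟨⟨h1, h2, h3, (sum_lengths_label _).symm⟩, rfl⟩
  · rintro ⟨⟨h1, h2, h3, -⟩, h4⟩
    exact ⟨h1, h2, h3, h4⟩

open Classical in
theorem mult_eq (A : Automaton α Q) (s : Tuple α) :
    A.mult s = #{r ∈ A.runsOfLength (∑ i, lengths s i) | label r.2.1 = s} := by
  rw [mult, acceptingRuns_eq, ← Set.ncard_coe_finset]
  congr 1
  ext r
  simp

end Automaton

theorem finite_lengths_eq {k : ℕ} {α : Fin k → Type} [∀ i, Fintype (α i)] (p : Fin k → ℕ) :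
    {s : Tuple α | lengths s = p}.Finite := by
  have : {s : Tuple α | lengths s = p} =
      Set.univ.pi fun i => {l : FreeMonoid (α i) | (FreeMonoid.toList l).length = p i} := by
    ext s
    simp [lengths, funext_iff]
  rw [this]
  exact Set.Finite.pi fun i => List.finite_length_eq (α i) (p i)

/-- The tuples with given lengths of the words. -/
noncomputable def tuples {k : ℕ} (α : Fin k → Type) [∀ i, Fintype (α i)] (p : Fin k → ℕ) :
    Finset (Tuple α) := (finite_lengths_eq p).toFinset

theorem mem_tuples {k : ℕ} {α : Fin k → Type} [∀ i, Fintype (α i)] {p : Fin k → ℕ} {s : Tuple α} :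
    s ∈ tuples α p ↔ lengths s = p := by simp [tuples]

namespace Automaton

variable {k : ℕ} {α : Fin k → Type} {Q : Type} [∀ i, Fintype (α i)] [Fintype Q]
  {R : Type*} [CommSemiring R]

/-- The weighted sum of the accepting runs that read words of given lengths. -/
noncomputable def value (A : Automaton α Q) (w : Letter α → ℕ → R) (p : Fin k → ℕ) : R :=
  ∑ q, (A.startBit q : R) * runSum A.edgeBit A.finalBit w (∑ i, p i) p q

/-- Grouping the runs by their labels turns the sum that can be computed by recursion into a
generating function of the multiplicities. -/
theorem value_eq (A : Automaton α Q) (w : Letter α → ℕ → R) (p : Fin k → ℕ) :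
    A.value w p = ∑ s ∈ tuples α p, (A.mult s : R) * weight w s := by
  classical
  have h1 : A.value w p = ∑ r ∈ A.runsOfLength (∑ i, p i),
      if lengths (label r.2.1) = p then weight w (label r.2.1) else 0 := by
    rw [A.sum_runsOfLength _ fun ρ => if lengths (label ρ) = p then weight w (label ρ) else 0]
    simp only [value, runSum_eq_sum_runsFrom, nsmul_eq_mul]
  have h2 : ∀ s ∈ tuples α p, (A.mult s : R) * weight w s =
      ∑ r ∈ A.runsOfLength (∑ i, p i), if label r.2.1 = s then weight w s else 0 := by
    intro s hs
    rw [mult_eq, mem_tuples.1 hs, Finset.sum_ite, Finset.sum_const_zero, add_zero,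
      Finset.sum_const, nsmul_eq_mul]
  rw [h1, Finset.sum_congr rfl h2, Finset.sum_comm]
  refine Finset.sum_congr rfl fun r _ => ?_
  rw [Finset.sum_ite_eq]
  simp only [mem_tuples]

end Automaton

end Multitape

/-! # Automata that agree on short tuples are equivalent -/

namespace Multitape

open Finset

/-! ### Weights that single out one tuple -/

section Weight

variable {k : ℕ} {R : Type*} [CommSemiring R]

theorem wordWeight_congr {β : Type*} {w w' : β → ℕ → R} {l : List β}
    (h : ∀ a, ∀ j < l.length, w a j = w' a j) : wordWeight w l = wordWeight w' l := by
  induction l with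
  | nil => rfl
  | cons a l ih =>
    rw [wordWeight, wordWeight, h a _ (by simp), ih fun b j hj => h b j (by simp; omega)]

theorem weight_congr {α : Fin k → Type} {w w' : Letter α → ℕ → R} {s : Tuple α}
    (h : ∀ x, ∀ j < lengths s x.1, w x j = w' x j) : weight w s = weight w' s :=
  Finset.prod_congr rfl fun i _ => wordWeight_congr fun a j hj => h ⟨i, a⟩ j hj

-- Induction on the word. The comparison word is reversed because positions count from the end;
-- dropping its first letter thus leaves the smaller positions unchanged.
open Classical in
theorem wordWeight_indicator {β : Type*} {l l₀ : List β} (h : l.length = l₀.length) :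
    wordWeight (fun a j => if l₀.reverse[j]? = some a then (1 : R) else 0) l =
      if l = l₀ then 1 else 0 := by
  induction l generalizing l₀ with
  | nil =>
    obtain rfl : l₀ = [] := by simpa using h.symm
    simp [wordWeight]
  | cons a l ih =>
    cases l₀ with
    | nil => simp at h
    | cons b l₀ =>
      have hl : l.length = l₀.length := by simpa using h
      have : wordWeight (fun a j => if (b :: l₀).reverse[j]? = some a then (1 : R) else 0) l =
          wordWeight (fun a j => if l₀.reverse[j]? = some a then (1 : R) else 0) l :=
        wordWeight_congr fun c j hj => by
          rw [List.reverse_cons, List.getElem?_append_left (by simp; omega)]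
      rw [wordWeight, this, ih hl, List.reverse_cons, List.getElem?_append_right (by simp; omega)]
      by_cases hab : b = a
      · by_cases hll : l = l₀
        · simp [hab, hll]
        · simp [hab, hll]
      · have : ¬ a = b := fun h => hab h.symm
        simp [hl, hab, this]

open Classical in
/-- The weight of letters that is one for the letters of a given tuple and zero otherwise. -/
noncomputable def indicator {α : Fin k → Type} (R : Type*) [CommSemiring R] (s : Tuple α)
    (x : Letter α) (j : ℕ) : R :=
  if (FreeMonoid.toList (s x.1)).reverse[j]? = some x.2 then 1 else 0

open Classical in
theorem weight_indicator {α : Fin k → Type} {s s₀ : Tuple α} (h : lengths s = lengths s₀) :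
    weight (indicator R s₀) s = if s = s₀ then 1 else 0 := by
  have : ∀ i, wordWeight (fun a => indicator R s₀ ⟨i, a⟩) (FreeMonoid.toList (s i)) =
      if s i = s₀ i then 1 else 0 := fun i => by
    refine (wordWeight_congr fun a j _ => ?_).trans
      ((wordWeight_indicator (l₀ := FreeMonoid.toList (s₀ i)) (congrFun h i)).trans ?_)
    · simp [indicator]
    · simp
  rw [weight, Finset.prod_congr rfl fun i _ => this i]
  by_cases hs : s = s₀
  · simp [hs]
  · obtain ⟨i, hi⟩ := Function.ne_iff.1 hs
    rw [if_neg hs]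
    exact Finset.prod_eq_zero (mem_univ i) (if_neg hi)

end Weight

/-! ### Linear relations between sums of runs, and short witnesses -/

section Value

variable {k : ℕ} {α : Fin k → Type} [∀ i, Fintype (α i)] {Q Q' : Type} [Fintype Q] [Fintype Q']

namespace Automaton

/-- Weights at positions beyond the word lengths never matter, so they may hold arbitrary values in
the arrays of the algorithm. -/
theorem value_congr {R : Type*} [CommSemiring R] (A : Automaton α Q) {w w' : Letter α → ℕ → R}
    {p : Fin k → ℕ} (h : ∀ x, ∀ j < p x.1, w x j = w' x j) : A.value w p = A.value w' p := by
  rw [value_eq, value_eq]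
  refine Finset.sum_congr rfl fun s hs => ?_
  rw [weight_congr fun x j hj => h x j ((congrFun (mem_tuples.1 hs) x.1) ▸ hj)]

theorem map_value {R R' : Type*} [CommSemiring R] [CommSemiring R'] (f : R →+* R')
    (A : Automaton α Q) (w : Letter α → ℕ → R) (p : Fin k → ℕ) :
    f (A.value w p) = A.value (fun x j => f (w x j)) p := by
  simp [value, map_runSum]

theorem value_indicator {R : Type*} [CommSemiring R] (A : Automaton α Q) (s : Tuple α) :
    A.value (indicator R s) (lengths s) = A.mult s := by
  classical
  rw [value_eq, Finset.sum_eq_single s]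
  · rw [weight_indicator rfl, if_pos rfl, mul_one]
  · intro s' hs' hne
    rw [weight_indicator (mem_tuples.1 hs'), if_neg hne, mul_zero]
  · intro h
    exact absurd (mem_tuples.2 rfl) h

theorem value_eq_value {R : Type*} [CommSemiring R] (A : Automaton α Q) (B : Automaton α Q')
    {p : Fin k → ℕ} (h : ∀ s, lengths s = p → A.mult s = B.mult s) (w : Letter α → ℕ → R) :
    A.value w p = B.value w p := by
  rw [value_eq, value_eq]
  exact Finset.sum_congr rfl fun s hs => by rw [h s (mem_tuples.1 hs)]

/-- The multiplicities can be recovered from the sums with indeterminate weights. -/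
theorem mult_eq_of_value_X_eq {V : Type*} (A : Automaton α Q) (B : Automaton α Q')
    (φ : Letter α → ℕ → V) {s : Tuple α}
    (hφ : ∀ x j x' j', j < lengths s x.1 → j' < lengths s x'.1 → φ x j = φ x' j' → x = x' ∧ j = j')
    (h : A.value (fun x j => (MvPolynomial.X (φ x j) : MvPolynomial V ℤ)) (lengths s) =
      B.value (fun x j => (MvPolynomial.X (φ x j) : MvPolynomial V ℤ)) (lengths s)) :
    A.mult s = B.mult s := by
  classical
  -- The point at which the polynomials are evaluated: along `φ` it is the indicator weight of `s`.
  -- It is consistent because `φ` is injective on the letters and positions that occur.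
  let e : V → ℤ := fun v => if ∃ x j, j < lengths s x.1 ∧ φ x j = v ∧ indicator ℤ s x j = 1 then 1
    else 0
  have he : ∀ x, ∀ j < lengths s x.1, e (φ x j) = indicator ℤ s x j := by
    intro x j hj
    by_cases hi : indicator ℤ s x j = 1
    · rw [hi]
      exact if_pos ⟨x, j, hj, rfl, hi⟩
    · have h0 : indicator ℤ s x j = 0 := by
        unfold indicator at hi ⊢
        split at hi
        · exact absurd rfl hi
        · rename_i h; rw [if_neg h]
      rw [h0]
      refine if_neg ?_
      rintro ⟨x', j', hj', hxx, hi'⟩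
      obtain ⟨rfl, rfl⟩ := hφ _ _ _ _ hj' hj hxx
      exact hi hi'
  have h' := congrArg (MvPolynomial.eval e) h
  rw [map_value, map_value] at h'
  simp only [MvPolynomial.eval_X] at h'
  rw [A.value_congr he, B.value_congr he, value_indicator, value_indicator] at h'
  exact_mod_cast h'

end Automaton

/-- Indeterminates as weights, shifted by the positions `r`. -/
noncomputable def shiftX (α : Fin k → Type) (r : Fin k → ℕ) (x : Letter α) (j : ℕ) :
    MvPolynomial (Letter α × ℕ) ℤ := MvPolynomial.X (x, j + r x.1)

open Classical in
/-- Left linear relations persist for longer runs. -/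
theorem relation_add {ι : Type*} [Fintype ι] (E : Q → Letter α → Q → ℕ) (F : Q → ℕ)
    (r : ι → Fin k → ℕ) (n : ι → ℕ) (c : ι → MvPolynomial (Letter α × ℕ) ℤ)
    (h : ∀ P q, ∑ i, (if r i ≤ P then c i * runSum E F (shiftX α (r i)) (n i) (P - r i) q else 0) = 0)
    (l : ℕ) (P : Fin k → ℕ) (q : Q) :
    ∑ i, (if r i ≤ P then c i * runSum E F (shiftX α (r i)) (n i + l) (P - r i) q else 0) = 0 := by
  induction l generalizing P q with
  | zero => exact h P q
  | succ l ih =>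
    -- Split off the first edge. Its letter has the weight of position `(P - r i) x.1 - 1 + r i x.1
    -- = P x.1 - 1`, which no longer depends on `i`; it factors out of the whole relation and leaves
    -- the relation for `l` at the position one letter further on.
    have key : ∀ i, (if r i ≤ P then c i * runSum E F (shiftX α (r i)) (n i + (l + 1)) (P - r i) q
        else 0) = ∑ x : Letter α, if 0 < P x.1 then ∑ q', (E q x q' : MvPolynomial _ ℤ) *
          MvPolynomial.X (x, P x.1 - 1) * (if r i ≤ P - Pi.single x.1 1 then
            c i * runSum E F (shiftX α (r i)) (n i + l) (P - Pi.single x.1 1 - r i) q' else 0)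
          else 0 := by
      intro i
      rw [← add_assoc, runSum]
      by_cases hr : r i ≤ P
      · rw [if_pos hr, Finset.mul_sum]
        refine Finset.sum_congr rfl fun x _ => ?_
        have hrx := hr x.1
        by_cases hx : 0 < (P - r i) x.1
        · have hx' : r i x.1 < P x.1 := by simpa using hx
          have hle : r i ≤ P - Pi.single x.1 1 := by
            intro j
            by_cases hj : j = x.1
            · subst hj; simp; omega
            · simpa [hj] using hr j
          rw [if_pos hx, if_pos (by omega), Finset.mul_sum]
          refine Finset.sum_congr rfl fun q' _ => ?_
          rw [if_pos hle, shiftX, tsub_right_comm, Pi.sub_apply,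
            show P x.1 - r i x.1 - 1 + r i x.1 = P x.1 - 1 by omega]
          ring
        · have hx' : ¬ r i x.1 < P x.1 := by simpa using hx
          rw [if_neg hx, mul_zero]
          split
          · refine (Finset.sum_eq_zero fun q' _ => ?_).symm
            rw [if_neg, mul_zero]
            intro hle
            have := hle x.1
            simp at this
            omega
          · rfl
      · rw [if_neg hr]
        refine (Finset.sum_eq_zero fun x _ => ?_).symm
        split
        · refine Finset.sum_eq_zero fun q' _ => ?_
          rw [if_neg, mul_zero]
          intro hle
          exact hr (hle.trans tsub_le_self)
        · rfl
    rw [Finset.sum_congr rfl fun i _ => key i, Finset.sum_comm]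
    refine Finset.sum_eq_zero fun x _ => ?_
    split
    · rw [Finset.sum_comm]
      refine Finset.sum_eq_zero fun q' _ => ?_
      rw [← Finset.mul_sum, ih, mul_zero]
    · simp

/-- This makes the unknowns outnumber the equations in `exists_relation`. The ratio `((D + n) / D) ^
k` tends to `1`. Explicitly, with `N = D + n`, Bernoulli's inequality gives `(1 - n / N) ^ k ≥ 1 - k
* n / N`, and `N > k * n * (n + 1)` suffices. -/
theorem exists_pow_lt (k n : ℕ) : ∃ D, n * (D + n) ^ k < (n + 1) * D ^ k := by
  rcases Nat.eq_zero_or_pos n with rfl | hn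
  · exact ⟨1, by simp⟩
  · obtain ⟨N, hN⟩ : ∃ N, N = k * n * (n + 1) + n + 1 := ⟨_, rfl⟩
    have hNn : n ≤ N := by
      rw [hN, add_assoc]
      exact (Nat.le_succ n).trans (Nat.le_add_left _ _)
    refine ⟨N - n, ?_⟩
    rw [Nat.sub_add_cancel hNn]
    have hN0 : (0 : ℚ) < N := by rw [hN]; positivity
    have hb := one_add_mul_le_pow (R := ℚ) (a := -(n / N)) (n := k) (by
      have : (n : ℚ) / N ≤ 1 := by rw [div_le_one hN0]; exact_mod_cast hNn
      linarith)
    have h1 : ((N - n : ℕ) : ℚ) = N * (1 + -(n / N)) := by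
      rw [Nat.cast_sub hNn]; field_simp; ring
    have h2 : (n : ℚ) < (n + 1) * (1 + k * -(n / N)) := by
      have h3 : (n + 1 : ℚ) * (k * (n / N)) < 1 := by
        rw [show (n + 1 : ℚ) * (k * (n / N)) = (k * n * (n + 1)) / N by ring, div_lt_one hN0, hN]
        push_cast
        linarith
      linarith
    have h4 : (n : ℚ) * N ^ k < (n + 1) * ((N - n : ℕ) : ℚ) ^ k := by
      rw [h1, mul_pow]
      have hNk : (0 : ℚ) < N ^ k := by positivity
      calc (n : ℚ) * N ^ k < (n + 1) * (1 + k * -(n / N)) * N ^ k := by gcongr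
        _ ≤ (n + 1) * (1 + -(n / N)) ^ k * N ^ k := by gcongr
        _ = _ := by ring
    exact_mod_cast h4

open Classical in
/-- There are nontrivial left linear relations between the vectors of the sums over the runs of
length at most the number of states. -/
theorem exists_relation (E : Q → Letter α → Q → ℕ) (F : Q → ℕ) (E' : Q' → Letter α → Q' → ℕ)
    (F' : Q' → ℕ) {n : ℕ} (hn : Fintype.card Q + Fintype.card Q' = n) :
    ∃ (D : ℕ) (c : (Fin k → Fin D) × Fin (n + 1) → MvPolynomial (Letter α × ℕ) ℤ), c ≠ 0 ∧
      (∀ P q, ∑ i, (if (fun j => (i.1 j : ℕ)) ≤ P then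
        c i * runSum E F (shiftX α fun j => i.1 j) i.2 (P - fun j => (i.1 j : ℕ)) q else 0) = 0) ∧
      (∀ P q, ∑ i, (if (fun j => (i.1 j : ℕ)) ≤ P then
        c i * runSum E' F' (shiftX α fun j => i.1 j) i.2 (P - fun j => (i.1 j : ℕ)) q else 0) = 0) := by
  obtain ⟨D, hD⟩ := exists_pow_lt k n
  -- The linear system whose solutions are the relations, restricted to positions in a box of side
  -- `D + n`; equations at other positions turn out to be trivial.
  let f : ((Fin k → Fin D) × Fin (n + 1) → MvPolynomial (Letter α × ℕ) ℤ) →ₗ[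
      MvPolynomial (Letter α × ℕ) ℤ]
      ((Fin k → Fin (D + n)) × (Q ⊕ Q') → MvPolynomial (Letter α × ℕ) ℤ) :=
    { toFun := fun c P => ∑ i, (if (fun j => (i.1 j : ℕ)) ≤ (fun j => (P.1 j : ℕ)) then
        c i * Sum.elim
          (runSum E F (shiftX α fun j => i.1 j) i.2 ((fun j => (P.1 j : ℕ)) - fun j => (i.1 j : ℕ)))
          (runSum E' F' (shiftX α fun j => i.1 j) i.2
            ((fun j => (P.1 j : ℕ)) - fun j => (i.1 j : ℕ))) P.2 else 0)
      map_add' := by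
        intro c c'
        ext1 P
        simp only [Pi.add_apply, ← Finset.sum_add_distrib]
        refine Finset.sum_congr rfl fun i _ => ?_
        split <;> ring
      map_smul' := by
        intro a c
        ext1 P
        simp only [Pi.smul_apply, smul_eq_mul, Finset.mul_sum, RingHom.id_apply]
        refine Finset.sum_congr rfl fun i _ => ?_
        split <;> ring }
  have hf : ¬ Function.Injective f := by
    intro hinj
    -- Over a nontrivial commutative ring an injective linear map between free modules cannot lower
    -- the rank, although here `(n + 1) * D ^ k` exceeds `n * (D + n) ^ k`.
    have := card_le_of_injective _ f hinj
    simp only [Fintype.card_prod, Fintype.card_fun, Fintype.card_fin, Fintype.card_sum, hn] at this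
    nlinarith
  obtain ⟨c, hc, hc0⟩ : ∃ c, f c = 0 ∧ c ≠ 0 := by
    by_contra! h
    exact hf ((injective_iff_map_eq_zero f).2 fun c hc => h c hc)
  have main : ∀ (P : Fin k → ℕ) (q : Q ⊕ Q'), ∑ i, (if (fun j => (i.1 j : ℕ)) ≤ P then
      c i * Sum.elim (runSum E F (shiftX α fun j => i.1 j) i.2 (P - fun j => (i.1 j : ℕ)))
        (runSum E' F' (shiftX α fun j => i.1 j) i.2 (P - fun j => (i.1 j : ℕ))) q else 0) = 0 := by
    intro P q
    by_cases hP : ∀ j, P j < D + n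
    · exact congrFun hc (⟨fun j => ⟨P j, hP j⟩, q⟩ : (Fin k → Fin (D + n)) × (Q ⊕ Q'))
    · obtain ⟨j, hj⟩ := not_forall.1 hP
      refine Finset.sum_eq_zero fun i _ => ?_
      split
      -- If `P j ≥ D + n`, then more than `n` letters of tape `j` lie between `r` and `P`, too many
      -- for a run of length at most `n`.
      · have hne : ∑ j, (P - fun j => (i.1 j : ℕ)) j ≠ i.2 := by
          have h1 := Finset.single_le_sum (f := (P - fun j => (i.1 j : ℕ))) (fun _ _ => Nat.zero_le _)
            (mem_univ j)
          have h2 := (i.1 j).2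
          have h3 := i.2.2
          rw [Pi.sub_apply] at h1
          omega
        cases q <;> simp [runSum_eq_zero _ _ _ hne]
      · rfl
  exact ⟨D, c, hc0, fun P q => main P (.inl q), fun P q => main P (.inr q)⟩

/-- Automata are equivalent if they have the same multiplicities for all tuples that are shorter than
the number of their states. -/
theorem multEquiv_of_agree (A : Automaton α Q) (B : Automaton α Q')
    (h : ∀ s, ∑ i, lengths s i < Fintype.card Q + Fintype.card Q' → A.mult s = B.mult s) :
    MultEquiv A B := by
  classical
  obtain ⟨n, hn⟩ : ∃ n, Fintype.card Q + Fintype.card Q' = n := ⟨_, rfl⟩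
  rw [hn] at h
  by_contra hne
  have hex : ∃ m, ∃ s, ∑ i, lengths s i = m ∧ A.mult s ≠ B.mult s := by
    obtain ⟨s, hs⟩ := not_forall.1 hne
    exact ⟨_, s, rfl, hs⟩
  obtain ⟨m, hm⟩ : ∃ m, m = Nat.find hex := ⟨_, rfl⟩
  obtain ⟨s₀, hs₀, hs₀'⟩ := Nat.find_spec hex
  rw [← hm] at hs₀
  have hmin : ∀ s, ∑ i, lengths s i < m → A.mult s = B.mult s := fun s hs => by
    by_contra hc
    exact Nat.find_min hex (hm ▸ hs) ⟨s, rfl, hc⟩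
  have hnm : n ≤ m := by
    by_contra hlt
    exact hs₀' (h s₀ (by omega))
  obtain ⟨D, c, hc, hA, hB⟩ := exists_relation A.edgeBit A.finalBit B.edgeBit B.finalBit hn
  let d : (Fin k → ℕ) → (Fin k → ℕ) → MvPolynomial (Letter α × ℕ) ℤ := fun r p =>
    A.value (shiftX α r) p - B.value (shiftX α r) p
  have hd : ∀ r p, (∀ s, lengths s = p → A.mult s = B.mult s) → d r p = 0 := fun r p hp => by
    simp only [d]
    rw [A.value_eq_value B hp, sub_self]
  have hd' : ∀ r s, d r (lengths s) = 0 → A.mult s = B.mult s := fun r s hds => by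
    refine A.mult_eq_of_value_X_eq B (fun x j => (x, j + r x.1)) ?_ (sub_eq_zero.1 hds)
    intro x j x' j' _ _ hxj
    simp only [Prod.mk.injEq] at hxj
    obtain ⟨rfl, hj⟩ := hxj
    exact ⟨rfl, by omega⟩
  obtain ⟨i₀, hi₀⟩ := Function.ne_iff.1 hc
  -- The longest runs with a nonzero coefficient; since their length is at most `n ≤ m`, all lengths
  -- can be shifted so that these become exactly `m`.
  obtain ⟨i₁, hi₁, hmax⟩ := Finset.exists_max_image (univ.filter fun i => c i ≠ 0)
    (fun i => (i.2 : ℕ)) ⟨i₀, by simpa using hi₀⟩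
  obtain ⟨l, hl⟩ : ∃ l, (i₁.2 : ℕ) + l = m := ⟨m - i₁.2, by have := i₁.2.2; omega⟩
  -- The relations, shifted by `l`, are summed over the initial states of each automaton and
  -- subtracted. Both automata satisfy them with the same coefficients `c`, so the differences `d`
  -- satisfy them too.
  have rel : ∀ P, ∑ i, (if (fun j => (i.1 j : ℕ)) ≤ P ∧ ∑ j, (P - fun j => (i.1 j : ℕ)) j = i.2 + l then
      c i * d (fun j => i.1 j) (P - fun j => (i.1 j : ℕ)) else 0) = 0 := by
    intro P
    have h1 := fun q => relation_add A.edgeBit A.finalBit (fun i j => (i.1 j : ℕ))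
      (fun i => (i.2 : ℕ)) c hA l P q
    have h2 := fun q => relation_add B.edgeBit B.finalBit (fun i j => (i.1 j : ℕ))
      (fun i => (i.2 : ℕ)) c hB l P q
    -- The zeros are placeholders, to be replaced by the left sides of the relations.
    have h3 : ∑ q, (A.startBit q : MvPolynomial (Letter α × ℕ) ℤ) * (0 : MvPolynomial _ ℤ) -
      ∑ q, (B.startBit q : MvPolynomial (Letter α × ℕ) ℤ) * (0 : MvPolynomial _ ℤ) = 0 := by simp
    rw [Finset.sum_congr rfl fun q _ => by rw [← h1 q],
      Finset.sum_congr (s₁ := (univ : Finset Q')) rfl fun q _ => by rw [← h2 q]] at h3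
    simp only [Finset.mul_sum] at h3
    rw [Finset.sum_comm, Finset.sum_comm (s := (univ : Finset Q')), ← Finset.sum_sub_distrib] at h3
    refine Eq.trans (Finset.sum_congr rfl fun i _ => ?_) h3
    by_cases hr : (fun j => (i.1 j : ℕ)) ≤ P
    · by_cases hs : ∑ j, (P - fun j => (i.1 j : ℕ)) j = i.2 + l
      · simp only [hr, hs, and_self, if_true, d, Automaton.value, mul_sub, Finset.mul_sum]
        congr 1 <;> exact Finset.sum_congr rfl fun q _ => by ring
      · rw [if_neg fun h => hs h.2]
        simp [runSum_eq_zero _ _ _ hs]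
    · simp [hr]
  let S : Finset (Fin k → ℕ) := (univ.filter fun i => c i ≠ 0 ∧ i.2 = i₁.2).image fun i j => i.1 j
  let T : Finset (Fin k → ℕ) := ((Finset.Iic fun _ => m).filter fun p =>
    ∃ s, lengths s = p ∧ ∑ i, lengths s i = m ∧ A.mult s ≠ B.mult s)
  have hT : ∀ s, ∑ i, lengths s i = m → A.mult s ≠ B.mult s → lengths s ∈ T := by
    intro s h1 h2
    refine Finset.mem_filter.2 ⟨Finset.mem_Iic.2 fun i => ?_, s, rfl, h1, h2⟩
    exact h1 ▸ Finset.single_le_sum (f := lengths s) (fun _ _ => Nat.zero_le _) (mem_univ i)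
  -- Here `S` consists of the offsets of the longest terms and `T` of the lengths at which a
  -- shortest difference occurs. A sum `a + b` with a unique representation is the position at which
  -- `rel` reduces to a single product.
  obtain ⟨a, ha, b, hb, hab⟩ := UniqueSums.uniqueAdd_of_nonempty (A := S) (B := T)
    ⟨_, Finset.mem_image_of_mem _ (Finset.mem_filter.2 ⟨mem_univ i₁, (Finset.mem_filter.1 hi₁).2, rfl⟩)⟩
    ⟨_, hT s₀ hs₀ hs₀'⟩
  obtain ⟨i₂, hi₂, rfl⟩ := Finset.mem_image.1 ha
  obtain ⟨-, hi₂c, hi₂2⟩ := Finset.mem_filter.1 hi₂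
  obtain ⟨-, s, rfl, hs, hsne⟩ := Finset.mem_filter.1 hb
  have hsub : ((fun j => (i₂.1 j : ℕ)) + lengths s - fun j => (i₂.1 j : ℕ)) = lengths s :=
    add_tsub_cancel_left _ _
  have := rel ((fun j => (i₂.1 j : ℕ)) + lengths s)
  rw [Finset.sum_eq_single i₂] at this
  · rw [if_pos, hsub] at this
    · rcases mul_eq_zero.1 this with h0 | h0
      · exact hi₂c h0
      · exact hsne (hd' _ s h0)
    · rw [hsub, hs, hi₂2, hl]
      exact ⟨le_self_add, rfl⟩
  -- Any other nonzero term would either belong to a tuple shorter than `m`, where the automata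
  -- agree, or give a second representation of the sum.
  · intro i _ hne
    split
    · rename_i hi
      obtain ⟨hle, hsum⟩ := hi
      by_contra hprod
      obtain ⟨hci, hdi⟩ := mul_ne_zero_iff.1 hprod
      have hmi := hmax i (Finset.mem_filter.2 ⟨mem_univ i, hci⟩)
      obtain ⟨s', hs', hs'ne⟩ : ∃ s', lengths s' = ((fun j => (i₂.1 j : ℕ)) + lengths s -
          fun j => (i.1 j : ℕ)) ∧ A.mult s' ≠ B.mult s' := by
        by_contra! hall
        exact hdi (hd _ _ hall)
      rw [← hs'] at hsum
      have hm' : m ≤ ∑ j, lengths s' j := by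
        by_contra hlt
        exact hs'ne (hmin s' (by omega))
      have hi2 : i.2 = i₁.2 := Fin.ext (by omega)
      have := hab (Finset.mem_image_of_mem (fun i j => (i.1 j : ℕ)) (Finset.mem_filter.2
        ⟨mem_univ i, hci, hi2⟩)) (hT s' (by omega) hs'ne) (by rw [hs', add_tsub_cancel_of_le hle])
      refine hne (Prod.ext (funext fun j => Fin.ext (congrFun this.1 j)) (hi2.trans hi₂2.symm))
    · rfl
  · intro h
    exact absurd (mem_univ _) h

end Value

end Multitape

/-! # Deterministic automata -/

namespace Multitape

open Finset

namespace Automaton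

variable {k : ℕ} {α : Fin k → Type} {Q Q' : Type}

/-- The state determines the tape, the label then the letter read from it, and the letter the next
state; the rest follows by cancelling this letter from the label. -/
theorem IsRun.unique {A : Automaton α Q} (hA : A.IsDeterministic)
    {p q q' : Q} {ρ ρ' : List (Q × Letter α × Q)} (h : A.IsRun p ρ q) (h' : A.IsRun p ρ' q')
    (hl : label ρ = label ρ') : ρ = ρ' ∧ q = q' := by
  induction h generalizing ρ' with
  | nil p =>
    have : ρ'.length = 0 := by
      rw [← sum_lengths_label, ← hl, sum_lengths_label, List.length_nil]
    obtain rfl := List.length_eq_zero_iff.1 this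
    cases h'
    exact ⟨rfl, rfl⟩
  | @cons p x q₁ r ρ he hρ ih =>
    cases h' with
    | nil =>
      have h := congrArg (fun s : Tuple α => ∑ i, lengths s i) hl
      simp [sum_lengths_label] at h
    | @cons _ x' q₁' _ ρ' he' hρ' =>
      obtain ⟨i, hi, hu⟩ := hA.2 p
      have hx := hi _ _ he
      have hx' := hi _ _ he'
      obtain ⟨i', a⟩ := x
      obtain ⟨i'', a'⟩ := x'
      obtain rfl : i' = i := hx
      obtain rfl : i'' = i' := hx'
      rw [label_cons, label_cons] at hl
      have h1 := congrArg (fun s : Tuple α => FreeMonoid.toList (s i'')) hl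
      simp only at h1
      have e1 := toTuple_mul_same (⟨i'', a⟩ : Letter α) (label ρ)
      have e2 := toTuple_mul_same (⟨i'', a'⟩ : Letter α) (label ρ')
      simp only at e1 e2
      rw [e1, e2] at h1
      obtain rfl : a = a' := (List.cons.inj h1).1
      obtain rfl : q₁ = q₁' := (hu a).unique he he'
      obtain ⟨rfl, rfl⟩ := ih hρ' (mul_left_cancel hl)
      exact ⟨rfl, rfl⟩

theorem mult_eq_ite {A : Automaton α Q} (hA : A.IsDeterministic) (s : Tuple α)
    [Decidable (s ∈ A.language)] : A.mult s = if s ∈ A.language then 1 else 0 := by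
  have hsub : (A.acceptingRuns s).Subsingleton := by
    rintro ⟨p, ρ, q⟩ ⟨h1, h2, h3, h4⟩ ⟨p', ρ', q'⟩ ⟨h1', h2', h3', h4'⟩
    obtain ⟨⟨q₀, h0⟩, -⟩ := id hA
    simp only at h1 h1' h3 h3' h4 h4'
    rw [h0, Set.mem_singleton_iff] at h1 h1'
    subst h1 h1'
    obtain ⟨rfl, rfl⟩ := IsRun.unique hA h3 h3' (h4.trans h4'.symm)
    rfl
  split
  · rename_i h
    obtain ⟨r, hr⟩ := h
    rw [mult, hsub.eq_singleton_of_mem hr, Set.ncard_singleton]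
  · rename_i h
    rw [mult, Set.not_nonempty_iff_eq_empty.1 h, Set.ncard_empty]

theorem multEquiv_iff_language_eq {A : Automaton α Q} {B : Automaton α Q'}
    (hA : A.IsDeterministic) (hB : B.IsDeterministic) :
    MultEquiv A B ↔ A.language = B.language := by
  classical
  rw [Set.ext_iff]
  refine forall_congr' fun s => ?_
  rw [mult_eq_ite hA, mult_eq_ite hB]
  by_cases h : s ∈ A.language <;> by_cases h' : s ∈ B.language <;> simp [h, h']

end Automaton

/-! # Fixing the letters of a tuple one by one -/

section Fix

variable {k : ℕ} {α : Fin k → Type} [∀ i, Fintype (α i)] {Q Q' : Type} [Fintype Q] [Fintype Q']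
  {R : Type*} [CommSemiring R]

/-- The weight `w' a` annihilates every letter but `a` at position `j` and agrees with `w`
elsewhere, so the only surviving summand is that of the actual letter at this position. -/
theorem wordWeight_eq_sum {β : Type*} [Fintype β] {w : β → ℕ → R} {w' : β → β → ℕ → R} {j : ℕ}
    (h : ∀ a b j', j' ≠ j → w' a b j' = w b j') (h1 : ∀ a, w' a a j = w a j)
    (h0 : ∀ a b, b ≠ a → w' a b j = 0) {l : List β} (hj : j < l.length) :
    wordWeight w l = ∑ a, wordWeight (w' a) l := by
  induction l with
  | nil => simp at hj
  | cons b l ih =>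
    simp only [wordWeight]
    by_cases hjl : j = l.length
    · subst hjl
      rw [Finset.sum_eq_single b, h1, wordWeight_congr fun a j' hj' => (h b a j' (by omega)).symm]
      · intro a _ hab
        rw [h0 a b hab.symm, zero_mul]
      · simp
    · rw [ih (by simp at hj; omega), Finset.mul_sum]
      refine Finset.sum_congr rfl fun a _ => ?_
      rw [h a b _ (Ne.symm hjl)]

/-- As `j < p i`, every contributing tuple has exactly one letter at position `j` of tape `i`. If
two automata differ in the sum, they differ in a summand, which allows this letter to be fixed. -/
theorem Automaton.value_eq_sum (A : Automaton α Q) {w : Letter α → ℕ → R} {i : Fin k}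
    {w' : α i → Letter α → ℕ → R} {j : ℕ} {p : Fin k → ℕ} (hj : j < p i)
    (h : ∀ a x j', ¬ (x.1 = i ∧ j' = j) → w' a x j' = w x j')
    (h1 : ∀ a, w' a ⟨i, a⟩ j = w ⟨i, a⟩ j)
    (h0 : ∀ a b, b ≠ a → w' a ⟨i, b⟩ j = 0) : A.value w p = ∑ a, A.value (w' a) p := by
  simp only [value_eq]
  rw [Finset.sum_comm]
  refine Finset.sum_congr rfl fun s hs => ?_
  rw [← Finset.mul_sum]
  congr 1
  have hlen : j < (FreeMonoid.toList (s i)).length := by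
    rw [← mem_tuples.1 hs] at hj
    exact hj
  have key : ∀ a, weight (w' a) s = wordWeight (fun b => w' a ⟨i, b⟩) (FreeMonoid.toList (s i)) *
      ∏ i' ∈ univ.erase i, wordWeight (fun b => w ⟨i', b⟩) (FreeMonoid.toList (s i')) := by
    intro a
    rw [weight, ← Finset.mul_prod_erase _ _ (mem_univ i)]
    congr 1
    refine Finset.prod_congr rfl fun i' hi' => wordWeight_congr fun b j' _ => ?_
    exact h a _ _ fun hc => Finset.ne_of_mem_erase hi' hc.1
  rw [Finset.sum_congr rfl fun a _ => key a, ← Finset.sum_mul, weight,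
    ← Finset.mul_prod_erase _ _ (mem_univ i)]
  congr 1
  exact wordWeight_eq_sum (fun a b j' hj' => h a ⟨i, b⟩ j' fun hc => hj' hc.2) h1 h0 hlen

theorem wordWeight_ne_zero {β : Type*} {w : β → ℕ → R} {l : List β}
    (h : wordWeight w l ≠ 0) (j : ℕ) (hj : j < l.length) : w l[l.length - 1 - j] j ≠ 0 := by
  induction l with
  | nil => simp at hj
  | cons a l ih =>
    rw [wordWeight] at h
    by_cases hjl : j = l.length
    · subst hjl
      simpa using left_ne_zero_of_mul h
    · have := ih (right_ne_zero_of_mul h) (by simp at hj; omega)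
      have hlen : (a :: l).length - 1 - j = (l.length - 1 - j) + 1 := by simp at hj ⊢; omega
      simp only [hlen, List.getElem_cons_succ]
      exact this

/-- If the sums differ, then they differ at a tuple all of whose letters have a nonzero weight. -/
theorem exists_mult_ne {A : Automaton α Q} {B : Automaton α Q'} [NoZeroDivisors R]
    {w : Letter α → ℕ → R} {p : Fin k → ℕ} (h : A.value w p ≠ B.value w p) :
    ∃ s : Tuple α, lengths s = p ∧ A.mult s ≠ B.mult s ∧ ∀ (i : Fin k) (j : ℕ)
      (hj : j < (FreeMonoid.toList (s i)).length),
      w ⟨i, (FreeMonoid.toList (s i))[(FreeMonoid.toList (s i)).length - 1 - j]⟩ j ≠ 0 := by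
  rw [Automaton.value_eq, Automaton.value_eq] at h
  obtain ⟨s, hs, hne⟩ : ∃ s ∈ tuples α p, (A.mult s : R) * weight w s ≠ B.mult s * weight w s := by
    by_contra! hall
    exact h (Finset.sum_congr rfl hall)
  refine ⟨s, mem_tuples.1 hs, fun hc => hne (by rw [hc]), fun i j hj => ?_⟩
  have hw : weight w s ≠ 0 := fun hc => hne (by rw [hc, mul_zero, mul_zero])
  have : wordWeight (fun a => w ⟨i, a⟩) (FreeMonoid.toList (s i)) ≠ 0 := fun hc =>
    hw (Finset.prod_eq_zero (mem_univ i) hc)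
  exact wordWeight_ne_zero this j hj

end Fix

/-! # Random weights -/

section Random

variable {k : ℕ} {α : Fin k → Type} [∀ i, Fintype (α i)] {Q Q' : Type} [Fintype Q] [Fintype Q']

theorem totalDegree_wordWeight_le {V β : Type*} (φ : β → ℕ → V) (l : List β) :
    (wordWeight (fun a j => (MvPolynomial.X (φ a j) : MvPolynomial V ℤ)) l).totalDegree ≤
      l.length := by
  induction l with
  | nil => simp [wordWeight]
  | cons a l ih =>
    rw [wordWeight, List.length_cons, add_comm]
    refine (MvPolynomial.totalDegree_mul _ _).trans (add_le_add ?_ ih)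
    simp

/-- Each letter of a label contributes one indeterminate. The low degree is what makes weights of
logarithmically many bits sufficient. -/
theorem Automaton.totalDegree_value_le {V : Type*} (A : Automaton α Q) (φ : Letter α → ℕ → V)
    (p : Fin k → ℕ) :
    (A.value (fun x j => (MvPolynomial.X (φ x j) : MvPolynomial V ℤ)) p).totalDegree ≤
      ∑ i, p i := by
  rw [value_eq]
  refine MvPolynomial.totalDegree_finsetSum_le fun s hs => ?_
  refine (MvPolynomial.totalDegree_mul _ _).trans ?_
  have : (A.mult s : MvPolynomial V ℤ).totalDegree = 0 := by
    rw [← map_natCast MvPolynomial.C]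
    exact MvPolynomial.totalDegree_C _
  rw [this, zero_add, weight]
  refine (MvPolynomial.totalDegree_finsetProd _ _).trans (Finset.sum_le_sum fun i _ => ?_)
  rw [← mem_tuples.1 hs]
  exact totalDegree_wordWeight_le (fun a => φ ⟨i, a⟩) _

/-- For at most one half of the weights, the sums agree. -/
theorem card_value_eq_le {A : Automaton α Q} {B : Automaton α Q'} {v W : ℕ}
    (φ : Letter α → ℕ → Fin v) {s : Tuple α} (hs : A.mult s ≠ B.mult s)
    (hW : 2 * ∑ i, lengths s i ≤ W) (hW0 : 0 < W)
    (hφ : ∀ x j x' j', j < lengths s x.1 → j' < lengths s x'.1 → φ x j = φ x' j' → x = x' ∧ j = j') :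
    2 * #{t : Fin v → Fin W | A.value (fun x j => (t (φ x j) : ℕ)) (lengths s) =
      B.value (fun x j => (t (φ x j) : ℕ)) (lengths s)} ≤ W ^ v := by
  classical
  set g : MvPolynomial (Fin v) ℤ := A.value (fun x j => MvPolynomial.X (φ x j)) (lengths s) -
    B.value (fun x j => MvPolynomial.X (φ x j)) (lengths s) with hg
  have hg0 : g ≠ 0 := fun h => hs (A.mult_eq_of_value_X_eq B φ hφ (sub_eq_zero.1 h))
  have hdeg : g.totalDegree ≤ ∑ i, lengths s i :=
    (MvPolynomial.totalDegree_sub _ _).trans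
      (max_le (A.totalDegree_value_le φ _) (B.totalDegree_value_le φ _))
  let S : Finset ℤ := (Finset.range W).map Nat.castEmbedding
  have hS : #S = W := by simp [S]
  -- At most a fraction `totalDegree / W` of the points of `S ^ v` are zeros of `g`, and twice the
  -- degree is at most `W`.
  have hz := MvPolynomial.schwartz_zippel_totalDegree hg0 S
  rw [hS] at hz
  have hcard : #{t : Fin v → Fin W | A.value (fun x j => (t (φ x j) : ℕ)) (lengths s) =
      B.value (fun x j => (t (φ x j) : ℕ)) (lengths s)} ≤
      #{f ∈ Fintype.piFinset fun _ => S | MvPolynomial.eval f g = 0} := by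
    refine Finset.card_le_card_of_injOn (fun t i => ((t i : ℕ) : ℤ)) ?_ ?_
    · intro t ht
      have ht' : A.value (fun x j => (t (φ x j) : ℕ)) (lengths s) =
        B.value (fun x j => (t (φ x j) : ℕ)) (lengths s) := by simpa using ht
      have h1 := congrArg (Nat.castRingHom ℤ) ht'
      rw [Automaton.map_value, Automaton.map_value] at h1
      simp only [Finset.coe_filter, Set.mem_ofPred_eq, Fintype.mem_piFinset]
      refine ⟨fun i => ?_, ?_⟩
      · simp [S]
      · rw [hg, map_sub, Automaton.map_value, Automaton.map_value, sub_eq_zero]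
        simpa using h1
    · intro t _ t' _ h
      ext i
      simpa using congrFun h i
  have h2 : (2 * #{f ∈ Fintype.piFinset fun _ => S | MvPolynomial.eval f g = 0} : ℚ≥0) ≤ W ^ v := by
    have hWq : (0 : ℚ≥0) < W := by exact_mod_cast hW0
    rw [div_le_div_iff₀ (by positivity) hWq] at hz
    have h3 : (2 * g.totalDegree : ℚ≥0) ≤ W := by
      exact_mod_cast (Nat.mul_le_mul_left 2 hdeg).trans hW
    refine le_of_mul_le_mul_right ?_ hWq
    calc _ = 2 * ((#{f ∈ Fintype.piFinset fun _ => S | MvPolynomial.eval f g = 0} : ℚ≥0) * W) := by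
          ring
      _ ≤ 2 * (g.totalDegree * W ^ v) := by gcongr
      _ = 2 * g.totalDegree * W ^ v := by ring
      _ ≤ W * W ^ v := by gcongr
      _ = _ := by ring
  have h4 : 2 * #{f ∈ Fintype.piFinset fun _ => S | MvPolynomial.eval f g = 0} ≤ W ^ v := by
    exact_mod_cast h2
  omega

end Random

end Multitape

/-! # The algorithm: dynamic programming -/

namespace LoopLang

open RAM

theorem iter_induction {S : Type*} {f : ℕ → S → S} {σ : S} {n : ℕ} (I : ℕ → S → Prop) (h0 : I 0 σ)
    (h : ∀ i < n, ∀ τ, I i τ → I (i + 1) (f i τ)) : I n (iter f σ n) := by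
  induction n with
  | zero => exact h0
  | succ n ih => exact h n (Nat.lt_succ_self n) _ (ih fun i hi => h i (by omega))

instance : Add Expr := ⟨.op .add⟩
instance : Sub Expr := ⟨.op .sub⟩
instance : Mul Expr := ⟨.op .mul⟩
instance : Div Expr := ⟨.op .div⟩
instance : Mod Expr := ⟨.op .mod⟩
instance (n : ℕ) : OfNat Expr n := ⟨.num n⟩

section Eval

variable (M : ℕ) (a : ℕ → ℕ → ℕ) (env : List ℕ)

@[simp] theorem eval_num (n : ℕ) : (Expr.num n).eval M a env = n := rfl
@[simp] theorem eval_zero : (0 : Expr).eval M a env = 0 := rfl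
@[simp] theorem eval_one : (1 : Expr).eval M a env = 1 := rfl
@[simp] theorem eval_loc_zero (i : ℕ) : (Expr.loc 0).eval M a (i :: env) = i := rfl
@[simp] theorem eval_loc_one (i j : ℕ) : (Expr.loc 1).eval M a (i :: j :: env) = j := rfl
@[simp] theorem eval_loc_two (i j l : ℕ) : (Expr.loc 2).eval M a (i :: j :: l :: env) = l := rfl
@[simp] theorem eval_loc_four (i j l n p : ℕ) :
    (Expr.loc 4).eval M a (i :: j :: l :: n :: p :: env) = p := rfl
@[simp] theorem eval_get (x : ℕ) (e : Expr) : (Expr.get x e).eval M a env = a x (e.eval M a env) := rfl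
@[simp] theorem eval_add (e e' : Expr) : (e + e').eval M a env = e.eval M a env + e'.eval M a env := rfl
@[simp] theorem eval_sub (e e' : Expr) : (e - e').eval M a env = e.eval M a env - e'.eval M a env := rfl
@[simp] theorem eval_div (e e' : Expr) : (e / e').eval M a env = e.eval M a env / e'.eval M a env := rfl
@[simp] theorem eval_mod (e e' : Expr) : (e % e').eval M a env = e.eval M a env % e'.eval M a env := rfl
@[simp] theorem eval_cond (c e e' : Expr) : (Expr.cond c e e').eval M a env =
    if c.eval M a env = 0 then e'.eval M a env else e.eval M a env := rfl

/-- The reductions modulo `M` only serve to bound the running time. The correctness proofs show them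
to be vacuous, in each case by verifying a bound of this kind. -/
theorem eval_mul {e e' : Expr} (h : e'.eval M a env < M) :
    (e * e').eval M a env = e.eval M a env * e'.eval M a env := by
  show e.eval M a env * (e'.eval M a env % M) = _
  rw [Nat.mod_eq_of_lt h]

theorem eval_sum {n : Expr} (e : Expr) (h : n.eval M a env < M) :
    (Expr.sum n e).eval M a env = ∑ i ∈ Finset.range (n.eval M a env), e.eval M a (i :: env) := by
  show ∑ i ∈ Finset.range (n.eval M a env % M), e.eval M a (i :: env) = _
  rw [Nat.mod_eq_of_lt h]

end Eval

theorem run_seq (M : ℕ) (c c' : Cmd) (env : List ℕ) (σ : Store) :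
    (Cmd.seq c c').run M env σ = c'.run M env (c.run M env σ) := rfl

theorem run_ite (M : ℕ) (e : Expr) (c c' : Cmd) (env : List ℕ) (σ : Store) :
    (Cmd.ite e c c').run M env σ = if e.eval M σ.arr env = 0 then c'.run M env σ else c.run M env σ :=
  rfl

theorem run_loop {M : ℕ} {n : Expr} (c : Cmd) {env : List ℕ} {σ : Store} {m : ℕ}
    (h : n.eval M σ.arr env = m) (hm : m < M) :
    (Cmd.loop n c).run M env σ = iter (fun i τ => c.run M (i :: env) τ) σ m := by
  show iter _ σ (n.eval M σ.arr env % M) = _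
  rw [h, Nat.mod_eq_of_lt hm]

theorem Store.put_arr_of_ne (σ : Store) {x y : ℕ} (i v : ℕ) (h : y ≠ x) :
    (σ.put x i v).arr y = σ.arr y := by simp [Store.put, h]

theorem Store.put_arr_self (σ : Store) (x i v : ℕ) :
    (σ.put x i v).arr x = Function.update (σ.arr x) i v := by simp [Store.put]

@[simp] theorem Store.put_coins (σ : Store) (x i v : ℕ) : (σ.put x i v).coins = σ.coins := rfl

end LoopLang

namespace Multitape

open LoopLang Finset

/-! ## Positions -/

/-- The tuple of digits of a number. -/
def digits (k N P : ℕ) (i : Fin k) : ℕ := P / N ^ (i : ℕ) % N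

theorem digits_zero (k N : ℕ) : digits k N 0 = 0 := by ext i; simp [digits]

theorem digits_lt {k N : ℕ} (hN : 0 < N) (P : ℕ) (i : Fin k) : digits k N P i < N :=
  Nat.mod_lt _ hN

theorem digits_injOn {k N P P' : ℕ} (hP : P < N ^ k) (hP' : P' < N ^ k)
    (h : digits k N P = digits k N P') : P = P' := by
  have : (finFunctionFinEquiv.symm ⟨P, hP⟩ : Fin k → Fin N) = finFunctionFinEquiv.symm ⟨P', hP'⟩ := by
    ext i
    exact congrFun h i
  simpa using finFunctionFinEquiv.symm.injective this

theorem exists_digits_eq {k N : ℕ} {p : Fin k → ℕ} (hp : ∀ i, p i < N) :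
    ∃ P < N ^ k, digits k N P = p := by
  refine ⟨finFunctionFinEquiv fun i => ⟨p i, hp i⟩, Fin.is_lt _, ?_⟩
  ext i
  have := congrArg Fin.val (congrFun (finFunctionFinEquiv.symm_apply_apply
    (fun i => (⟨p i, hp i⟩ : Fin N))) i)
  exact this

theorem pow_le_of_digits_pos {k N P : ℕ} {i : Fin k} (h : 0 < digits k N P i) : N ^ (i : ℕ) ≤ P := by
  by_contra hlt
  rw [digits, Nat.div_eq_of_lt (by omega)] at h
  simp at h

/-- Digit `i` is positive, so the subtraction needs no borrow and leaves all other digits alone.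
Reading a letter of tape `i` thus becomes a single subtraction. -/
theorem digits_sub_pow {k N P : ℕ} {i : Fin k} (hN : 0 < N) (h : 0 < digits k N P i) :
    digits k N (P - N ^ (i : ℕ)) = digits k N P - Pi.single i 1 := by
  have hle := pow_le_of_digits_pos h
  ext j
  rw [Pi.sub_apply]
  simp only [digits] at h ⊢
  obtain ⟨d, hd⟩ : ∃ d, d = P / N ^ (i : ℕ) := ⟨_, rfl⟩
  rw [← hd] at h
  have hNi : 0 < N ^ (i : ℕ) := by positivity
  have hdi : (P - N ^ (i : ℕ)) / N ^ (i : ℕ) = d - 1 := by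
    have := Nat.sub_mul_div P (N ^ (i : ℕ)) 1
    rw [mul_one] at this
    rw [this, hd]
  have hmod : (d - 1) % N = d % N - 1 ∧ (d - 1) / N = d / N := by
    have h1 := Nat.div_add_mod d N
    have h2 := Nat.mod_lt d hN
    have h3 : d - 1 = N * (d / N) + (d % N - 1) := by omega
    have h4 : (N * (d / N) + (d % N - 1)) % N = d % N - 1 := by
      rw [Nat.mul_add_mod, Nat.mod_eq_of_lt (by omega)]
    have h5 : (N * (d / N) + (d % N - 1)) / N = d / N := by
      rw [Nat.mul_add_div hN, Nat.div_eq_of_lt (a := d % N - 1) (by omega), add_zero]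
    rw [← h3] at h4 h5
    exact ⟨h4, h5⟩
  rcases lt_trichotomy j i with hji | rfl | hij
  · rw [Pi.single_eq_of_ne (by exact hji.ne), Nat.sub_zero]
    have hlt : (j : ℕ) < i := hji
    have h1 : N ^ (i : ℕ) = N ^ (j : ℕ) * N ^ (i - j : ℕ) := by
      rw [← pow_add]; congr 1; omega
    have h2 : N ^ (i - j : ℕ) = N * N ^ (i - j - 1 : ℕ) := by
      rw [← pow_succ']; congr 1; omega
    rw [h1, Nat.sub_mul_div]
    have h3 : N ^ (i - j : ℕ) ≤ P / N ^ (j : ℕ) := by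
      rw [Nat.le_div_iff_mul_le (by positivity), mul_comm, ← h1]; exact hle
    obtain ⟨c, hc⟩ := Nat.exists_eq_add_of_le h3
    rw [hc, Nat.add_sub_cancel_left, h2, Nat.mul_add_mod]
  · rw [hdi, hmod.1, Pi.single_eq_same, hd]
  · rw [Pi.single_eq_of_ne (by exact hij.ne'), Nat.sub_zero]
    have hlt : (i : ℕ) < j := hij
    have h1 : N ^ (j : ℕ) = N ^ (i : ℕ) * (N * N ^ (j - i - 1 : ℕ)) := by
      rw [← pow_succ', ← pow_add]; congr 1; omega
    rw [h1, ← Nat.div_div_eq_div_mul, ← Nat.div_div_eq_div_mul, ← Nat.div_div_eq_div_mul,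
      ← Nat.div_div_eq_div_mul, hdi, hmod.2, hd]

/-- The weighted sums of runs, with the positions given by numbers. -/
theorem runSum_digits {k N P : ℕ} {m : Fin k → ℕ} {n : ℕ} (hN : 0 < N) (hP : P < N ^ k)
    (E : Fin n → Letter (fun i => Fin (m i)) → Fin n → ℕ) (F : Fin n → ℕ)
    (w : Letter (fun i => Fin (m i)) → ℕ → ℕ) (q : Fin n) :
    runSum E F w (∑ i, digits k N P i) (digits k N P) q = (if P = 0 then F q else 0) +
      ∑ i : Fin k, if digits k N P i = 0 then 0 else ∑ a : Fin (m i), ∑ q' : Fin n,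
        runSum E F w (∑ i', digits k N (P - N ^ (i : ℕ)) i') (digits k N (P - N ^ (i : ℕ))) q' *
          (w ⟨i, a⟩ (digits k N P i - 1) * E q ⟨i, a⟩ q') := by
  by_cases h0 : P = 0
  · subst h0
    simp [digits_zero, runSum]
  · have hne : digits k N P ≠ 0 := fun h =>
      h0 (digits_injOn hP (lt_of_le_of_lt (Nat.zero_le P) hP) (h.trans (digits_zero k N).symm))
    obtain ⟨s, hs⟩ : ∃ s, ∑ i, digits k N P i = s + 1 := by
      refine Nat.exists_eq_succ_of_ne_zero fun h => hne ?_
      ext i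
      exact (Finset.sum_eq_zero_iff.1 h) i (mem_univ i)
    rw [hs, runSum, if_neg h0, zero_add, Fintype.sum_sigma]
    refine Finset.sum_congr rfl fun i _ => ?_
    by_cases hi : digits k N P i = 0
    · rw [if_pos hi]
      exact Finset.sum_eq_zero fun a _ => if_neg (by simp [hi])
    · rw [if_neg hi]
      refine Finset.sum_congr rfl fun a _ => ?_
      have hi' : 0 < digits k N P i := Nat.pos_of_ne_zero hi
      have hsum := sum_sub_single hi'
      rw [if_pos hi', digits_sub_pow hN hi', show ∑ j, (digits k N P - Pi.single i 1 : Fin k → ℕ) j = s by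
        omega]
      refine Finset.sum_congr rfl fun q' _ => ?_
      simp only [Nat.cast_id]
      ring

/-! ## Expressions for the entries of the input -/

/-- The length of the input, which is also a bound for the lengths of words. -/
def eN : Expr := .get 0 0

/-- The number of letters of tape `i`. -/
def eM (i : Expr) : Expr := .get 0 (3 + i)

/-- The number of letters on the tapes before tape `i`. -/
def ePre (i : Expr) : Expr := .sum i (.get 0 (3 + .loc 0))

/-- The digit `i` of `P`. -/
def eDigit (P i : Expr) : Expr := P / .get 2 i % eN

/-- The weight of the letter `a` of tape `i` at position `j`. -/
def eWeight (i a j : Expr) : Expr :=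
  .cond (.get 6 (i * eN + j))
    (.cond (.get 6 (i * eN + j) - (a + 1) + (a + 1 - .get 6 (i * eN + j))) 0
      (.get 4 ((ePre i + a) * eN + j)))
    (.get 4 ((ePre i + a) * eN + j))

/-- Dynamic programming: the weighted sums of the accepting runs of an automaton. -/
def dpCmd (k : ℕ) (off n : Expr) (res : ℕ) : Cmd :=
  .seq
    (.loop (.get 2 (.num k)) (.loop n (.put 7 (.loc 1 * n + .loc 0)
      (.cond (.loc 1) 0 (.get 0 (off + n + .loc 0)) +
        .sum (.num k) (.cond (eDigit (.loc 2) (.loc 0))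
          (.sum (eM (.loc 0)) (.sum n
            (.get 7 ((.loc 4 - .get 2 (.loc 2)) * n + .loc 0) *
              (eWeight (.loc 2) (.loc 1) (eDigit (.loc 4) (.loc 2) - 1) *
                .get 0 (off + n + n +
                  ((.loc 3 * ePre (.num k) + (ePre (.loc 2) + .loc 1)) * n + .loc 0)))))) 0)))))
    (.loop (.get 2 (.num k)) (.put res (.loc 0)
      (.sum n (.get 7 (.loc 1 * n + .loc 0) * .get 0 (off + .loc 0)))))

/-- The number of letters of a tape, zero for tapes that do not exist. -/
def letters {k : ℕ} (m : Fin k → ℕ) (i : ℕ) : ℕ := if h : i < k then m ⟨i, h⟩ else 0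

/-- The number of letters on the first tapes. -/
def pre {k : ℕ} (m : Fin k → ℕ) (i : ℕ) : ℕ := ∑ j ∈ range i, letters m j

/-- The arrays hold the parameters of the problem, and the loops are long enough. -/
structure Good {k : ℕ} (m : Fin k → ℕ) (N M : ℕ) (a : ℕ → ℕ → ℕ) : Prop where
  pos : 0 < N
  length : a 0 0 = N
  letters : ∀ i < k, a 0 (3 + i) = letters m i
  pow : ∀ i ≤ k, a 2 i = N ^ i
  pow_lt : N ^ k < M
  tapes_lt : k < M
  length_lt : N < M
  pre_lt : pre m k < M

/-- The table of an automaton starts at the place `off`. -/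
structure Table {k n : ℕ} {m : Fin k → ℕ} (A : Automaton (fun i => Fin (m i)) (Fin n))
    (off : ℕ) (a : ℕ → ℕ) : Prop where
  start : ∀ q : Fin n, a (off + q) = A.startBit q
  final : ∀ q : Fin n, a (off + n + q) = A.finalBit q
  edge : ∀ (q : Fin n) (i : Fin k) (c : Fin (m i)) (q' : Fin n),
    a (off + n + n + ((q * pre m k + (pre m i + c)) * n + q')) =
    A.edgeBit q ⟨i, c⟩ q'

/-- The weights given by arrays of random numbers and of letters that are fixed. -/
def arrayWeight {k : ℕ} (m : Fin k → ℕ) (N : ℕ) (t lim : ℕ → ℕ) (x : Letter fun i => Fin (m i))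
    (j : ℕ) : ℕ :=
  if lim (x.1 * N + j) = 0 ∨ lim (x.1 * N + j) = x.2 + 1 then t ((pre m x.1 + x.2) * N + j) else 0

/-! ### Correctness of the dynamic programming -/

section Spec

variable {k : ℕ} {m : Fin k → ℕ} {N M : ℕ} {a : ℕ → ℕ → ℕ}

theorem pre_mono {i j : ℕ} (h : i ≤ j) : pre m i ≤ pre m j :=
  Finset.sum_le_sum_of_subset (Finset.range_mono h)

theorem pre_add_lt (i : Fin k) (c : Fin (m i)) : pre m i + c < pre m k := by
  have h := pre_mono (m := m) (show (i : ℕ) + 1 ≤ k from i.2)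
  rw [pre, pre, Finset.sum_range_succ] at h
  have h2 : letters m i = m i := by simp [letters]
  have h3 := c.2
  rw [← pre, ← pre] at h
  omega

theorem Good.letters_lt (h : Good m N M a) (i : ℕ) : Multitape.letters m i < M := by
  by_cases hi : i < k
  · have h1 := pre_mono (m := m) (show i + 1 ≤ k from hi)
    rw [pre, Finset.sum_range_succ] at h1
    have := h.pre_lt
    omega
  · rw [Multitape.letters, dif_neg hi]
    exact (Nat.zero_le _).trans_lt h.tapes_lt

theorem Good.congr {a' : ℕ → ℕ → ℕ} (h : Good m N M a) (h0 : a' 0 = a 0) (h2 : a' 2 = a 2) :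
    Good m N M a' :=
  ⟨h.pos, h0 ▸ h.length, h0 ▸ h.letters, h2 ▸ h.pow, h.pow_lt, h.tapes_lt, h.length_lt, h.pre_lt⟩

theorem Good.eval_eM (h : Good m N M a) {env : List ℕ} {e : Expr} {i : ℕ}
    (he : e.eval M a env = i) (hi : i < k) : (eM e).eval M a env = Multitape.letters m i := by
  rw [← h.letters i hi, ← he]
  rfl

theorem Good.eval_ePre (h : Good m N M a) {env : List ℕ} {e : Expr} {i : ℕ}
    (he : e.eval M a env = i) (hi : i ≤ k) : (ePre e).eval M a env = pre m i := by
  rw [ePre, eval_sum _ _ _ _ (by rw [he]; exact hi.trans_lt h.tapes_lt), he, pre]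
  exact Finset.sum_congr rfl fun j hj => h.letters j (by have := mem_range.1 hj; omega)

theorem Good.eval_eDigit (h : Good m N M a) {env : List ℕ} {e e' : Expr} {P : ℕ} {i : Fin k}
    (he : e.eval M a env = P) (he' : e'.eval M a env = i) :
    (eDigit e e').eval M a env = digits k N P i := by
  simp [eDigit, eN, he, he', h.pow i i.2.le, h.length, digits]

/-- The sum of both truncated differences vanishes exactly for equal numbers; this encodes the test
for the fixed letter. Letters are stored increased by one, and `0` means no restriction. -/
theorem Good.eval_eWeight (h : Good m N M a) {env : List ℕ} {e e' e'' : Expr} {i : Fin k}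
    {c : Fin (m i)} {j : ℕ} (he : e.eval M a env = i) (he' : e'.eval M a env = c)
    (he'' : e''.eval M a env = j) :
    (eWeight e e' e'').eval M a env = arrayWeight m N (a 4) (a 6) ⟨i, c⟩ j := by
  have hN : (eN).eval M a env = N := h.length
  have hN' : (eN).eval M a env < M := by rw [hN]; exact h.length_lt
  simp only [eWeight, eval_cond, eval_get, eval_add, eval_sub, eval_mul _ _ _ hN', he, he', he'', hN,
    h.eval_ePre he i.2.le, eval_one, eval_zero, arrayWeight]
  by_cases h0 : a 6 (i * N + j) = 0
  · simp [h0]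
  · by_cases h1 : a 6 (i * N + j) = c + 1
    · simp [h1]
    · rw [if_neg h0, if_neg (by omega), if_neg (by omega)]

theorem dp_place_inj {n P P' q q' : ℕ} (hq : q < n) (hq' : q' < n) (h : P * n + q = P' * n + q') :
    P = P' ∧ q = q' := by
  have h1 : (P * n + q) / n = (P' * n + q') / n := by rw [h]
  rw [mul_comm, mul_comm P', Nat.mul_add_div (by omega), Nat.mul_add_div (by omega),
    Nat.div_eq_of_lt hq, Nat.div_eq_of_lt hq'] at h1
  have h2 : P = P' := by omega
  subst h2
  exact ⟨rfl, by omega⟩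

/-- Array `7` holds the sum for position `P` and state `q` at place `P * n + q`. Positions are
visited in increasing order, and reading from tape `i` leads from `P` to the smaller number `P - N ^
i`, whose entries are complete by then. -/
theorem Good.run_dpCmd {σ : Store} (h : Good m N M σ.arr) {n off : ℕ}
    {A : Automaton (fun i => Fin (m i)) (Fin n)} (hA : Table A off (σ.arr 0)) {eoff en : Expr}
    (heoff : ∀ a' : ℕ → ℕ → ℕ, a' 0 = σ.arr 0 → ∀ env, eoff.eval M a' env = off)
    (hen : ∀ a' : ℕ → ℕ → ℕ, a' 0 = σ.arr 0 → ∀ env, en.eval M a' env = n) (hn : n < M)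
    (hw : ∀ i < pre m k * N, σ.arr 4 i < M) {res : ℕ} (hres : 7 < res) (env : List ℕ) :
    ((dpCmd k eoff en res).run M env σ).coins = σ.coins ∧
    (∀ x, x ≠ 7 → x ≠ res → ((dpCmd k eoff en res).run M env σ).arr x = σ.arr x) ∧
    ∀ P < N ^ k, ((dpCmd k eoff en res).run M env σ).arr res P =
      A.value (arrayWeight m N (σ.arr 4) (σ.arr 6)) (digits k N P) := by
  set w := arrayWeight m N (σ.arr 4) (σ.arr 6) with hwdef
  let S : ℕ → Fin n → ℕ := fun P q =>
    runSum A.edgeBit A.finalBit w (∑ i, digits k N P i) (digits k N P) q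
  have hwlt : ∀ x, ∀ j < N, w x j < M := by
    intro x j hj
    rw [hwdef, arrayWeight]
    split
    · refine hw _ ?_
      have h1 : pre m x.1 + x.2 + 1 ≤ pre m k := pre_add_lt x.1 x.2
      nlinarith
    · exact (Nat.zero_le _).trans_lt h.tapes_lt
  have hbit : ∀ p : Prop, bit p ≤ 1 := fun p => by unfold bit; split <;> simp
  have hM1 : 1 < M := by
    have := h.pos
    have := h.length_lt
    omega
  have hpow : ∀ a' : ℕ → ℕ → ℕ, a' 2 = σ.arr 2 → ∀ env,
      (Expr.get 2 (.num k)).eval M a' env = N ^ k := by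
    intro a' ha' env
    simp [ha', h.pow k le_rfl]
  -- the value of the entry at `P`, `q`
  have hentry : ∀ (τ : Store), (∀ x, x ≠ 7 → τ.arr x = σ.arr x) → ∀ P < N ^ k,
      (∀ P' < P, ∀ q : Fin n, τ.arr 7 (P' * n + q) = S P' q) → ∀ (q : Fin n),
      (Expr.cond (.loc 1) 0 (.get 0 (eoff + en + .loc 0)) +
        .sum (.num k) (.cond (eDigit (.loc 2) (.loc 0))
          (.sum (eM (.loc 0)) (.sum en
            (.get 7 ((.loc 4 - .get 2 (.loc 2)) * en + .loc 0) *
              (eWeight (.loc 2) (.loc 1) (eDigit (.loc 4) (.loc 2) - 1) *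
                .get 0 (eoff + en + en +
                  ((.loc 3 * ePre (.num k) + (ePre (.loc 2) + .loc 1)) * en + .loc 0)))))) 0)).eval
          M τ.arr ((q : ℕ) :: P :: env) = S P q := by
    intro τ hτ P hP ih q
    have h' : Good m N M τ.arr := h.congr (hτ 0 (by norm_num)) (hτ 2 (by norm_num))
    have h0 := hτ 0 (by norm_num)
    have hen' : ∀ env, en.eval M τ.arr env = n := hen _ h0
    have heoff' : ∀ env, eoff.eval M τ.arr env = off := heoff _ h0
    have hw' : w = arrayWeight m N (τ.arr 4) (τ.arr 6) := by
      rw [hwdef, hτ 4 (by norm_num), hτ 6 (by norm_num)]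
    rw [show S P q = _ from runSum_digits h.pos hP _ _ _ _, eval_add]
    congr 1
    · simp only [eval_cond, eval_loc_one, eval_zero, eval_get, eval_add, heoff', hen', eval_loc_zero,
        h0, hA.final]
    · rw [eval_sum _ _ _ _ (by exact h.tapes_lt), eval_num, Finset.sum_range]
      refine Finset.sum_congr rfl fun i _ => ?_
      rw [eval_cond, h'.eval_eDigit (P := P) (i := i) rfl rfl]
      by_cases hi : digits k N P i = 0
      · rw [if_pos hi, if_pos hi, eval_zero]
      · rw [if_neg hi, if_neg hi]
        have hm : (eM (.loc 0)).eval M τ.arr ((i : ℕ) :: (q : ℕ) :: P :: env) = m i := by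
          rw [h'.eval_eM (i := i) rfl i.2]
          simp [Multitape.letters]
        have hmM : m i < M := by
          have := h.letters_lt (i : ℕ)
          simpa [Multitape.letters] using this
        rw [eval_sum _ _ _ _ (by rwa [hm]), hm, Finset.sum_range]
        refine Finset.sum_congr rfl fun c _ => ?_
        rw [eval_sum _ _ _ _ (by rwa [hen']), hen', Finset.sum_range]
        refine Finset.sum_congr rfl fun q' _ => ?_
        set env' := (q' : ℕ) :: (c : ℕ) :: (i : ℕ) :: (q : ℕ) :: P :: env with henv'
        have hen'' : en.eval M τ.arr env' < M := by rwa [hen']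
        have hweight : (eWeight (.loc 2) (.loc 1) (eDigit (.loc 4) (.loc 2) - 1)).eval M τ.arr env' =
            w ⟨i, c⟩ (digits k N P i - 1) := by
          rw [hw']
          refine h'.eval_eWeight rfl rfl ?_
          rw [eval_sub, h'.eval_eDigit (P := P) (i := i) rfl rfl, eval_one]
        have hpre : (ePre (.num k)).eval M τ.arr env' = pre m k := h'.eval_ePre rfl le_rfl
        have hedge : (Expr.get 0 (eoff + en + en +
            ((.loc 3 * ePre (.num k) + (ePre (.loc 2) + .loc 1)) * en + .loc 0))).eval M τ.arr env' =
            A.edgeBit q ⟨i, c⟩ q' := by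
          simp only [eval_get, eval_add, heoff', hen', eval_mul _ _ _ hen'',
            eval_mul M τ.arr env' (e' := ePre (.num k)) (by rw [hpre]; exact h.pre_lt), hpre,
            h'.eval_ePre (e := .loc 2) (env := env') (i := i) rfl i.2.le, h0]
          exact hA.edge q i c q'
        have hb : A.edgeBit q ⟨i, c⟩ q' ≤ 1 := hbit _
        have hprod : (eWeight (.loc 2) (.loc 1) (eDigit (.loc 4) (.loc 2) - 1) *
                .get 0 (eoff + en + en +
                  ((.loc 3 * ePre (.num k) + (ePre (.loc 2) + .loc 1)) * en + .loc 0))).eval M τ.arr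
                env' = w ⟨i, c⟩ (digits k N P i - 1) * A.edgeBit q ⟨i, c⟩ q' := by
          rw [eval_mul _ _ _ (by rw [hedge]; omega), hweight, hedge]
        have hle := pow_le_of_digits_pos (Nat.pos_of_ne_zero hi)
        -- The entry of the table may be huge and is therefore the first factor; the second, a
        -- weight times an edge bit, is below `M`.
        rw [eval_mul _ _ _ (by
          rw [hprod]
          refine lt_of_le_of_lt ?_ (hwlt ⟨i, c⟩ (digits k N P i - 1)
            (lt_of_le_of_lt (Nat.sub_le _ _) (digits_lt h.pos P i)))
          simpa using Nat.mul_le_mul_left (w ⟨i, c⟩ (digits k N P i - 1)) hb), hprod]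
        congr 1
        have hNi : 0 < N ^ (i : ℕ) := pow_pos h.pos _
        refine Eq.trans ?_ (ih (P - N ^ (i : ℕ)) (by omega) q')
        simp only [eval_get, eval_add, eval_mul _ _ _ hen'', hen', eval_sub]
        rw [henv', eval_loc_four, eval_loc_two, eval_loc_zero, h'.pow i i.2.le]
  -- the loops
  rw [dpCmd, run_seq]
  rw [run_loop _ (hpow σ.arr rfl env) h.pow_lt]
  set σ₁ := iter _ σ (N ^ k) with hσ₁
  have H1 : σ₁.coins = σ.coins ∧ (∀ x, x ≠ 7 → σ₁.arr x = σ.arr x) ∧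
      ∀ P < N ^ k, ∀ q : Fin n, σ₁.arr 7 (P * n + q) = S P q := by
    refine iter_induction (fun P' (τ : Store) => τ.coins = σ.coins ∧ (∀ x, x ≠ 7 → τ.arr x = σ.arr x) ∧
      ∀ P < P', ∀ q : Fin n, τ.arr 7 (P * n + q) = S P q) ⟨rfl, fun _ _ => rfl, by simp⟩ ?_
    rintro P hP τ ⟨hc, hτ, hv⟩
    rw [run_loop _ (hen _ (hτ 0 (by norm_num)) _) hn]
    have := iter_induction (f := fun i τ => (Cmd.put 7 (.loc 1 * en + .loc 0)
      (.cond (.loc 1) 0 (.get 0 (eoff + en + .loc 0)) +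
        .sum (.num k) (.cond (eDigit (.loc 2) (.loc 0))
          (.sum (eM (.loc 0)) (.sum en
            (.get 7 ((.loc 4 - .get 2 (.loc 2)) * en + .loc 0) *
              (eWeight (.loc 2) (.loc 1) (eDigit (.loc 4) (.loc 2) - 1) *
                .get 0 (eoff + en + en +
                  ((.loc 3 * ePre (.num k) + (ePre (.loc 2) + .loc 1)) * en + .loc 0)))))) 0))).run
          M (i :: P :: env) τ) (σ := τ) (n := n)
      (fun q' (ρ : Store) => ρ.coins = σ.coins ∧ (∀ x, x ≠ 7 → ρ.arr x = σ.arr x) ∧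
        (∀ P' < P, ∀ q : Fin n, ρ.arr 7 (P' * n + q) = S P' q) ∧
        ∀ q : Fin n, (q : ℕ) < q' → ρ.arr 7 (P * n + q) = S P q) ⟨hc, hτ, hv, by simp⟩ (by
        rintro q hq ρ ⟨hc, hρ, hv, hv'⟩
        have hen' : ∀ env, en.eval M ρ.arr env = n := hen _ (hρ 0 (by norm_num))
        have e1 := hentry ρ hρ P hP hv ⟨q, hq⟩
        have e2 : (Expr.loc 1 * en + .loc 0).eval M ρ.arr (q :: P :: env) = P * n + q := by
          rw [eval_add, eval_mul _ _ _ (by rwa [hen']), hen']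
          rfl
        simp only [Cmd.run]
        rw [e1, e2]
        refine ⟨hc, fun x hx => ?_, fun P' hP' q' => ?_, fun q' hq' => ?_⟩
        · rw [Store.put_arr_of_ne _ _ _ hx, hρ x hx]
        · rw [Store.put_arr_self, Function.update_of_ne, hv P' hP' q']
          intro heq
          have := (dp_place_inj q'.2 hq heq).1
          omega
        · rw [Store.put_arr_self]
          by_cases hqq : (q' : ℕ) = q
          · subst hqq
            rw [Function.update_self]
          · rw [Function.update_of_ne, hv' q' (by omega)]
            intro heq
            exact hqq (dp_place_inj q'.2 hq heq).2)
    obtain ⟨i1, i2, i3, i4⟩ := this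
    refine ⟨i1, i2, fun P' hP' q => ?_⟩
    by_cases hPP : P' = P
    · subst hPP; exact i4 q q.2
    · exact i3 P' (by omega) q
  obtain ⟨c1, f1, v1⟩ := H1
  rw [run_loop _ (hpow σ₁.arr (f1 2 (by norm_num)) env) h.pow_lt]
  have H2 := iter_induction (f := fun i τ => (Cmd.put res (.loc 0)
      (.sum en (.get 7 (.loc 1 * en + .loc 0) * .get 0 (eoff + .loc 0)))).run M (i :: env) τ)
    (σ := σ₁) (n := N ^ k) (fun P' (τ : Store) => τ.coins = σ.coins ∧ (∀ x, x ≠ res → τ.arr x = σ₁.arr x) ∧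
      ∀ P < P', τ.arr res P = A.value w (digits k N P)) ⟨c1, fun _ _ => rfl, by simp⟩ (by
      rintro P hP τ ⟨hc, hτ, hv⟩
      have h0 : τ.arr 0 = σ.arr 0 := by rw [hτ 0 (by omega), f1 0 (by norm_num)]
      have hen' : ∀ env, en.eval M τ.arr env = n := hen _ h0
      have heoff' : ∀ env, eoff.eval M τ.arr env = off := heoff _ h0
      have e1 : (Expr.sum en (.get 7 (.loc 1 * en + .loc 0) * .get 0 (eoff + .loc 0))).eval M τ.arr
          (P :: env) = A.value w (digits k N P) := by
        rw [eval_sum _ _ _ _ (by rwa [hen']), hen', Finset.sum_range, Automaton.value]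
        refine Finset.sum_congr rfl fun q _ => ?_
        have hs : (Expr.get 0 (eoff + .loc 0)).eval M τ.arr ((q : ℕ) :: P :: env) = A.startBit q := by
          rw [eval_get, eval_add, heoff', h0, eval_loc_zero, hA.start]
        have hb : A.startBit q ≤ 1 := hbit _
        rw [eval_mul _ _ _ (by rw [hs]; omega), hs, eval_get, eval_add,
          eval_mul _ _ _ (by rwa [hen']), hen', eval_loc_one, eval_loc_zero, hτ 7 (by omega),
          v1 P hP q, mul_comm, Nat.cast_id]
      simp only [Cmd.run]
      rw [e1, eval_loc_zero]
      refine ⟨hc, fun x hx => ?_, fun P' hP' => ?_⟩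
      · rw [Store.put_arr_of_ne _ _ _ hx, hτ x hx]
      · rw [Store.put_arr_self]
        by_cases hPP : P' = P
        · subst hPP; rw [Function.update_self]
        · rw [Function.update_of_ne hPP, hv P' (by omega)])
  obtain ⟨i1, i2, i3⟩ := H2
  exact ⟨i1, fun x hx hx' => by rw [i2 x hx', f1 x hx], i3⟩

end Spec

end Multitape

/-! # The algorithm: random weights -/

namespace LoopLang

/-- The number whose binary digits are the first `n` values of `c`. -/
def bitsVal (c : ℕ → Bool) : ℕ → ℕ
  | 0 => 0
  | n + 1 => bitsVal c n + bitsVal c n + (c n).toNat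

theorem bitsVal_lt (c : ℕ → Bool) (n : ℕ) : bitsVal c n < 2 ^ n := by
  induction n with
  | zero => simp [bitsVal]
  | succ n ih =>
    have := Bool.toNat_le (c n)
    rw [bitsVal, pow_succ]
    omega

theorem bitsVal_inj {c c' : ℕ → Bool} {n : ℕ} (h : bitsVal c n = bitsVal c' n) :
    ∀ j < n, c j = c' j := by
  induction n with
  | zero => simp
  | succ n ih =>
    rw [bitsVal, bitsVal] at h
    have h1 := Bool.toNat_le (c n)
    have h2 := Bool.toNat_le (c' n)
    intro j hj
    rcases Nat.lt_succ_iff_lt_or_eq.1 hj with hj | rfl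
    · exact ih (by omega) j hj
    · have : (c j).toNat = (c' j).toNat := by omega
      revert this
      cases c j <;> cases c' j <;> simp

end LoopLang

namespace Multitape

open LoopLang Finset

/-- Computes the powers of the length of the input. -/
def powCmd (k : ℕ) : Cmd :=
  .seq (.put 2 0 1) (.loop (.num k) (.put 2 (.loc 0 + 1) (.get 2 (.loc 0) * eN)))

/-- Computes the number of bits of the random weights. -/
def bitsCmd : Cmd :=
  .seq (.put 3 0 0) (.seq (.put 3 1 1) (.loop (.bnd - 1)
    (.ite (eN + eN - .get 3 1) (.seq (.put 3 1 (.get 3 1 + .get 3 1)) (.put 3 0 (.get 3 0 + 1)))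
      .skip)))

/-- Tosses the coins for the random weights. -/
def tossCmd : Cmd :=
  .loop (.bnd - 1) (.seq (.put 4 (.loc 0) 0) (.loop (.get 3 0)
    (.seq (.toss 5 0) (.put 4 (.loc 1) (.get 4 (.loc 1) + .get 4 (.loc 1) + .get 5 0)))))

/-- Removes all restrictions on the letters. -/
def limCmd (k : ℕ) : Cmd := .loop (.num k * eN) (.put 6 (.loc 0) 0)

/-! ### Correctness of the preparations -/

section Spec

variable {k N M : ℕ} {σ : Store}

theorem run_powCmd (h0 : σ.arr 0 0 = N) (hN : N < M) (hk : k < M) (env : List ℕ) :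
    (∀ i ≤ k, ((powCmd k).run M env σ).arr 2 i = N ^ i) ∧
    (∀ x, x ≠ 2 → ((powCmd k).run M env σ).arr x = σ.arr x) ∧
    ((powCmd k).run M env σ).coins = σ.coins := by
  rw [powCmd, run_seq, run_loop (m := k) _ rfl hk]
  refine iter_induction (fun i (τ : Store) => (∀ i' ≤ i, τ.arr 2 i' = N ^ i') ∧
    (∀ x, x ≠ 2 → τ.arr x = σ.arr x) ∧ τ.coins = σ.coins) ⟨?_, ?_, rfl⟩ ?_
  · intro i' hi'
    obtain rfl : i' = 0 := by omega
    simp [Cmd.run, Store.put_arr_self]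
  · intro x hx
    exact Store.put_arr_of_ne _ _ _ hx
  · rintro i hi τ ⟨h2, hx, hc⟩
    have hN' : (eN).eval M τ.arr (i :: env) = N := by
      rw [eN, eval_get, hx 0 (by norm_num)]; exact h0
    simp only [Cmd.run]
    rw [eval_mul _ _ _ (by rwa [hN']), hN', eval_add, eval_get, eval_loc_zero, eval_one, h2 i le_rfl]
    refine ⟨fun i' hi' => ?_, fun x hx' => ?_, hc⟩
    · rw [Store.put_arr_self]
      by_cases h : i' = i + 1
      · subst h; rw [Function.update_self, pow_succ]
      · rw [Function.update_of_ne h, h2 i' (by omega)]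
    · rw [Store.put_arr_of_ne _ _ _ hx', hx x hx']

/-- The interval from `2 * N` to `4 * N` contains only one power of two, so repeated doubling must
stop at `b`. -/
theorem run_bitsCmd {b : ℕ} (h0 : σ.arr 0 0 = N) (hN : 0 < N) (hM : 4 * N ≤ M)
    (hb : 2 * N ≤ 2 ^ b) (hb' : 2 ^ b < 4 * N) (env : List ℕ) :
    (bitsCmd.run M env σ).arr 3 0 = b ∧
    (∀ x, x ≠ 3 → (bitsCmd.run M env σ).arr x = σ.arr x) ∧
    (bitsCmd.run M env σ).coins = σ.coins := by
  rw [bitsCmd, run_seq, run_seq, run_loop (m := M - 1) _ rfl (by omega)]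
  have := iter_induction (f := fun i τ => (Cmd.ite (eN + eN - .get 3 1)
      (.seq (.put 3 1 (.get 3 1 + .get 3 1)) (.put 3 0 (.get 3 0 + 1))) .skip).run M (i :: env) τ)
    (σ := (Cmd.put 3 1 1).run M env ((Cmd.put 3 0 0).run M env σ)) (n := M - 1)
    (fun i (τ : Store) => (∃ b', τ.arr 3 0 = b' ∧ τ.arr 3 1 = 2 ^ b' ∧ 2 ^ b' < 4 * N ∧
      (2 * N ≤ 2 ^ b' ∨ b' = i)) ∧
      (∀ x, x ≠ 3 → τ.arr x = σ.arr x) ∧ τ.coins = σ.coins) ⟨⟨0, ?_, ?_, ?_, ?_⟩, ?_, rfl⟩ ?_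
  · obtain ⟨⟨b', e1, e2, e3, e4⟩, i2, i3⟩ := this
    refine ⟨?_, i2, i3⟩
    rw [e1]
    -- The rounds suffice: otherwise there were `b' = M - 1` doublings, contrary to `b' < 2 ^ b' < 4
    -- * N ≤ M`.
    have h4 : 2 * N ≤ 2 ^ b' := by
      rcases e4 with e4 | e4
      · exact e4
      · have := Nat.lt_two_pow_self (n := b')
        omega
    refine le_antisymm (not_lt.1 fun hlt => ?_) (not_lt.1 fun hlt => ?_)
    · have := Nat.pow_le_pow_right (n := 2) (by norm_num) (show b + 1 ≤ b' from hlt)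
      rw [pow_succ] at this
      omega
    · have := Nat.pow_le_pow_right (n := 2) (by norm_num) (show b' + 1 ≤ b from hlt)
      rw [pow_succ] at this
      omega
  · simp [Cmd.run, Store.put_arr_self]
  · simp [Cmd.run, Store.put_arr_self]
  · simp; omega
  · exact .inr rfl
  · intro x hx
    simp only [Cmd.run]
    rw [Store.put_arr_of_ne _ _ _ hx, Store.put_arr_of_ne _ _ _ hx]
  · rintro i hi τ ⟨⟨b', e1, e2, e3, e4⟩, hx, hc⟩
    have hN' : (eN).eval M τ.arr (i :: env) = N := by
      rw [eN, eval_get, hx 0 (by norm_num)]; exact h0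
    simp only [Cmd.run, eval_sub, eval_add, hN', eval_get, eval_one, eval_zero, e2]
    split
    · exact ⟨⟨b', e1, e2, e3, .inl (by omega)⟩, hx, hc⟩
    · refine ⟨⟨b' + 1, ?_, ?_, by rw [pow_succ]; omega, ?_⟩, fun x hx' => ?_, hc⟩
      · simp [Store.put_arr_self, e1]
      · simp [Store.put_arr_self, pow_succ, mul_two]
      · rcases e4 with e4 | e4 <;> omega
      · rw [Store.put_arr_of_ne _ _ _ hx', Store.put_arr_of_ne _ _ _ hx', hx x hx']

theorem headD_drop (r : List Bool) (n : ℕ) : (r.drop n).headD false = r.getD n false := by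
  rw [List.headD_eq_head?_getD, List.head?_drop, List.getD_eq_getElem?_getD]

theorem run_tossCmd {b : ℕ} (hM : 0 < M) (h3 : σ.arr 3 0 = b) (hb : b < M) (env : List ℕ) :
    (∀ x < M - 1, (tossCmd.run M env σ).arr 4 x =
      bitsVal (fun j => σ.coins.getD (x * b + j) false) b) ∧
    (∀ x, x ≠ 4 → x ≠ 5 → (tossCmd.run M env σ).arr x = σ.arr x) := by
  -- A loop bound `M` would be reduced to `0`, so `M - 1` is the largest possible number of rounds.
  -- Weight `x` uses the coins from `x * b` to `x * b + b - 1`; missing coins count as `false`.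
  rw [tossCmd, run_loop (m := M - 1) _ rfl (by omega)]
  have := iter_induction (f := fun i τ => (Cmd.seq (.put 4 (.loc 0) 0) (.loop (.get 3 0)
    (.seq (.toss 5 0) (.put 4 (.loc 1) (.get 4 (.loc 1) + .get 4 (.loc 1) + .get 5 0))))).run M
      (i :: env) τ) (σ := σ) (n := M - 1)
    (fun y (τ : Store) => (∀ x < y, τ.arr 4 x =
      bitsVal (fun j => σ.coins.getD (x * b + j) false) b) ∧
      (∀ x, x ≠ 4 → x ≠ 5 → τ.arr x = σ.arr x) ∧ τ.coins = σ.coins.drop (y * b))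
    ⟨by simp, fun _ _ _ => rfl, by simp⟩ ?_
  · exact ⟨this.1, this.2.1⟩
  · rintro y hy τ ⟨h4, hx, hc⟩
    rw [run_seq, run_loop (m := b) _ ?_ hb]
    · have := iter_induction (f := fun i τ => (Cmd.seq (.toss 5 0) (.put 4 (.loc 1)
          (.get 4 (.loc 1) + .get 4 (.loc 1) + .get 5 0))).run M (i :: y :: env) τ)
        (σ := (Cmd.put 4 (.loc 0) 0).run M (y :: env) τ) (n := b)
        (fun j (ρ : Store) => (∀ x < y, ρ.arr 4 x =
          bitsVal (fun j => σ.coins.getD (x * b + j) false) b) ∧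
          ρ.arr 4 y = bitsVal (fun j => σ.coins.getD (y * b + j) false) j ∧
          (∀ x, x ≠ 4 → x ≠ 5 → ρ.arr x = σ.arr x) ∧ ρ.coins = σ.coins.drop (y * b + j))
        ⟨?_, ?_, ?_, hc⟩ ?_
      · obtain ⟨i1, i2, i3, i4⟩ := this
        refine ⟨fun x hx => ?_, i3, by rw [i4, add_one_mul]⟩
        rcases Nat.lt_succ_iff_lt_or_eq.1 hx with hx | rfl
        · exact i1 x hx
        · exact i2
      · intro x hxy
        simp only [Cmd.run, eval_loc_zero]
        rw [Store.put_arr_self, Function.update_of_ne hxy.ne, h4 x hxy]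
      · simp [Cmd.run, Store.put_arr_self, bitsVal]
      · intro x hx4 hx5
        simp only [Cmd.run]
        rw [Store.put_arr_of_ne _ _ _ hx4, hx x hx4 hx5]
      · rintro j hj ρ ⟨i1, i2, i3, i4⟩
        simp only [Cmd.run, eval_loc_one, eval_zero, eval_add, eval_get]
        rw [i4, headD_drop]
        refine ⟨fun x hxy => ?_, ?_, fun x hx4 hx5 => ?_, ?_⟩
        · rw [Store.put_arr_self, Function.update_of_ne hxy.ne,
            Store.put_arr_of_ne _ _ _ (by norm_num), i1 x hxy]
        · rw [Store.put_arr_self, Function.update_self, Store.put_arr_of_ne _ _ _ (by norm_num), i2,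
            Store.put_arr_self, Function.update_self, bitsVal]
          congr 1
          cases σ.coins.getD (y * b + j) false <;> rfl
        · rw [Store.put_arr_of_ne _ _ _ hx4, Store.put_arr_of_ne _ _ _ hx5, i3 x hx4 hx5]
        · rw [Store.put_coins, List.tail_drop, add_assoc]
    · simp only [Cmd.run, eval_get, eval_zero]
      rw [Store.put_arr_of_ne _ _ _ (by norm_num), hx 3 (by norm_num) (by norm_num), h3]

theorem run_limCmd (h0 : σ.arr 0 0 = N) (hN : N < M) (hk : k * N < M) (env : List ℕ) :
    (∀ i < k * N, ((limCmd k).run M env σ).arr 6 i = 0) ∧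
    (∀ x, x ≠ 6 → ((limCmd k).run M env σ).arr x = σ.arr x) := by
  have hN' : (eN).eval M σ.arr env = N := h0
  rw [limCmd, run_loop (m := k * N) _ (by rw [eval_mul _ _ _ (by rwa [hN']), hN', eval_num]) hk]
  refine iter_induction (fun i (τ : Store) => (∀ i' < i, τ.arr 6 i' = 0) ∧
    (∀ x, x ≠ 6 → τ.arr x = σ.arr x)) ⟨by simp, fun _ _ => rfl⟩ ?_
  rintro i hi τ ⟨h6, hx⟩
  simp only [Cmd.run, eval_zero, eval_loc_zero]
  refine ⟨fun i' hi' => ?_, fun x hx' => by rw [Store.put_arr_of_ne _ _ _ hx', hx x hx']⟩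
  rw [Store.put_arr_self]
  by_cases h : i' = i
  · subst h; simp
  · rw [Function.update_of_ne h, h6 i' (by omega)]

end Spec

end Multitape

/-! # The algorithm: comparison and search -/

namespace Multitape

open LoopLang Finset

/-- The place where the table of the second automaton starts. -/
def eOff (k : ℕ) : Expr :=
  .num (3 + k) + .get 0 1 + .get 0 1 + .get 0 1 * (ePre (.num k) * .get 0 1)

/-- Dynamic programming for both automata. -/
def dpsCmd (k : ℕ) : Cmd :=
  .seq (dpCmd k (.num (3 + k)) (.get 0 1) 8) (dpCmd k (eOff k) (.get 0 2) 9)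

/-- Zero if and only if the values of the two automata agree. -/
def eDiff (P : Expr) : Expr := .get 8 P - .get 9 P + (.get 9 P - .get 8 P)

/-- Looks for a place where the automata have different values. -/
def findCmd (k : ℕ) : Cmd :=
  .seq (.put 10 0 0) (.loop (.get 2 (.num k))
    (.ite (eDiff (.loc 0)) (.seq (.put 10 0 1) (.put 10 1 (.loc 0))) .skip))

/-- The comparison of the automata. -/
def compareCmd (k : ℕ) : Cmd :=
  .seq (powCmd k) (.seq bitsCmd (.seq tossCmd (.seq (limCmd k) (.seq (dpsCmd k) (findCmd k)))))

/-- Decides equivalence. -/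
def decideCmd (k : ℕ) : Cmd :=
  .seq (.put 1 0 1) (.ite (.get 0 1 + .get 0 2)
    (.seq (compareCmd k) (.put 1 1 (1 - .get 10 0))) (.put 1 1 1))

/-- The array `0` holds the encoding of a pair of automata, and the loops are long enough. -/
structure Input {k : ℕ} (x : AutomatonPair k) (N M : ℕ) (a : ℕ → ℕ) : Prop where
  pos : 0 < N
  length : a 0 = N
  states : a 1 = x.nA
  states' : a 2 = x.nB
  letters : ∀ i < k, a (3 + i) = letters x.m i
  table : Table x.A (3 + k) a
  table' : Table x.B (3 + k + x.nA + x.nA + x.nA * (pre x.m k * x.nA)) a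
  pow_lt : N ^ k < M
  tapes_lt : k < M
  length_le : 4 * N ≤ M
  pre_lt : pre x.m k < M
  weights_lt : pre x.m k * N < M
  tapes_mul_lt : k * N < M
  states_lt : x.nA < M
  states_lt' : x.nB < M
  table_lt : pre x.m k * x.nA < M

/-! ### Correctness of the comparison -/

section Spec

variable {k : ℕ} {x : AutomatonPair k} {N M : ℕ} {σ : Store}

theorem Input.length_lt {a : ℕ → ℕ} (h : Input x N M a) : N < M := by
  have := h.pos
  have := h.length_le
  omega

theorem Input.good {a : ℕ → ℕ → ℕ} (h : Input x N M (a 0)) (h2 : ∀ i ≤ k, a 2 i = N ^ i) :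
    Good x.m N M a :=
  ⟨h.pos, h.length, h.letters, h2, h.pow_lt, h.tapes_lt, h.length_lt, h.pre_lt⟩

theorem Input.eval_ePre {a : ℕ → ℕ → ℕ} (h : Input x N M (a 0)) (env : List ℕ) :
    (ePre (.num k)).eval M a env = pre x.m k := by
  rw [ePre, eval_sum _ _ _ _ (by exact h.tapes_lt), eval_num, pre]
  exact Finset.sum_congr rfl fun j hj => h.letters j (mem_range.1 hj)

theorem run_dpsCmd (h : Input x N M (σ.arr 0)) (h2 : ∀ i ≤ k, σ.arr 2 i = N ^ i)
    (hw : ∀ i < pre x.m k * N, σ.arr 4 i < M) (env : List ℕ) :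
    (∀ y, y ≠ 7 → y ≠ 8 → y ≠ 9 → ((dpsCmd k).run M env σ).arr y = σ.arr y) ∧
    (∀ P < N ^ k, ((dpsCmd k).run M env σ).arr 8 P =
      x.A.value (arrayWeight x.m N (σ.arr 4) (σ.arr 6)) (digits k N P)) ∧
    ∀ P < N ^ k, ((dpsCmd k).run M env σ).arr 9 P =
      x.B.value (arrayWeight x.m N (σ.arr 4) (σ.arr 6)) (digits k N P) := by
  rw [dpsCmd, run_seq]
  obtain ⟨-, f1, v1⟩ := (h.good h2).run_dpCmd (A := x.A) (off := 3 + k) (eoff := .num (3 + k))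
    (en := .get 0 1) h.table (fun _ _ _ => rfl) (fun a' ha env => by
      rw [← h.states, ← ha]; rfl) h.states_lt hw (res := 8) (by norm_num) env
  set τ := (dpCmd k (.num (3 + k)) (.get 0 1) 8).run M env σ
  have e0 : τ.arr 0 = σ.arr 0 := f1 0 (by norm_num) (by norm_num)
  have e2 : τ.arr 2 = σ.arr 2 := f1 2 (by norm_num) (by norm_num)
  have e4 : τ.arr 4 = σ.arr 4 := f1 4 (by norm_num) (by norm_num)
  have e6 : τ.arr 6 = σ.arr 6 := f1 6 (by norm_num) (by norm_num)
  have hI : Input x N M (τ.arr 0) := e0 ▸ h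
  obtain ⟨-, f2, v2⟩ := (hI.good (e2 ▸ h2)).run_dpCmd (A := x.B) (eoff := eOff k)
    (en := .get 0 2) hI.table' (fun a' ha env => by
      have hI' : Input x N M (a' 0) := ha ▸ hI
      have hs : (Expr.get 0 1).eval M a' env = x.nA := hI'.states
      have hp : (ePre (.num k) * .get 0 1).eval M a' env = pre x.m k * x.nA := by
        rw [eval_mul _ _ _ (by rw [hs]; exact h.states_lt), hs, hI'.eval_ePre]
      simp only [eOff, eval_add, hs, eval_num]
      rw [eval_mul _ _ _ (by rw [hp]; exact h.table_lt), hs, hp]) (fun a' ha env => by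
      rw [← hI.states', ← ha]; rfl) h.states_lt' (e4 ▸ hw) (res := 9) (by norm_num) env
  refine ⟨fun y h7 h8 h9 => ?_, fun P hP => ?_, fun P hP => ?_⟩
  · rw [f2 y h7 h9, f1 y h7 h8]
  · rw [f2 8 (by norm_num) (by norm_num), v1 P hP]
  · rw [v2 P hP, e4, e6]

theorem eval_eDiff (a : ℕ → ℕ → ℕ) (e : Expr) (env : List ℕ) :
    (eDiff e).eval M a env = 0 ↔ a 8 (e.eval M a env) = a 9 (e.eval M a env) := by
  simp only [eDiff, eval_add, eval_sub, eval_get]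
  omega

theorem run_findCmd (h2 : σ.arr 2 k = N ^ k) (hN : N ^ k < M) (env : List ℕ) :
    (∀ y, y ≠ 10 → ((findCmd k).run M env σ).arr y = σ.arr y) ∧
    ((((findCmd k).run M env σ).arr 10 0 = 0 ∧ ∀ P < N ^ k, σ.arr 8 P = σ.arr 9 P) ∨
      ((findCmd k).run M env σ).arr 10 0 = 1 ∧ ((findCmd k).run M env σ).arr 10 1 < N ^ k ∧
        σ.arr 8 (((findCmd k).run M env σ).arr 10 1) ≠
          σ.arr 9 (((findCmd k).run M env σ).arr 10 1)) := by
  rw [findCmd, run_seq, run_loop (m := N ^ k) _ ?_ hN]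
  · refine iter_induction (fun i (τ : Store) => (∀ y, y ≠ 10 → τ.arr y = σ.arr y) ∧
      ((τ.arr 10 0 = 0 ∧ ∀ P < i, σ.arr 8 P = σ.arr 9 P) ∨ τ.arr 10 0 = 1 ∧ τ.arr 10 1 < N ^ k ∧
        σ.arr 8 (τ.arr 10 1) ≠ σ.arr 9 (τ.arr 10 1))) ⟨?_, .inl ⟨?_, by simp⟩⟩ ?_
    · intro y hy
      exact Store.put_arr_of_ne _ _ _ hy
    · simp [Cmd.run, Store.put_arr_self]
    · rintro i hi τ ⟨hy, hd⟩
      rw [Cmd.run]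
      have key := eval_eDiff (M := M) τ.arr (.loc 0) (i :: env)
      rw [eval_loc_zero, hy 8 (by norm_num), hy 9 (by norm_num)] at key
      split
      · rename_i h0
        refine ⟨hy, hd.imp (fun hd => ⟨hd.1, fun P hP => ?_⟩) id⟩
        rcases Nat.lt_succ_iff_lt_or_eq.1 hP with hP | rfl
        · exact hd.2 P hP
        · exact key.1 h0
      · rename_i h0
        refine ⟨fun y hy' => ?_, .inr ?_⟩
        · simp only [Cmd.run]
          rw [Store.put_arr_of_ne _ _ _ hy', Store.put_arr_of_ne _ _ _ hy', hy y hy']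
        · have e0 : ((Cmd.seq (.put 10 0 1) (.put 10 1 (.loc 0))).run M (i :: env) τ).arr 10 0 = 1 := by
            simp [Cmd.run, Store.put_arr_self]
          have e1 : ((Cmd.seq (.put 10 0 1) (.put 10 1 (.loc 0))).run M (i :: env) τ).arr 10 1 = i := by
            simp [Cmd.run, Store.put_arr_self]
          rw [e0, e1]
          exact ⟨rfl, hi, fun hc => h0 (key.2 hc)⟩
  · simp only [Cmd.run, eval_get, eval_num]
    rw [Store.put_arr_of_ne _ _ _ (by norm_num), h2]

/-- The weights given by coin tosses. -/
def coinWeight (m : Fin k → ℕ) (N b : ℕ) (r : List Bool) (x : Letter fun i => Fin (m i)) (j : ℕ) : ℕ :=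
  bitsVal (fun l => r.getD (((pre m x.1 + x.2) * N + j) * b + l) false) b

theorem place_lt {m : Fin k → ℕ} (y : Letter fun i => Fin (m i)) {j : ℕ} (hj : j < N) :
    (pre m y.1 + y.2) * N + j < pre m k * N := by
  have h1 : pre m y.1 + y.2 + 1 ≤ pre m k := pre_add_lt y.1 y.2
  nlinarith

/-- Beside the verdict, the contents of the arrays are recorded from which the search continues. The
weights in memory agree with those given by the coins only at positions below `N`, and no others
occur, since all digits are below `N`. -/
theorem run_compareCmd (h : Input x N M (σ.arr 0)) {b : ℕ} (hb : 2 * N ≤ 2 ^ b)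
    (hb' : 2 ^ b < 4 * N) (env : List ℕ) :
    ∃ τ, (compareCmd k).run M env σ = τ ∧ (∀ y ∈ ({0, 1} : Set ℕ), τ.arr y = σ.arr y) ∧
    (∀ i ≤ k, τ.arr 2 i = N ^ i) ∧
    (∀ i < pre x.m k * N, τ.arr 4 i < M) ∧ (∀ i < k * N, τ.arr 6 i = 0) ∧
    (∀ y, ∀ j < N, arrayWeight x.m N (τ.arr 4) (τ.arr 6) y j = coinWeight x.m N b σ.coins y j) ∧
    ((τ.arr 10 0 = 0 ∧ ∀ P < N ^ k, x.A.value (coinWeight x.m N b σ.coins) (digits k N P) =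
        x.B.value (coinWeight x.m N b σ.coins) (digits k N P)) ∨
      τ.arr 10 0 = 1 ∧ τ.arr 10 1 < N ^ k ∧
        x.A.value (coinWeight x.m N b σ.coins) (digits k N (τ.arr 10 1)) ≠
        x.B.value (coinWeight x.m N b σ.coins) (digits k N (τ.arr 10 1))) := by
  refine ⟨_, rfl, ?_⟩
  simp only [compareCmd, run_seq]
  obtain ⟨p1, p2, p3⟩ := run_powCmd h.length h.length_lt h.tapes_lt env
  set σ₁ := (powCmd k).run M env σ
  have h₁ : Input x N M (σ₁.arr 0) := (p2 0 (by norm_num)) ▸ h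
  obtain ⟨b1, b2, b3⟩ := run_bitsCmd h₁.length h.pos h.length_le hb hb' env
  set σ₂ := bitsCmd.run M env σ₁
  have hbM : b < M := by
    have := Nat.lt_two_pow_self (n := b)
    have := h.length_le
    omega
  obtain ⟨t1, t2⟩ := run_tossCmd (by omega) b1 hbM env
  set σ₃ := tossCmd.run M env σ₂
  have e3 : ∀ y, y ≠ 2 → y ≠ 3 → y ≠ 4 → y ≠ 5 → σ₃.arr y = σ.arr y := fun y h2 h3 h4 h5 => by
    rw [t2 y h4 h5, b2 y h3, p2 y h2]
  have h₃ : Input x N M (σ₃.arr 0) := by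
    rw [e3 0 (by norm_num) (by norm_num) (by norm_num) (by norm_num)]
    exact h
  obtain ⟨l1, l2⟩ := run_limCmd h₃.length h.length_lt h.tapes_mul_lt env
  set σ₄ := (limCmd k).run M env σ₃
  have h₄ : Input x N M (σ₄.arr 0) := (l2 0 (by norm_num)) ▸ h₃
  have w4 : ∀ i < pre x.m k * N, σ₄.arr 4 i = bitsVal (fun l => σ.coins.getD (i * b + l) false) b := by
    intro i hi
    have := h.weights_lt
    rw [l2 4 (by norm_num), t1 i (by omega), b3, p3]
  have w4' : ∀ i < pre x.m k * N, σ₄.arr 4 i < M := by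
    intro i hi
    rw [w4 i hi]
    have := bitsVal_lt (fun l => σ.coins.getD (i * b + l) false) b
    have := h.length_le
    omega
  have w2 : ∀ i ≤ k, σ₄.arr 2 i = N ^ i := by
    intro i hi
    rw [l2 2 (by norm_num), t2 2 (by norm_num) (by norm_num), b2 2 (by norm_num), p1 i hi]
  obtain ⟨d1, d2, d3⟩ := run_dpsCmd h₄ w2 w4' env
  set σ₅ := (dpsCmd k).run M env σ₄
  obtain ⟨f1, f2⟩ := run_findCmd (σ := σ₅) (N := N)
    (by rw [d1 2 (by norm_num) (by norm_num) (by norm_num), w2 k le_rfl]) h.pow_lt env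
  have hf : ∀ y, y ≠ 7 → y ≠ 8 → y ≠ 9 → y ≠ 10 → ((findCmd k).run M env σ₅).arr y = σ₄.arr y :=
    fun y h7 h8 h9 h10 => by rw [f1 y h10, d1 y h7 h8 h9]
  set σ₆ := (findCmd k).run M env σ₅
  have hweight : ∀ y, ∀ j < N, arrayWeight x.m N (σ₄.arr 4) (σ₄.arr 6) y j =
      coinWeight x.m N b σ.coins y j := by
    intro y j hj
    have hlt : (y.1 : ℕ) * N + j < k * N := by
      have := y.1.2
      nlinarith
    rw [arrayWeight, if_pos (.inl (l1 _ hlt)), w4 _ (place_lt y hj)]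
    rfl
  have hval : ∀ {n : ℕ} (A : Automaton (fun i => Fin (x.m i)) (Fin n)) (P : ℕ),
      A.value (arrayWeight x.m N (σ₄.arr 4) (σ₄.arr 6)) (digits k N P) =
        A.value (coinWeight x.m N b σ.coins) (digits k N P) := fun A P =>
    A.value_congr fun y j hj => hweight y j (hj.trans (digits_lt h.pos P y.1))
  refine ⟨?_, fun i hi => ?_, fun i hi => ?_, fun i hi => ?_, ?_, ?_⟩
  · rintro y (rfl | rfl)
    · rw [hf _ (by norm_num) (by norm_num) (by norm_num) (by norm_num), l2 _ (by norm_num),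
        e3 _ (by norm_num) (by norm_num) (by norm_num) (by norm_num)]
    · rw [hf _ (by norm_num) (by norm_num) (by norm_num) (by norm_num), l2 _ (by norm_num),
        e3 _ (by norm_num) (by norm_num) (by norm_num) (by norm_num)]
  · rw [hf _ (by norm_num) (by norm_num) (by norm_num) (by norm_num), w2 i hi]
  · rw [hf _ (by norm_num) (by norm_num) (by norm_num) (by norm_num)]
    exact w4' i hi
  · rw [hf _ (by norm_num) (by norm_num) (by norm_num) (by norm_num), l1 i hi]
  · rwa [hf 4 (by norm_num) (by norm_num) (by norm_num) (by norm_num),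
      hf 6 (by norm_num) (by norm_num) (by norm_num) (by norm_num)]
  · refine f2.imp (fun hc => ⟨hc.1, fun P hP => ?_⟩) (fun hc => ⟨hc.1, hc.2.1, ?_⟩)
    · have := hc.2 P hP
      rwa [d2 P hP, d3 P hP, hval, hval] at this
    · have := hc.2.2
      rwa [d2 _ hc.2.1, d3 _ hc.2.1, hval, hval] at this

theorem output_decideCmd (h : Input x N M (σ.arr 0)) (hn : 0 < x.nA + x.nB) {b : ℕ}
    (hb : 2 * N ≤ 2 ^ b) (hb' : 2 ^ b < 4 * N) :
    (RAM.Store.output M ((decideCmd k).run M [] σ) = [1] ∧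
      ∀ P < N ^ k, x.A.value (coinWeight x.m N b σ.coins) (digits k N P) =
        x.B.value (coinWeight x.m N b σ.coins) (digits k N P)) ∨
    (RAM.Store.output M ((decideCmd k).run M [] σ) = [0] ∧
      ∃ P < N ^ k, x.A.value (coinWeight x.m N b σ.coins) (digits k N P) ≠
        x.B.value (coinWeight x.m N b σ.coins) (digits k N P)) := by
  have hM : 1 < M := by
    have := h.pos
    have := h.length_lt
    omega
  rw [decideCmd, run_seq, run_ite]
  have e0 : ((Cmd.put 1 0 1).run M [] σ).arr 0 = σ.arr 0 := Store.put_arr_of_ne _ _ _ (by norm_num)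
  have e1 : ((Cmd.put 1 0 1).run M [] σ).arr 1 0 = 1 := by simp [Cmd.run, Store.put_arr_self]
  have ec : ((Cmd.put 1 0 1).run M [] σ).coins = σ.coins := rfl
  set τ := (Cmd.put 1 0 1).run M [] σ
  have hif : (Expr.get 0 1 + .get 0 2).eval M τ.arr [] ≠ 0 := by
    show τ.arr 0 1 + τ.arr 0 2 ≠ 0
    rw [e0, h.states, h.states']
    omega
  rw [if_neg hif, run_seq]
  obtain ⟨ρ, hρ, r1, -, -, -, -, r2⟩ := run_compareCmd (σ := τ) (e0 ▸ h) hb hb' []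
  rw [hρ]
  have o1 : ρ.arr 1 0 = 1 := by rw [r1 1 (by simp), e1]
  have out : RAM.Store.output M ((Cmd.put 1 1 (1 - .get 10 0)).run M [] ρ) = [1 - ρ.arr 10 0] := by
    have : ((Cmd.put 1 1 (1 - .get 10 0)).run M [] ρ).arr 1 0 = 1 := by
      simp [Cmd.run, Store.put_arr_self, o1]
    rw [RAM.Store.output, this, Nat.mod_eq_of_lt hM]
    simp [Cmd.run, Store.put_arr_self]
  rw [out]
  rw [ec] at r2
  rcases r2 with ⟨f0, hall⟩ | ⟨f0, hP, hne⟩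
  · exact .inl ⟨by rw [f0], hall⟩
  · exact .inr ⟨by rw [f0], _, hP, hne⟩

/-- Without states the tables are empty, so the length of the input does not bound the number of
letters and `Input` may fail. Such automata are trivially equivalent and are answered directly. -/
theorem output_decideCmd_of_eq_zero (hM : 1 < M) (h : σ.arr 0 1 = 0) (h' : σ.arr 0 2 = 0) :
    RAM.Store.output M ((decideCmd k).run M [] σ) = [1] := by
  have hif : (Expr.get 0 1 + .get 0 2).eval M ((Cmd.put 1 0 1).run M [] σ).arr [] = 0 := by
    show ((Cmd.put 1 0 1).run M [] σ).arr 0 1 + ((Cmd.put 1 0 1).run M [] σ).arr 0 2 = 0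
    rw [Cmd.run, Store.put_arr_of_ne _ _ _ (by norm_num), h, h']
  rw [decideCmd, run_seq, run_ite, if_pos hif]
  have : ((Cmd.put 1 1 1).run M [] ((Cmd.put 1 0 1).run M [] σ)).arr 1 0 = 1 := by
    simp [Cmd.run, Store.put_arr_self]
  rw [RAM.Store.output, this, Nat.mod_eq_of_lt hM]
  simp [Cmd.run, Store.put_arr_self]

end Spec

end Multitape

/-! # The algorithm: search -/

namespace Multitape

open LoopLang Finset

/-- Fixes the letter at a position of a tape and compares the automata. -/
def tryCmd (k : ℕ) : Cmd :=
  .seq (.put 6 (.loc 2 * eN + .loc 1) (.loc 0 + 1)) (.seq (dpsCmd k)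
    (.ite (eDiff (.get 10 1)) (.put 11 0 (.loc 0 + 1)) .skip))

/-- Fixes the letter at a position of a tape such that the automata still differ. -/
def fixCmd (k : ℕ) : Cmd :=
  .seq (.put 11 0 0) (.seq (.loop (eM (.loc 1)) (tryCmd k))
    (.put 6 (.loc 1 * eN + .loc 0) (.get 11 0)))

/-- Fixes all letters. -/
def fixAllCmd (k : ℕ) : Cmd :=
  .loop (.num k) (.loop (eDigit (.get 10 1) (.loc 0)) (fixCmd k))

/-- Appends a number to the output. -/
def emitCmd (e : Expr) : Cmd := .seq (.put 12 0 (.get 12 0 + 1)) (.put 1 (.get 12 0) e)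

/-- Writes the length of a word and its letters. -/
def emitWordCmd : Cmd :=
  .seq (emitCmd (eDigit (.get 10 1) (.loc 0))) (.loop (eDigit (.get 10 1) (.loc 0))
    (emitCmd (.get 6 (.loc 1 * eN + (eDigit (.get 10 1) (.loc 1) - 1 - .loc 0)) - 1)))

/-- Writes the tuple of words. -/
def emitAllCmd (k : ℕ) : Cmd :=
  .seq (.put 12 0 0) (.seq (.loop (.num k) emitWordCmd) (.put 1 0 (.get 12 0)))

/-- Searches a tuple with different multiplicities. -/
def searchCmd (k : ℕ) : Cmd := .seq (compareCmd k) (.seq (fixAllCmd k) (emitAllCmd k))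

section Value

variable {k : ℕ} {x : AutomatonPair k} {N M : ℕ}

theorem value_eq_sum_arrayWeight {n : ℕ} {m : Fin k → ℕ}
    (A : Automaton (fun i => Fin (m i)) (Fin n)) {t lim : ℕ → ℕ} {p : Fin k → ℕ} {i : Fin k} {j : ℕ}
    (hp : ∀ i, p i ≤ N) (hj : j < p i) (h0 : lim (i * N + j) = 0) :
    A.value (arrayWeight m N t lim) p =
      ∑ c : Fin (m i), A.value (arrayWeight m N t (Function.update lim (i * N + j) (c + 1))) p := by
  -- The place `i * N + j'` determines tape and position only for `j' < N`; beyond that, where no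
  -- letter occurs, the old weights are kept.
  rw [A.value_eq_sum (i := i) (j := j) (w' := fun c y j' => if j' < N then
    arrayWeight m N t (Function.update lim (i * N + j) (c + 1)) y j' else arrayWeight m N t lim y j')
    hj]
  · exact Finset.sum_congr rfl fun c _ => A.value_congr fun y j' hj' =>
      if_pos (hj'.trans_le (hp y.1))
  · intro c y j' hne
    split
    · rename_i hj'
      have : (y.1 : ℕ) * N + j' ≠ i * N + j := by
        intro heq
        obtain ⟨h1, h2⟩ := dp_place_inj hj' (hj.trans_le (hp i)) heq
        exact hne ⟨Fin.ext h1, h2⟩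
      rw [arrayWeight, arrayWeight, Function.update_of_ne this]
    · rfl
  · intro c
    rw [if_pos (hj.trans_le (hp i)), arrayWeight, arrayWeight]
    simp [h0]
  · intro c d hcd
    rw [if_pos (hj.trans_le (hp i)), arrayWeight, if_neg]
    have : (d : ℕ) ≠ c := fun h => hcd (Fin.ext h)
    simp only [Function.update_self]
    omega

end Value

/-! ### Correctness of the search -/

section Spec

variable {k : ℕ} {x : AutomatonPair k} {N M : ℕ} {σ : Store}

/-- The letters at the positions in `D` are fixed and the automata differ. -/
structure Stage (x : AutomatonPair k) (N M P : ℕ) (D : ℕ → ℕ → Prop) (τ : Store) : Prop where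
  input : Input x N M (τ.arr 0)
  pow : ∀ i ≤ k, τ.arr 2 i = N ^ i
  weights_lt : ∀ i < pre x.m k * N, τ.arr 4 i < M
  position_lt : P < N ^ k
  position : τ.arr 10 1 = P
  ne : x.A.value (arrayWeight x.m N (τ.arr 4) (τ.arr 6)) (digits k N P) ≠
    x.B.value (arrayWeight x.m N (τ.arr 4) (τ.arr 6)) (digits k N P)
  fixed : ∀ i : Fin k, ∀ j < digits k N P i, D i j → τ.arr 6 (i * N + j) ≠ 0
  free : ∀ i : Fin k, ∀ j < digits k N P i, ¬ D i j → τ.arr 6 (i * N + j) = 0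

theorem Stage.congr {P : ℕ} {D D' : ℕ → ℕ → Prop} (h : Stage x N M P D σ)
    (hD : ∀ i : Fin k, ∀ j < digits k N P i, D i j ↔ D' i j) : Stage x N M P D' σ :=
  { h with
    fixed := fun i j hj hd => h.fixed i j hj ((hD i j hj).2 hd)
    free := fun i j hj hd => h.free i j hj fun hc => hd ((hD i j hj).1 hc) }

theorem Stage.good {P : ℕ} {D : ℕ → ℕ → Prop} (h : Stage x N M P D σ) : Good x.m N M σ.arr :=
  h.input.good h.pow

/-- If every letter at this position led to equal values, their sums would be equal too, contrary to
`Stage.ne`. Array `11` remembers the last letter, increased by one, for which the values differ; all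
attempts overwrite the same place of array `6`, so nothing has to be undone. -/
theorem Stage.run_fixCmd {P : ℕ} {D : ℕ → ℕ → Prop} (h : Stage x N M P D σ) {i : Fin k} {j : ℕ}
    (hj : j < digits k N P i) (hD : ¬ D i j) (env : List ℕ) :
    Stage x N M P (fun i' j' => D i' j' ∨ i' = i ∧ j' = j)
      ((fixCmd k).run M (j :: i :: env) σ) := by
  have hjN : j < N := hj.trans (digits_lt h.input.pos P i)
  let w : ℕ → Letter (fun i => Fin (x.m i)) → ℕ → ℕ := fun c =>
    arrayWeight x.m N (σ.arr 4) (Function.update (σ.arr 6) (i * N + j) (c + 1))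
  rw [fixCmd, run_seq, run_seq]
  have e : ∀ y, y ≠ 11 → ((Cmd.put 11 0 0).run M (j :: i :: env) σ).arr y = σ.arr y := fun y hy =>
    Store.put_arr_of_ne _ _ _ hy
  have e11 : ((Cmd.put 11 0 0).run M (j :: i :: env) σ).arr 11 0 = 0 := by
    simp [Cmd.run, Store.put_arr_self]
  set σ₁ := (Cmd.put 11 0 0).run M (j :: i :: env) σ
  have h₁ : Good x.m N M σ₁.arr := h.good.congr (e 0 (by norm_num)) (e 2 (by norm_num))
  rw [run_loop (m := x.m i) _ (by
      rw [h₁.eval_eM (i := i) rfl i.2]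
      simp [Multitape.letters]) (by
      have := h.good.letters_lt (i : ℕ)
      simpa [Multitape.letters] using this)]
  have key := iter_induction (f := fun c τ => (tryCmd k).run M (c :: j :: i :: env) τ) (σ := σ₁)
    (n := x.m i) (fun c (τ : Store) => (∀ y ∈ ({0, 2, 4, 10} : Set ℕ), τ.arr y = σ.arr y) ∧
      (∀ l, l ≠ i * N + j → τ.arr 6 l = σ.arr 6 l) ∧
      ((τ.arr 11 0 = 0 ∧ ∀ d < c, x.A.value (w d) (digits k N P) = x.B.value (w d) (digits k N P)) ∨
        ∃ d, τ.arr 11 0 = d + 1 ∧ x.A.value (w d) (digits k N P) ≠ x.B.value (w d) (digits k N P)))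
    ⟨?_, fun l _ => by rw [e 6 (by norm_num)], .inl ⟨e11, by simp⟩⟩ ?_
  · set τ := iter _ σ₁ (x.m i)
    obtain ⟨k1, k2, k3⟩ := key
    obtain ⟨d, hd, hne⟩ : ∃ d, τ.arr 11 0 = d + 1 ∧
        x.A.value (w d) (digits k N P) ≠ x.B.value (w d) (digits k N P) := by
      refine k3.resolve_left fun hc => h.ne ?_
      have hle : ∀ i, digits k N P i ≤ N := fun i => (digits_lt h.input.pos P i).le
      rw [value_eq_sum_arrayWeight x.A hle hj (h.free i j hj hD),
        value_eq_sum_arrayWeight x.B hle hj (h.free i j hj hD)]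
      exact Finset.sum_congr rfl fun c _ => hc.2 c c.2
    have h0 : τ.arr 0 = σ.arr 0 := k1 0 (by simp)
    have hN : (eN).eval M τ.arr (j :: i :: env) = N := by rw [eN, eval_get, h0]; exact h.input.length
    have hplace : (Expr.loc 1 * eN + .loc 0).eval M τ.arr (j :: i :: env) = i * N + j := by
      rw [eval_add, eval_mul _ _ _ (by rw [hN]; exact h.input.length_lt), hN]
      rfl
    have h6 : Function.update (τ.arr 6) (i * N + j) (d + 1) =
        Function.update (σ.arr 6) (i * N + j) (d + 1) := by
      ext l
      by_cases hl : l = i * N + j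
      · subst hl; simp
      · rw [Function.update_of_ne hl, Function.update_of_ne hl, k2 l hl]
    have hne6 : ∀ y, y ≠ 6 → ((Cmd.put 6 (.loc 1 * eN + .loc 0) (.get 11 0)).run M
        (j :: i :: env) τ).arr y = τ.arr y := fun y hy => Store.put_arr_of_ne _ _ _ hy
    have hself : ((Cmd.put 6 (.loc 1 * eN + .loc 0) (.get 11 0)).run M
        (j :: i :: env) τ).arr 6 = Function.update (σ.arr 6) (i * N + j) (d + 1) := by
      rw [Cmd.run, Store.put_arr_self, hplace, eval_get, eval_zero, hd, h6]
    set ρ := (Cmd.put 6 (.loc 1 * eN + .loc 0) (.get 11 0)).run M (j :: i :: env) τ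
    have hr : ∀ y ∈ ({0, 2, 4, 10} : Set ℕ), ρ.arr y = σ.arr y := fun y hy => by
      rw [hne6 y (by rintro rfl; simp at hy), k1 y hy]
    have h4 : ρ.arr 4 = σ.arr 4 := hr 4 (by simp)
    refine ⟨(hr 0 (by simp)) ▸ h.input, (hr 2 (by simp)) ▸ h.pow, h4 ▸ h.weights_lt, h.position_lt,
      (hr 10 (by simp)) ▸ h.position, ?_, fun i' j' hj' hd' => ?_, fun i' j' hj' hd' => ?_⟩
    · rw [h4, hself]
      exact hne
    · rw [hself]
      by_cases hl : (i' : ℕ) * N + j' = i * N + j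
      · rw [hl, Function.update_self]
        exact Nat.succ_ne_zero d
      · rw [Function.update_of_ne hl]
        exact h.fixed i' j' hj' (hd'.resolve_right fun hc => hl (by rw [hc.1, hc.2]))
    · rw [hself, Function.update_of_ne]
      · exact h.free i' j' hj' fun hc => hd' (.inl hc)
      · intro hl
        exact hd' (.inr (dp_place_inj (hj'.trans (digits_lt h.input.pos P i')) hjN hl))
  · intro y hy
    exact e y (by rintro rfl; simp at hy)
  · rintro c hc τ ⟨k1, k2, k3⟩
    rw [tryCmd, run_seq, run_seq, run_ite]
    have h0 : τ.arr 0 = σ.arr 0 := k1 0 (by simp)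
    have hN : (eN).eval M τ.arr (c :: j :: i :: env) = N := by
      rw [eN, eval_get, h0]; exact h.input.length
    have hplace : (Expr.loc 2 * eN + .loc 1).eval M τ.arr (c :: j :: i :: env) = i * N + j := by
      rw [eval_add, eval_mul _ _ _ (by rw [hN]; exact h.input.length_lt), hN]
      rfl
    have hne6 : ∀ y, y ≠ 6 → ((Cmd.put 6 (.loc 2 * eN + .loc 1) (.loc 0 + 1)).run M
        (c :: j :: i :: env) τ).arr y = τ.arr y := fun y hy => Store.put_arr_of_ne _ _ _ hy
    have hself : ((Cmd.put 6 (.loc 2 * eN + .loc 1) (.loc 0 + 1)).run M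
        (c :: j :: i :: env) τ).arr 6 = Function.update (σ.arr 6) (i * N + j) (c + 1) := by
      rw [Cmd.run, Store.put_arr_self, hplace, eval_add, eval_loc_zero, eval_one]
      ext l
      by_cases hl : l = i * N + j
      · subst hl; simp
      · rw [Function.update_of_ne hl, Function.update_of_ne hl, k2 l hl]
    set ρ := (Cmd.put 6 (.loc 2 * eN + .loc 1) (.loc 0 + 1)).run M (c :: j :: i :: env) τ
    have hr : ∀ y ∈ ({0, 2, 4, 10} : Set ℕ), ρ.arr y = σ.arr y := fun y hy => by
      rw [hne6 y (by rintro rfl; simp at hy), k1 y hy]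
    have h4 : ρ.arr 4 = σ.arr 4 := hr 4 (by simp)
    obtain ⟨d1, d2, d3⟩ := run_dpsCmd (σ := ρ) ((hr 0 (by simp)) ▸ h.input) ((hr 2 (by simp)) ▸ h.pow)
      (h4 ▸ h.weights_lt) (c :: j :: i :: env)
    rw [h4, hself] at d2 d3
    set θ := (dpsCmd k).run M (c :: j :: i :: env) ρ
    have ht : ∀ y ∈ ({0, 2, 4, 10} : Set ℕ), θ.arr y = σ.arr y := fun y hy => by
      rw [d1 y (by rintro rfl; simp at hy) (by rintro rfl; simp at hy) (by rintro rfl; simp at hy),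
        hr y hy]
    have ht6 : ∀ l, l ≠ i * N + j → θ.arr 6 l = σ.arr 6 l := fun l hl => by
      rw [d1 6 (by norm_num) (by norm_num) (by norm_num), hself, Function.update_of_ne hl]
    have ht11 : θ.arr 11 = τ.arr 11 := by
      rw [d1 11 (by norm_num) (by norm_num) (by norm_num), hne6 11 (by norm_num)]
    have hpos : (Expr.get 10 1).eval M θ.arr (c :: j :: i :: env) = P := by
      rw [eval_get, ht 10 (by simp)]
      exact h.position
    have hdiff := eval_eDiff (M := M) θ.arr (.get 10 1) (c :: j :: i :: env)
    rw [hpos, d2 P h.position_lt, d3 P h.position_lt] at hdiff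
    split
    · rename_i hz
      refine ⟨ht, ht6, ?_⟩
      simp only [Cmd.run]
      rw [ht11]
      refine k3.imp (fun hk => ⟨hk.1, fun d hd => ?_⟩) id
      rcases Nat.lt_succ_iff_lt_or_eq.1 hd with hd | rfl
      · exact hk.2 d hd
      · exact hdiff.1 hz
    · rename_i hz
      simp only [Cmd.run]
      refine ⟨fun y hy => ?_, fun l hl => ?_, .inr ⟨c, ?_, fun hc => hz (hdiff.2 hc)⟩⟩
      · rw [Store.put_arr_of_ne _ _ _ (by rintro rfl; simp at hy), ht y hy]
      · rw [Store.put_arr_of_ne _ _ _ (by norm_num), ht6 l hl]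
      · simp [Store.put_arr_self]

theorem Stage.run_fixAllCmd {P : ℕ} (h : Stage x N M P (fun _ _ => False) σ) (env : List ℕ) :
    Stage x N M P (fun _ _ => True) ((fixAllCmd k).run M env σ) := by
  rw [fixAllCmd, run_loop (m := k) _ rfl h.input.tapes_lt]
  refine Stage.congr (D := fun i _ => i < k) ?_ fun i j _ => by simp
  refine iter_induction (fun i' τ => Stage x N M P (fun i _ => i < i') τ) (h.congr (by simp)) ?_
  intro i hi τ hτ
  rw [run_loop (m := digits k N P ⟨i, hi⟩) _
    (hτ.good.eval_eDigit (i := ⟨i, hi⟩) (e := .get 10 1) (e' := .loc 0) (env := i :: env) hτ.position rfl)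
    ((digits_lt hτ.input.pos P _).trans hτ.input.length_lt)]
  refine Stage.congr (D := fun i' j' => i' < i ∨ i' = i ∧ j' < digits k N P ⟨i, hi⟩) ?_ ?_
  · refine iter_induction (fun j τ => Stage x N M P (fun i' j' => i' < i ∨ i' = i ∧ j' < j) τ)
      (hτ.congr (by simp)) ?_
    intro j hj ρ hρ
    refine (hρ.run_fixCmd (i := ⟨i, hi⟩) hj (by simp) env).congr fun i' j' _ => ?_
    simp only
    omega
  · intro i' j hj
    by_cases hii : (i' : ℕ) = i
    · subst hii
      simp [hj]
    · omega

/-- The output written so far. -/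
def outList (σ : Store) : List ℕ := (List.range (σ.arr 12 0)).map fun j => σ.arr 1 (j + 1)

/-- The counter in array `12` is advanced before `e` is evaluated, so the value of `e` must not
depend on that array. -/
theorem run_emitCmd (e : Expr) (env : List ℕ) (v : ℕ)
    (he : ∀ a : ℕ → ℕ → ℕ, (∀ y, y ≠ 12 → a y = σ.arr y) → e.eval M a env = v) :
    (∀ y, y ≠ 1 → y ≠ 12 → ((emitCmd e).run M env σ).arr y = σ.arr y) ∧
    outList ((emitCmd e).run M env σ) = outList σ ++ [v] := by
  rw [emitCmd, run_seq]
  have e1 : ∀ y, y ≠ 12 → ((Cmd.put 12 0 (.get 12 0 + 1)).run M env σ).arr y = σ.arr y :=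
    fun y hy => Store.put_arr_of_ne _ _ _ hy
  have e2 : ((Cmd.put 12 0 (.get 12 0 + 1)).run M env σ).arr 12 0 = σ.arr 12 0 + 1 := by
    simp [Cmd.run, Store.put_arr_self]
  set τ := (Cmd.put 12 0 (.get 12 0 + 1)).run M env σ
  refine ⟨fun y h1 h12 => ?_, ?_⟩
  · rw [Cmd.run, Store.put_arr_of_ne _ _ _ h1, e1 y h12]
  · have e3 : ((Cmd.put 1 (.get 12 0) e).run M env τ).arr 12 0 = σ.arr 12 0 + 1 := by
      rw [Cmd.run, Store.put_arr_of_ne _ _ _ (by norm_num), e2]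
    rw [outList, outList, e3, List.range_succ, List.map_append, List.map_singleton]
    simp only [Cmd.run, Store.put_arr_self, eval_get, eval_zero, e2, he _ e1, Function.update_self]
    congr 1
    refine List.map_congr_left fun j hj => ?_
    have := List.mem_range.1 hj
    rw [Function.update_of_ne (by omega), e1 1 (by norm_num)]

/-- The length and the letters of a word, as they are given by the array of fixed letters. -/
def wordCode (N P : ℕ) (lim : ℕ → ℕ) (i : ℕ) : List ℕ :=
  (P / N ^ i % N) ::
    (List.range (P / N ^ i % N)).map fun l => lim (i * N + (P / N ^ i % N - 1 - l)) - 1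

theorem Stage.run_emitAllCmd {P : ℕ} {D : ℕ → ℕ → Prop} (h : Stage x N M P D σ) :
    RAM.Store.output M ((emitAllCmd k).run M [] σ) =
      (List.range k).flatMap (wordCode N P (σ.arr 6)) := by
  have hNM := h.input.length_lt
  rw [emitAllCmd, run_seq, run_seq, run_loop (m := k) _ rfl h.input.tapes_lt]
  have e0 : ∀ y, y ≠ 12 → ((Cmd.put 12 0 0).run M [] σ).arr y = σ.arr y := fun y hy =>
    Store.put_arr_of_ne _ _ _ hy
  have e0' : outList ((Cmd.put 12 0 0).run M [] σ) = [] := by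
    simp [outList, Cmd.run, Store.put_arr_self]
  set σ₁ := (Cmd.put 12 0 0).run M [] σ
  -- evaluation depends on few arrays
  have hgood : ∀ a : ℕ → ℕ → ℕ, (∀ y, y ≠ 1 → y ≠ 12 → a y = σ.arr y) → Good x.m N M a :=
    fun a ha => h.good.congr (ha 0 (by norm_num) (by norm_num)) (ha 2 (by norm_num) (by norm_num))
  have hdig : ∀ a : ℕ → ℕ → ℕ, (∀ y, y ≠ 1 → y ≠ 12 → a y = σ.arr y) → ∀ (e : Expr) (env : List ℕ)
      (i : ℕ), i < k → e.eval M a env = i → (eDigit (.get 10 1) e).eval M a env = P / N ^ i % N := by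
    intro a ha e env i hi he
    exact (hgood a ha).eval_eDigit (i := ⟨i, hi⟩) (by
      rw [eval_get, ha 10 (by norm_num) (by norm_num)]; exact h.position) he
  have key := iter_induction (f := fun i τ => emitWordCmd.run M [i] τ) (σ := σ₁) (n := k)
    (fun i (τ : Store) => (∀ y, y ≠ 1 → y ≠ 12 → τ.arr y = σ.arr y) ∧
      outList τ = (List.range i).flatMap (wordCode N P (σ.arr 6)))
    ⟨fun y _ hy => e0 y hy, by simpa using e0'⟩ ?_
  · set τ := iter _ σ₁ k
    obtain ⟨k1, k2⟩ := key
    -- Each word takes its length plus one, hence at most `N` entries. The length of the output is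
    -- therefore below `M` and is not altered by the reduction in `Store.output`.
    have hlen : τ.arr 12 0 ≤ k * N := by
      have := congrArg List.length k2
      rw [outList, List.length_map, List.length_range, List.length_flatMap] at this
      rw [this]
      refine (List.sum_le_card_nsmul _ N fun n hn => ?_).trans (by simp)
      obtain ⟨i, -, rfl⟩ := List.mem_map.1 hn
      rw [wordCode, List.length_cons, List.length_map, List.length_range]
      exact Nat.mod_lt _ h.input.pos
    have hM : τ.arr 12 0 < M := hlen.trans_lt h.input.tapes_mul_lt
    have hout : ((Cmd.put 1 0 (.get 12 0)).run M [] τ).arr 1 =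
        Function.update (τ.arr 1) 0 (τ.arr 12 0) := by
      rw [Cmd.run, Store.put_arr_self]
      rfl
    rw [← k2, RAM.Store.output, hout, Function.update_self, Nat.mod_eq_of_lt hM, outList]
    exact List.map_congr_left fun j _ => Function.update_of_ne (Nat.succ_ne_zero j) _ _
  · rintro i hi τ ⟨k1, k2⟩
    rw [emitWordCmd, run_seq]
    obtain ⟨w1, w2⟩ := run_emitCmd (M := M) (σ := τ) (eDigit (.get 10 1) (.loc 0)) [i]
      (P / N ^ i % N) fun a ha =>
        hdig a (fun y h1 h12 => by rw [ha y h12, k1 y h1 h12]) _ _ i hi rfl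
    set ρ := (emitCmd (eDigit (.get 10 1) (.loc 0))).run M [i] τ
    have hρ : ∀ y, y ≠ 1 → y ≠ 12 → ρ.arr y = σ.arr y := fun y h1 h12 => by
      rw [w1 y h1 h12, k1 y h1 h12]
    have hd : P / N ^ i % N < N := Nat.mod_lt _ h.input.pos
    rw [run_loop (m := P / N ^ i % N) _ (hdig ρ.arr hρ _ _ i hi rfl) (hd.trans hNM)]
    have := iter_induction (f := fun l θ => (emitCmd (.get 6 (.loc 1 * eN +
        (eDigit (.get 10 1) (.loc 1) - 1 - .loc 0)) - 1)).run M [l, i] θ) (σ := ρ)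
      (n := P / N ^ i % N) (fun l (θ : Store) => (∀ y, y ≠ 1 → y ≠ 12 → θ.arr y = σ.arr y) ∧
        outList θ = outList τ ++ (P / N ^ i % N) ::
          (List.range l).map fun l => σ.arr 6 (i * N + (P / N ^ i % N - 1 - l)) - 1)
      ⟨hρ, by simpa using w2⟩ ?_
    · refine ⟨this.1, ?_⟩
      rw [this.2, k2, List.range_succ, List.flatMap_append, List.flatMap_singleton]
      rfl
    · rintro l hl θ ⟨l1, l2⟩
      obtain ⟨v1, v2⟩ := run_emitCmd (M := M) (σ := θ) (.get 6 (.loc 1 * eN +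
        (eDigit (.get 10 1) (.loc 1) - 1 - .loc 0)) - 1) [l, i]
        (σ.arr 6 (i * N + (P / N ^ i % N - 1 - l)) - 1) fun a ha => by
          have ha' : ∀ y, y ≠ 1 → y ≠ 12 → a y = σ.arr y := fun y h1 h12 => by
            rw [ha y h12, l1 y h1 h12]
          have hN : (eN).eval M a [l, i] = N := (hgood a ha').length
          rw [eval_sub, eval_get, eval_add, eval_mul _ _ _ (by rwa [hN]), hN, eval_sub, eval_sub,
            hdig a ha' _ _ i hi (eval_loc_one M a [] l i), ha' 6 (by norm_num) (by norm_num)]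
          rfl
      refine ⟨fun y h1 h12 => by rw [v1 y h1 h12, l1 y h1 h12], ?_⟩
      rw [v2, l2, List.range_succ, List.map_append]
      simp

/-- Some tuple of nonzero weight has different multiplicities. As every position is fixed, a nonzero
weight forces each letter of the tuple to be the one recorded in array `6`; positions are counted
from the end, so the word is read off backwards. -/
theorem Stage.exists_mult_ne {P : ℕ} (h : Stage x N M P (fun _ _ => True) σ) :
    ∃ s, x.A.mult s ≠ x.B.mult s ∧
      (List.range k).flatMap (wordCode N P (σ.arr 6)) = encodeTuple s := by
  obtain ⟨s, hs, hne, hw⟩ := Multitape.exists_mult_ne h.ne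
  refine ⟨s, hne, ?_⟩
  have hrange : List.range k = (List.finRange k).map Fin.val := by simp
  rw [encodeTuple, hrange, List.flatMap_map]
  refine List.flatMap_congr fun i _ => ?_
  have hi : P / N ^ (i : ℕ) % N = (FreeMonoid.toList (s i)).length := (congrFun hs i).symm
  rw [wordCode, hi]
  congr 1
  refine List.ext_getElem (by simp) fun l hl _ => ?_
  rw [List.length_map, List.length_range] at hl
  rw [List.getElem_map, List.getElem_map, List.getElem_range]
  have hj : (FreeMonoid.toList (s i)).length - 1 - l < (FreeMonoid.toList (s i)).length := by omega
  have hwl := hw i _ hj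
  have hfix := h.fixed i _ (by rw [← hs]; exact hj) trivial
  rw [arrayWeight] at hwl
  have := (of_not_not fun hc => hwl (if_neg hc)).resolve_left hfix
  simp only at this
  rw [this]
  simp only [show (FreeMonoid.toList (s i)).length - 1 - ((FreeMonoid.toList (s i)).length - 1 - l) = l
    by omega]
  simp

theorem output_searchCmd (h : Input x N M (σ.arr 0)) {b : ℕ} (hb : 2 * N ≤ 2 ^ b)
    (hb' : 2 ^ b < 4 * N) {P : ℕ} (hP : P < N ^ k)
    (hne : x.A.value (coinWeight x.m N b σ.coins) (digits k N P) ≠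
      x.B.value (coinWeight x.m N b σ.coins) (digits k N P)) :
    ∃ s, x.A.mult s ≠ x.B.mult s ∧
      RAM.Store.output M ((searchCmd k).run M [] σ) = encodeTuple s := by
  rw [searchCmd, run_seq, run_seq]
  obtain ⟨τ, hτ, r0, r1, r2, r3, r4, r5⟩ := run_compareCmd h hb hb' []
  rw [hτ]
  obtain ⟨-, hP', hne'⟩ := r5.resolve_left fun hc => hne (hc.2 P hP)
  have hst : Stage x N M (τ.arr 10 1) (fun _ _ => False) τ := by
    refine ⟨(r0 0 (by simp)) ▸ h, r1, r2, hP', rfl, ?_, fun _ _ _ h => h.elim, fun i j hj _ => ?_⟩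
    · have hw : ∀ y, ∀ j < digits k N (τ.arr 10 1) y.1,
          arrayWeight x.m N (τ.arr 4) (τ.arr 6) y j = coinWeight x.m N b σ.coins y j :=
        fun y j hj => r4 y j (hj.trans (digits_lt h.pos _ _))
      rwa [x.A.value_congr hw, x.B.value_congr hw]
    · refine r3 _ ?_
      have := hj.trans (digits_lt h.pos _ _)
      have := i.2
      nlinarith
  have hst' := hst.run_fixAllCmd []
  obtain ⟨s, hs, hs'⟩ := hst'.exists_mult_ne
  exact ⟨s, hs, by rw [hst'.run_emitAllCmd, hs']⟩

end Spec

end Multitape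

/-! # The encoding of automata -/

namespace Multitape

open LoopLang Finset

section Lists

theorem length_flatMap_const {α β : Type*} (l : List α) (f : α → List β) {d : ℕ}
    (h : ∀ a ∈ l, (f a).length = d) : (l.flatMap f).length = l.length * d := by
  rw [List.length_flatMap, List.map_congr_left h]
  simp

theorem length_flatMap_finRange {k : ℕ} {β : Type*} (f : Fin k → List β) :
    ((List.finRange k).flatMap f).length = ∑ i, (f i).length := by
  rw [List.length_flatMap, ← List.ofFn_eq_map, List.sum_ofFn]

theorem getD_flatMap_finRange {k : ℕ} (f : Fin k → List ℕ) (i : Fin k) {j : ℕ}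
    (hj : j < (f i).length) :
    ((List.finRange k).flatMap f).getD
      (∑ l ∈ range i, (if h : l < k then (f ⟨l, h⟩).length else 0) + j) 0 = (f i).getD j 0 := by
  induction k with
  | zero => exact i.elim0
  | succ k ih =>
    rw [List.finRange_succ, List.flatMap_cons, List.flatMap_map]
    refine Fin.cases (fun hj => ?_) (fun i hj => ?_) i hj
    · simp only [Fin.val_zero, range_zero, sum_empty, zero_add]
      exact List.getD_append _ _ _ _ hj
    · rw [Fin.val_succ, Finset.sum_range_succ', List.getD_append_right _ _ _ _ (by simp; omega)]
      rw [← ih (fun i => f i.succ) i hj]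
      congr 1
      simp only [Nat.add_lt_add_iff_right, Nat.zero_lt_succ, dite_true]
      have : (f ⟨0, Nat.zero_lt_succ k⟩).length = (f 0).length := rfl
      rw [this]
      have : ∀ l, (if h : l < k then (f ⟨l + 1, Nat.succ_lt_succ h⟩).length else 0) =
        (if h : l < k then (f (Fin.succ ⟨l, h⟩)).length else 0) := fun _ => rfl
      simp only [this]
      omega

theorem getD_flatMap_const {n : ℕ} (f : Fin n → List ℕ) {d : ℕ} (hd : ∀ q, (f q).length = d)
    (q : Fin n) {j : ℕ} (hj : j < d) :
    ((List.finRange n).flatMap f).getD (q * d + j) 0 = (f q).getD j 0 := by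
  rw [← getD_flatMap_finRange f q (by rwa [hd])]
  congr 2
  rw [Finset.sum_congr rfl (g := fun _ => d)]
  · simp
  · intro l hl
    rw [dif_pos ((mem_range.1 hl).trans q.2), hd]

theorem getD_map_finRange {n : ℕ} (f : Fin n → ℕ) (q : Fin n) :
    ((List.finRange n).map f).getD q 0 = f q := by
  rw [List.getD_eq_getElem _ _ (by simp)]
  simp

end Lists

section Encode

variable {k n : ℕ} {m : Fin k → ℕ} (A : Automaton (fun i => Fin (m i)) (Fin n))

theorem sum_letters : ∑ i, m i = pre m k := by
  rw [pre, Finset.sum_range]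
  simp [letters]

theorem length_edges (p : Fin n) :
    ((List.finRange k).flatMap fun i => (List.finRange (m i)).flatMap fun a =>
      (List.finRange n).map fun q => A.edgeBit p ⟨i, a⟩ q).length = pre m k * n := by
  rw [length_flatMap_finRange, ← sum_letters, Finset.sum_mul]
  refine Finset.sum_congr rfl fun i _ => ?_
  rw [length_flatMap_const _ _ (d := n) (by simp)]
  simp

theorem encode_eq : A.encode = ((List.finRange n).map A.startBit) ++
    (((List.finRange n).map A.finalBit) ++
    (List.finRange n).flatMap fun p => (List.finRange k).flatMap fun i =>
      (List.finRange (m i)).flatMap fun a => (List.finRange n).map fun q =>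
        A.edgeBit p ⟨i, a⟩ q) := by
  rw [Automaton.encode, List.append_assoc]
  rfl

theorem length_encode : A.encode.length = n + n + n * (pre m k * n) := by
  rw [encode_eq, List.length_append, List.length_append,
    length_flatMap_const _ _ (d := pre m k * n) (fun p _ => length_edges A p)]
  simp
  omega

theorem table_of_getD {off : ℕ} {a : ℕ → ℕ}
    (h : ∀ j < A.encode.length, a (off + j) = A.encode.getD j 0) : Table A off a := by
  have hl := length_encode A
  have hpos : ∀ q : Fin n, ∀ l < pre m k * n, q * (pre m k * n) + l < n * (pre m k * n) := by
    intro q l hl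
    have := q.2
    nlinarith
  refine ⟨fun q => ?_, fun q => ?_, fun q i c q' => ?_⟩
  · rw [h _ (by omega), encode_eq, List.getD_append _ _ _ _ (by simp), getD_map_finRange]
  · rw [add_assoc, h _ (by omega), encode_eq, List.getD_append_right _ _ _ _ (by simp)]
    simp only [List.length_map, List.length_finRange, Nat.add_sub_cancel_left]
    rw [List.getD_append _ _ _ _ (by simp), getD_map_finRange]
  · have hin : (c : ℕ) * n + q' < m i * n := by
      have := c.2
      have := q'.2
      nlinarith
    have hmid : pre m i * n + (c * n + q') < pre m k * n := by
      have h1 : pre m i + c + 1 ≤ pre m k := pre_add_lt i c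
      have := q'.2
      nlinarith
    have hidx : (q * pre m k + (pre m i + c)) * n + q' =
        q * (pre m k * n) + (pre m i * n + (c * n + q')) := by ring
    have hidx' := hpos q _ hmid
    rw [hidx, add_assoc off, add_assoc off, h _ (by omega), encode_eq,
      List.getD_append_right _ _ _ _ (by simp; omega)]
    rw [List.length_map, List.length_finRange,
      List.getD_append_right _ _ _ _ (by simp; omega), List.length_map, List.length_finRange,
      show n + n + (q * (pre m k * n) + (pre m i * n + (c * n + q'))) - n - n =
        q * (pre m k * n) + (pre m i * n + (c * n + q')) by omega,
      getD_flatMap_const _ (length_edges A) q hmid]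
    have hlen : ∀ i : Fin k, ((List.finRange (m i)).flatMap fun a =>
        (List.finRange n).map fun q' => A.edgeBit q ⟨i, a⟩ q').length = m i * n := fun i => by
      rw [length_flatMap_const _ _ (d := n) (by simp)]
      simp
    have hpre : ∑ l ∈ range i, (if h : l < k then ((List.finRange (m ⟨l, h⟩)).flatMap fun a =>
        (List.finRange n).map fun q' => A.edgeBit q ⟨⟨l, h⟩, a⟩ q').length else 0) = pre m i * n := by
      rw [pre, Finset.sum_mul]
      refine Finset.sum_congr rfl fun l _ => ?_
      rw [letters]
      split
      · exact hlen _
      · simp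
    have := getD_flatMap_finRange (fun i => (List.finRange (m i)).flatMap fun a =>
      (List.finRange n).map fun q' => A.edgeBit q ⟨i, a⟩ q') i (j := c * n + q')
      (by rw [hlen]; exact hin)
    rw [hpre] at this
    rw [this, getD_flatMap_const _ (d := n) (by simp) c q'.2, getD_map_finRange]

end Encode

section Pair

variable {k : ℕ} (x : AutomatonPair k)

theorem length_encode_pair : x.encode.length = 2 + k +
    (x.nA + x.nA + x.nA * (pre x.m k * x.nA)) + (x.nB + x.nB + x.nB * (pre x.m k * x.nB)) := by
  rw [AutomatonPair.encode, List.length_cons, List.length_cons, List.length_append,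
    List.length_append, length_encode, length_encode, List.length_ofFn]
  omega

/-- Each quantity that must stay below `M` is at most a power `N ^ k`, a product of two numbers of
size at most `N + C`, or a small multiple of `N`, so an exponent `e ≥ k + 5` is enough. -/
theorem input_encode {M C e : ℕ} (hn : 0 < x.nA + x.nB) (hC : k + 5 ≤ C) (he : k + 5 ≤ e)
    (hM : M = (x.encode.length + C) ^ e) {a : ℕ → ℕ}
    (ha : ∀ j ≤ x.encode.length, a j = (x.encode.length :: x.encode).getD j 0) :
    Input x x.encode.length M a := by
  have hlen := length_encode_pair x
  have hlA := length_encode x.A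
  have hlB := length_encode x.B
  set N := x.encode.length with hN
  -- An automaton that has a state lists at least one table entry for every letter.
  have hpre : pre x.m k ≤ N := by
    rcases Nat.eq_zero_or_pos x.nA with h0 | h0
    · have hB : 0 < x.nB := by omega
      have : pre x.m k ≤ x.nB * (pre x.m k * x.nB) := by
        calc pre x.m k = 1 * (pre x.m k * 1) := by ring
          _ ≤ x.nB * (pre x.m k * x.nB) := by gcongr <;> exact hB
      omega
    · have : pre x.m k ≤ x.nA * (pre x.m k * x.nA) := by
        calc pre x.m k = 1 * (pre x.m k * 1) := by ring
          _ ≤ x.nA * (pre x.m k * x.nA) := by gcongr <;> exact h0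
      omega
  have hbase : 1 ≤ N + C := by omega
  have hpow : ∀ d, d ≤ k + 5 → (N + C) ^ d ≤ M := fun d hd => by
    rw [hM]
    exact Nat.pow_le_pow_right hbase (by omega)
  have h2 : (N + C) * (N + C) ≤ M := by
    rw [← pow_two]; exact hpow 2 (by omega)
  have hk1 : (N + C) ^ (k + 1) ≤ M := hpow _ (by omega)
  have hNC : N + C < M := by nlinarith
  have hpow_lt : N ^ k < M := by
    have h1 : N ^ k ≤ (N + C) ^ k := Nat.pow_le_pow_left (by omega) k
    have h3 : 0 < (N + C) ^ k := Nat.pow_pos hbase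
    rw [pow_succ] at hk1
    nlinarith
  have hg : ∀ j < N, a (j + 1) = x.encode.getD j 0 := fun j hj => by
    rw [ha _ hj, List.getD_cons_succ]
  have hbody : ∀ j, j + 2 < N →
      a (j + 3) = (List.ofFn x.m ++ (x.A.encode ++ x.B.encode)).getD j 0 := fun j hj => by
    rw [hg _ hj, AutomatonPair.encode, List.getD_cons_succ, List.getD_cons_succ]
  have htab : ∀ j, j + k + 2 < N → a (3 + k + j) = (x.A.encode ++ x.B.encode).getD j 0 :=
    fun j hj => by
      rw [show 3 + k + j = k + j + 3 by omega, hbody _ (by omega),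
        List.getD_append_right _ _ _ _ (by simp), List.length_ofFn, Nat.add_sub_cancel_left]
  refine ⟨by omega, ?_, ?_, ?_, fun i hi => ?_, table_of_getD _ fun j hj => ?_,
    table_of_getD _ fun j hj => ?_, hpow_lt, by omega, by nlinarith, by omega, by nlinarith,
    by nlinarith, by omega, by omega, by nlinarith⟩
  · rw [ha 0 (by omega)]
    rfl
  · rw [hg 0 (by omega), AutomatonPair.encode]
    rfl
  · rw [hg 1 (by omega), AutomatonPair.encode]
    rfl
  · rw [add_comm, hbody i (by omega), List.getD_append _ _ _ _ (by simpa), letters, dif_pos hi,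
      List.getD_eq_getElem _ _ (by simpa)]
    simp
  · rw [htab j (by omega), List.getD_append _ _ _ _ hj]
  · rw [show 3 + k + x.nA + x.nA + x.nA * (pre x.m k * x.nA) + j =
      3 + k + (x.A.encode.length + j) by omega, htab _ (by omega),
      List.getD_append_right _ _ _ _ (by omega), Nat.add_sub_cancel_left]

end Pair

end Multitape

/-! # Probabilities -/

namespace RAM

open LoopLang Finset

theorem half_le_coinProb {T : ℕ} {E : List Bool → Prop} (S : Finset (Fin T → Bool))
    (hS : 2 * #S ≤ 2 ^ T) (h : ∀ r ∉ S, E (List.ofFn r)) : 1 / 2 ≤ coinProb T E := by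
  classical
  have h1 : #(Sᶜ) ≤ Nat.card {r : Fin T → Bool // E (List.ofFn r)} := by
    rw [Nat.card_eq_fintype_card, Fintype.card_subtype]
    exact Finset.card_le_card fun r hr => by
      simpa using h r (Finset.mem_compl.1 hr)
  rw [Finset.card_compl] at h1
  have hc : Fintype.card (Fin T → Bool) = 2 ^ T := by simp
  rw [hc] at h1
  have h2 : 2 ^ T ≤ 2 * Nat.card {r : Fin T → Bool // E (List.ofFn r)} := by omega
  have h3 : (2 ^ T : ℚ) ≤ 2 * Nat.card {r : Fin T → Bool // E (List.ofFn r)} := by exact_mod_cast h2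
  rw [coinProb, div_le_div_iff₀ (by norm_num) (by positivity)]
  linarith

theorem coinProb_eq_one {T : ℕ} {E : List Bool → Prop} (h : ∀ r, E r) : coinProb T E = 1 := by
  have : Nat.card {r : Fin T → Bool // E (List.ofFn r)} = 2 ^ T := by
    rw [Nat.card_congr (Equiv.subtypeUnivEquiv fun r => h (List.ofFn r))]
    simp
  rw [coinProb, this]
  simp

/-- The numbers given by consecutive blocks of coin tosses. -/
def blocks (v b : ℕ) (r : List Bool) (y : Fin v) : Fin (2 ^ b) :=
  ⟨bitsVal (fun l => r.getD (y * b + l) false) b, bitsVal_lt _ _⟩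

theorem getD_ofFn {T : ℕ} (r : Fin T → Bool) {j : ℕ} (hj : j < T) :
    (List.ofFn r).getD j false = r ⟨j, hj⟩ := by
  rw [List.getD_eq_getElem _ _ (by simpa), List.getElem_ofFn]

/-- The values of the `v` blocks and the coins after them determine all the coins. So each tuple of
block values arises from at most `2 ^ (T - v * b)` outcomes, and an event of proportion one half in
the weights keeps this bound for the coins. -/
theorem card_blocks_le {v b T : ℕ} (hT : v * b ≤ T) (S : Finset (Fin v → Fin (2 ^ b)))
    (hS : 2 * #S ≤ (2 ^ b) ^ v) :
    2 * #{r : Fin T → Bool | blocks v b (List.ofFn r) ∈ S} ≤ 2 ^ T := by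
  have h1 : #{r : Fin T → Bool | blocks v b (List.ofFn r) ∈ S} ≤
      #(S ×ˢ (univ : Finset (Fin (T - v * b) → Bool))) := by
    refine Finset.card_le_card_of_injOn
      (fun r => (blocks v b (List.ofFn r), fun j => r ⟨v * b + j, by have := j.2; omega⟩)) ?_ ?_
    · intro r hr
      simpa using hr
    · intro r _ r' _ h
      obtain ⟨h1, h2⟩ := Prod.mk.inj h
      ext1 j
      by_cases hj : (j : ℕ) < v * b
      · have hb : 0 < b := Nat.pos_of_ne_zero fun h0 => by simp [h0] at hj
        have hy : (j : ℕ) / b < v := (Nat.div_lt_iff_lt_mul hb).2 hj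
        have h3 := congrArg Fin.val (congrFun h1 ⟨j / b, hy⟩)
        have h4 := bitsVal_inj h3 (j % b) (Nat.mod_lt _ hb)
        have h5 : (j : ℕ) / b * b + j % b = j := by rw [mul_comm]; exact Nat.div_add_mod _ _
        simp only [h5] at h4
        rwa [getD_ofFn r j.2, getD_ofFn r' j.2] at h4
      · have h3 := congrFun h2 ⟨j - v * b, by have := j.2; omega⟩
        simp only [show v * b + (j - v * b) = j by omega] at h3
        exact h3
  rw [Finset.card_product, Finset.card_univ, Fintype.card_fun, Fintype.card_bool,
    Fintype.card_fin] at h1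
  calc _ ≤ 2 * (#S * 2 ^ (T - v * b)) := Nat.mul_le_mul_left 2 h1
    _ = (2 * #S) * 2 ^ (T - v * b) := by ring
    _ ≤ (2 ^ b) ^ v * 2 ^ (T - v * b) := Nat.mul_le_mul_right _ hS
    _ = 2 ^ T := by
      rw [← pow_mul, ← pow_add]
      congr 1
      rw [mul_comm b]
      omega

end RAM

/-! ### Success probability and assembly of the algorithms -/

namespace Multitape

open LoopLang RAM Finset

theorem mult_of_isEmpty {k : ℕ} {α : Fin k → Type} {Q : Type} [IsEmpty Q]
    (A : Automaton α Q) (s : Tuple α) : A.mult s = 0 := by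
  rw [Automaton.mult, Set.eq_empty_of_isEmpty (A.acceptingRuns s), Set.ncard_empty]

theorem multEquiv_of_eq_zero {k : ℕ} {x : AutomatonPair k} (hA : x.nA = 0) (hB : x.nB = 0) :
    MultEquiv x.A x.B := fun s => by
  have : IsEmpty (Fin x.nA) := by rw [hA]; infer_instance
  have : IsEmpty (Fin x.nB) := by rw [hB]; infer_instance
  rw [mult_of_isEmpty, mult_of_isEmpty]

theorem letter_eq_of_place_eq {k : ℕ} {m : Fin k → ℕ} {y y' : Letter fun i => Fin (m i)}
    (h : pre m y.1 + y.2 = pre m y'.1 + y'.2) : y = y' := by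
  have key : ∀ z z' : Letter fun i => Fin (m i), z.1 < z'.1 → pre m z.1 + z.2 < pre m z'.1 := by
    intro z z' hz
    have h1 := pre_mono (m := m) (show (z.1 : ℕ) + 1 ≤ z'.1 from hz)
    rw [pre, Finset.sum_range_succ] at h1
    have h2 : letters m z.1 = m z.1 := by simp [letters]
    have h3 := z.2.2
    rw [← pre] at h1
    omega
  obtain ⟨i, a⟩ := y
  obtain ⟨i', a'⟩ := y'
  rcases lt_trichotomy i i' with hi | rfl | hi
  · have := key ⟨i, a⟩ ⟨i', a'⟩ hi
    simp only at this h
    omega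
  · have : a = a' := Fin.ext (by simpa using h)
    rw [this]
  · have := key ⟨i', a'⟩ ⟨i, a⟩ hi
    simp only at this h
    omega

/-- If the automata are not equivalent, then the values differ for at least one half of the coin
tosses. -/
theorem exists_card_coinWeight_le {k : ℕ} {x : AutomatonPair k} (h : ¬ MultEquiv x.A x.B) {N b T : ℕ}
    (hN : x.nA + x.nB ≤ N) (hb : 2 * N ≤ 2 ^ b) (hT : (pre x.m k * N + 1) * b ≤ T) :
    ∃ P < N ^ k, ∃ S : Finset (Fin T → Bool), 2 * #S ≤ 2 ^ T ∧ ∀ r ∉ S,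
      x.A.value (coinWeight x.m N b (List.ofFn r)) (digits k N P) ≠
        x.B.value (coinWeight x.m N b (List.ofFn r)) (digits k N P) := by
  classical
  -- A short witness `s` is chosen before the coins are tossed. Only the failure at its tuple of
  -- lengths has to be estimated, so no union bound is needed.
  obtain ⟨s, hs, hne⟩ : ∃ s, ∑ i, lengths s i < x.nA + x.nB ∧ x.A.mult s ≠ x.B.mult s := by
    by_contra! hc
    exact h (multEquiv_of_agree x.A x.B fun s hs => hc s (by simpa using hs))
  have hlen : ∀ i, lengths s i < N := fun i =>
    lt_of_le_of_lt (Finset.single_le_sum (fun _ _ => Nat.zero_le _) (mem_univ i)) (hs.trans_le hN)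
  obtain ⟨P, hP, hPs⟩ := exists_digits_eq hlen
  -- The additional index makes the type nonempty, as `Fin.ofNat` demands; places with `j ≥ N` get
  -- irrelevant values.
  let φ : (Letter fun i => Fin (x.m i)) → ℕ → Fin (pre x.m k * N + 1) := fun y j =>
    Fin.ofNat _ ((pre x.m y.1 + y.2) * N + j)
  have hφ : ∀ y, ∀ j < N, (φ y j : ℕ) = (pre x.m y.1 + y.2) * N + j := fun y j hj =>
    Nat.mod_eq_of_lt ((place_lt y hj).trans (Nat.lt_succ_self _))
  have hW := card_value_eq_le φ hne (W := 2 ^ b) (by omega) (by positivity) (by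
    intro y j y' j' hj hj' heq
    have h1 := congrArg Fin.val heq
    rw [hφ y j (hj.trans (hlen _)), hφ y' j' (hj'.trans (hlen _))] at h1
    obtain ⟨h2, h3⟩ := dp_place_inj (hj.trans (hlen _)) (hj'.trans (hlen _)) h1
    exact ⟨letter_eq_of_place_eq h2, h3⟩)
  refine ⟨P, hP, _, card_blocks_le hT _ hW, fun r hr hc => hr ?_⟩
  have hw : ∀ y, ∀ j < lengths s y.1, coinWeight x.m N b (List.ofFn r) y j =
      (blocks (pre x.m k * N + 1) b (List.ofFn r) (φ y j) : ℕ) := fun y j hj => by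
    simp only [coinWeight, blocks, hφ y j (hj.trans (hlen _))]
  rw [hPs, x.A.value_congr hw, x.B.value_congr hw] at hc
  simpa using hc

theorem exists_pow_two {N : ℕ} (hN : 0 < N) : ∃ b, 2 * N ≤ 2 ^ b ∧ 2 ^ b < 4 * N := by
  refine ⟨Nat.log 2 (4 * N - 1), ?_, ?_⟩
  · have := Nat.lt_pow_succ_log_self (b := 2) (by norm_num) (4 * N - 1)
    rw [pow_succ] at this
    omega
  · have := Nat.pow_log_le_self 2 (x := 4 * N - 1) (by omega)
    omega

theorem encode_ne_nil {k : ℕ} (x : AutomatonPair k) : x.encode ≠ [] := List.cons_ne_nil _ _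

/-- A command is executed in polynomial time, with enough coin tosses. -/
theorem exists_program_encode (k : ℕ) (c : Cmd) :
    ∃ (P : Program) (p : Polynomial ℕ), ∀ x : AutomatonPair k, ∃ M, 1 < M ∧ ∀ r, ∃ σ : Store,
      σ.coins = r ∧ σ.arr 0 1 = x.nA ∧ σ.arr 0 2 = x.nB ∧
      (0 < x.nA + x.nB → Input x x.encode.length M (σ.arr 0) ∧
        ∀ b, 2 ^ b < 4 * x.encode.length →
          (pre x.m k * x.encode.length + 1) * b ≤ p.eval (inputSize x.encode)) ∧
      Outputs P x.encode r (p.eval (inputSize x.encode)) (Store.output M (c.run M [] σ)) := by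
  obtain ⟨P, p, C, hC, h⟩ := exists_program c (k + 5) (e := k + 5) (by omega)
  -- The added product is at least `M * M`, so the tape of coins is long enough for all blocks: both
  -- `pre x.m k * N + 1` and `b` are at most `M`.
  refine ⟨P, p + (.X + .C C) ^ (k + 5) * (.X + .C C) ^ (k + 5), fun x => ?_⟩
  refine ⟨(x.encode.length + C) ^ (k + 5), Nat.one_lt_pow (by omega) (by omega), fun r => ?_⟩
  obtain ⟨σ, hσ, hr, hout⟩ := h x.encode r (encode_ne_nil x)
  have hlen := length_encode_pair x
  refine ⟨σ, hr, ?_, ?_, fun hn => ?_, hout.mono ?_⟩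
  · rw [hσ 1 (by omega), AutomatonPair.encode]
    rfl
  · rw [hσ 2 (by omega), AutomatonPair.encode]
    rfl
  · have hI := input_encode x hn hC le_rfl rfl hσ
    refine ⟨hI, fun b hb => ?_⟩
    have hle := length_le_inputSize x.encode
    have h1 : (x.encode.length + C) ^ (k + 5) ≤ (inputSize x.encode + C) ^ (k + 5) :=
      Nat.pow_le_pow_left (by omega) _
    have h2 := hI.weights_lt
    have h3 := hI.length_le
    have h4 := Nat.lt_two_pow_self (n := b)
    simp only [Polynomial.eval_add, Polynomial.eval_mul, Polynomial.eval_pow, Polynomial.eval_X,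
      Polynomial.eval_C]
    calc (pre x.m k * x.encode.length + 1) * b ≤
          (inputSize x.encode + C) ^ (k + 5) * (inputSize x.encode + C) ^ (k + 5) :=
        Nat.mul_le_mul (by omega) (by omega)
      _ ≤ _ := Nat.le_add_left _ _
  · rw [Polynomial.eval_add]
    exact Nat.le_add_right _ _

/-- There is a program that decides multiplicity equivalence. -/
theorem exists_decide_program (k : ℕ) : ∃ (P : Program) (p : Polynomial ℕ), ∀ x : AutomatonPair k,
    (∀ r, ∃ y, Outputs P x.encode r (p.eval (inputSize x.encode)) y) ∧
    (MultEquiv x.A x.B →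
      outputProb P x.encode (p.eval (inputSize x.encode)) (fun y => y = [1]) = 1) ∧
    (¬ MultEquiv x.A x.B →
      1 / 2 ≤ outputProb P x.encode (p.eval (inputSize x.encode)) (fun y => y = [0])) := by
  obtain ⟨P, p, hP⟩ := exists_program_encode k (decideCmd k)
  refine ⟨P, p, fun x => ?_⟩
  obtain ⟨M, hM, h⟩ := hP x
  obtain ⟨b, hb, hb'⟩ := exists_pow_two (N := x.encode.length)
    (List.length_pos_iff.2 (encode_ne_nil x))
  refine ⟨fun r => ?_, fun heq => coinProb_eq_one fun r => ?_, fun hne => ?_⟩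
  · obtain ⟨σ, -, -, -, -, hout⟩ := h r
    exact ⟨_, hout⟩
  · obtain ⟨σ, hr, hA, hB, hI, hout⟩ := h r
    refine ⟨_, hout, ?_⟩
    rcases Nat.eq_zero_or_pos (x.nA + x.nB) with h0 | h0
    · exact output_decideCmd_of_eq_zero hM (by omega) (by omega)
    · refine (output_decideCmd (hI h0).1 h0 hb hb').elim And.left fun hc => ?_
      obtain ⟨-, P', -, hne⟩ := hc
      refine absurd ?_ hne
      -- Equal multiplicities give equal values for every choice of weights, so equivalent automata
      -- are accepted whatever the coins.
      rw [Automaton.value_eq, Automaton.value_eq]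
      simp only [heq _]
  · have h0 : 0 < x.nA + x.nB := Nat.pos_of_ne_zero fun h0 =>
      hne (multEquiv_of_eq_zero (by omega) (by omega))
    have hT : (pre x.m k * x.encode.length + 1) * b ≤ p.eval (inputSize x.encode) := by
      -- The bound on the number of coins does not involve the coins, so any sequence, here the
      -- empty one, yields it.
      obtain ⟨σ, -, -, -, hI, -⟩ := h []
      exact (hI h0).2 b hb'
    have hlen := length_encode_pair x
    obtain ⟨P', hP', S, hS, hval⟩ := exists_card_coinWeight_le hne (N := x.encode.length) (by omega)
      hb hT
    refine half_le_coinProb S hS fun r hr => ?_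
    obtain ⟨σ, hσ, -, -, hI, hout⟩ := h (List.ofFn r)
    refine ⟨_, hout, ?_⟩
    refine (output_decideCmd (hI h0).1 h0 hb hb').elim (fun hc => ?_) And.left
    rw [hσ] at hc
    exact absurd (hc.2 P' hP') (hval r hr)

/-- There is a program that finds a tuple with different multiplicities. -/
theorem exists_search_program (k : ℕ) :
    SearchInRandPolyTime (fun x : AutomatonPair k => x.encode)
      (fun x y => ∃ s, x.A.mult s ≠ x.B.mult s ∧ y = encodeTuple s) := by
  obtain ⟨P, p, hP⟩ := exists_program_encode k (searchCmd k)
  refine ⟨P, p, fun x r _ => ?_, fun x hx => ?_⟩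
  · obtain ⟨M, hM, h⟩ := hP x
    obtain ⟨σ, -, -, -, -, hout⟩ := h r
    exact ⟨_, hout⟩
  · obtain ⟨M, hM, h⟩ := hP x
    obtain ⟨b, hb, hb'⟩ := exists_pow_two (N := x.encode.length)
      (List.length_pos_iff.2 (encode_ne_nil x))
    have hne : ¬ MultEquiv x.A x.B := by
      obtain ⟨y, s, hs, -⟩ := hx
      exact fun hc => hs (hc s)
    have h0 : 0 < x.nA + x.nB := Nat.pos_of_ne_zero fun h0 =>
      hne (multEquiv_of_eq_zero (by omega) (by omega))
    have hT : (pre x.m k * x.encode.length + 1) * b ≤ p.eval (inputSize x.encode) := by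
      obtain ⟨σ, -, -, -, hI, -⟩ := h []
      exact (hI h0).2 b hb'
    have hlen := length_encode_pair x
    obtain ⟨P', hP', S, hS, hval⟩ := exists_card_coinWeight_le hne (N := x.encode.length) (by omega)
      hb hT
    refine half_le_coinProb S hS fun r hr => ?_
    obtain ⟨σ, hσ, -, -, hI, hout⟩ := h (List.ofFn r)
    exact ⟨_, hout, output_searchCmd (hI h0).1 hb hb' hP' (hσ ▸ hval r hr)⟩

end Multitape

theorem theorem3 (k : ℕ) :
    RAM.DecidableInRandPolyTime
      (fun x : Multitape.AutomatonPair k => x.encode)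
      (fun x => Multitape.MultEquiv x.A x.B) ∧
    RAM.DecidableInRandPolyTime
      (fun x : {x : Multitape.AutomatonPair k // x.A.IsDeterministic ∧ x.B.IsDeterministic} =>
        x.1.encode)
      (fun x => x.1.A.language = x.1.B.language) ∧
    RAM.SearchInRandPolyTime
      (fun x : Multitape.AutomatonPair k => x.encode)
      (fun x y => ∃ s, x.A.mult s ≠ x.B.mult s ∧ y = Multitape.encodeTuple s) := by
  obtain ⟨P, p, h⟩ := Multitape.exists_decide_program k
  refine ⟨⟨P, p, fun x r _ => (h x).1 r, fun x => (h x).2⟩, ⟨P, p, fun x r _ => (h x.1).1 r,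
    fun x => ?_⟩, Multitape.exists_search_program k⟩
  -- For deterministic automata the two equivalences coincide, so the program for multiplicities
  -- also serves for languages.
  have hx := (h x.1).2
  rwa [Multitape.Automaton.multEquiv_iff_language_eq x.2.1 x.2.2] at hx
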